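/- Let $\mathcal A=\mathbb C[a,b,c,d]/(ad-bc-1)$ be the function algebra of $SL(2,\mathbb C)$, with comultiplication $\Delta(T)=T\otimes T$ for $T=\begin{pmatrix}a&b\\c&d\end{pmatrix}$. Let $\mathcal M$ be the external algebra of $SL(2)$: the $\mathbb Z_2$-graded algebra generated by $\mathcal A$ (even) and odd generators $\theta^0,\theta^1,\theta^2$ that commute with $\mathcal A$ and anticommute with each other. Extend $\Delta$ to algebra homomorphisms $\Delta_L,\Delta_R:\mathcal M\to\mathcal M\otimes\mathcal M$ by $\Delta_R\theta^i=\theta^i\otimes 1$ and $$\begin{aligned}\Delta_L\theta^0&=(1+2bc)\otimes\theta^0-ac\otimes\theta^1+bd\otimes\theta^2,\\ \Delta_L\theta^1&=-2ab\otimes\theta^0+a^2\otimes\theta^1-b^2\otimes\theta^2,\\ \Delta_L\theta^2&=2cd\otimes\theta^0-c^2\otimes\theta^1+d^2\otimes\theta^2.\end{aligned}$$ A *graded bracket* on $\mathcal M$ is a $\mathbb C$-bilinear map $\{\,,\}:\mathcal M\times\mathcal M\to\mathcal M$ such that, for homogeneous $x,y,z$, $\deg\{x,y\}=\deg x+\deg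 y \bmod 2$, $\{x,y\}=(-1)^{\deg x\deg y+1}\{y,x\}$ and $\{xy,z\}=x\{y,z\}+(-1)^{\deg y\deg z}\{x,z\}y$. It is *graded Poisson* if moreover $(-1)^{\deg x\deg z}\{\{x,y\},z\}+(-1)^{\deg y\deg z}\{\{z,x\},y\}+(-1)^{\deg x\deg y}\{\{y,z\},x\}=0$. It is extended to $\mathcal M\otimes\mathcal M$ by $\{x\otimes y,z\otimes w\}=(-1)^{\deg y\deg z}(\{x,z\}\otimes yw+xz\otimes\{y,w\})$. It *prolongs the Sklyanin bracket* if $\{a,b\}=-ab$, $\{b,d\}=-bd$, $\{c,b\}=0$, $\{a,c\}=-ac$, $\{c,d\}=-cd$, $\{a,d\}=-2bc$. Consider the covariance conditions, for all $f,h\in\mathcal A$ and all $i,j$: (1) $\Delta\{f,h\}=\{\Delta f,\Delta h\}$; (2) $\Delta_{L,R}\{\theta^i,f\}=\{\Delta_{L,R}\theta^i,\Delta f\}$; (3) $\Delta_{L,R}\{\theta^i,\theta^j\}=\{\Delta_{L,R}\theta^i,\Delta_{L,R}\theta^j\}$. A bracket is *of the first order* if (1), (2) hold, and *of the second order* if (1),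 (3) hold. A *graded Poisson–Lie structure* on $\mathcal M$ is a graded Poisson bracket satisfying (1), (2), (3) for which each $\{\theta^i,\theta^j\}$ is quadratic in the forms, i.e. $\{\theta^i,\theta^j\}=\sum_{m,n}C^{ij}_{mn}\theta^m\theta^n$ with $C^{ij}_{mn}\in\mathcal A$. **Theorem.** There are exactly two graded Poisson–Lie structures on $\mathcal M$ prolonging the Sklyanin bracket. One has the brackets $\{\theta,t\}$ of type I, $$\begin{array}{lll}\{\theta^0,a\}=-2c\theta^1,&\{\theta^1,a\}=a\theta^1,&\{\theta^2,a\}=4c\theta^0-a\theta^2,\\ \{\theta^0,b\}=-2d\theta^1,&\{\theta^1,b\}=b\theta^1,&\{\theta^2,b\}=4d\theta^0-b\theta^2,\\ \{\theta^0,c\}=0,&\{\theta^1,c\}=-c\theta^1,&\{\theta^2,c\}=c\theta^2,\\ \{\theta^0,d\}=0,&\{\theta^1,d\}=-d\theta^1,&\{\theta^2,d\}=d\theta^2,\end{array}$$ the other one those of type II, $$\begin{array}{lll}\{\theta^0,a\}=0,&\{\theta^1,a\}=-a\theta^1,&\{\theta^2,a\}=a\theta^2,\\ \{\theta^0,b\}=0,&\{\theta^1,b\}=-b\theta^1,&\{\theta^2,b\}=b\theta^2,\\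 \{\theta^0,c\}=-2a\theta^2,&\{\theta^1,c\}=4a\theta^0+c\theta^1,&\{\theta^2,c\}=-c\theta^2,\\ \{\theta^0,d\}=-2b\theta^2,&\{\theta^1,d\}=4b\theta^0+d\theta^1,&\{\theta^2,d\}=-d\theta^2,\end{array}$$ and both have $$\{\theta^0,\theta^0\}=-2\theta^1\theta^2,\quad \{\theta^0,\theta^1\}=-2\theta^0\theta^1,\quad \{\theta^0,\theta^2\}=2\theta^0\theta^2,\quad \{\theta^1,\theta^1\}=\{\theta^1,\theta^2\}=\{\theta^2,\theta^2\}=0.\tag{$*$}$$ Moreover: (a) Every graded Poisson bracket of the first order that prolongs the Sklyanin bracket has $\{\theta,t\}$ of type I or of type II. (b) A graded bracket (Jacobi not assumed) that prolongs the Sklyanin bracket and for which all $\{\theta^i,a\},\{\theta^i,b\},\{\theta^i,c\},\{\theta^i,d\}$ lie in $\sum_j\mathcal A\theta^j$ is of the first order if and only if, for some $\eta\in\mathbb C$, $$\begin{array}{lll}\{\theta^0,a\}=\eta c\theta^1,&\{\theta^1,a\}=-(1+\eta)a\theta^1,&\{\theta^2,a\}=-2\eta c\theta^0+(1+\eta)a\theta^2,\\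 \{\theta^0,b\}=\eta d\theta^1,&\{\theta^1,b\}=-(1+\eta)b\theta^1,&\{\theta^2,b\}=-2\eta d\theta^0+(1+\eta)b\theta^2,\\ \{\theta^0,c\}=-(2+\eta)a\theta^2,&\{\theta^1,c\}=(4+2\eta)a\theta^0+(1+\eta)c\theta^1,&\{\theta^2,c\}=-(1+\eta)c\theta^2,\\ \{\theta^0,d\}=-(2+\eta)b\theta^2,&\{\theta^1,d\}=(4+2\eta)b\theta^0+(1+\eta)d\theta^1,&\{\theta^2,d\}=-(1+\eta)d\theta^2.\end{array}$$ Every $\eta\in\mathbb C$ occurs for some graded bracket prolonging the Sklyanin bracket. For such a bracket with parameter $\eta$, the Jacobi identities $\{\{\theta^i,f\},h\}+\{\{h,\theta^i\},f\}+\{\{f,h\},\theta^i\}=0$ ($f,h\in\mathcal A$, $i=0,1,2$) hold if and only if $\eta=0$ or $\eta=-2$; type I is $\eta=-2$ and type II is $\eta=0$. (c) A graded bracket that prolongs the Sklyanin bracket, with each $\{\theta^i,\theta^j\}$ quadratic in the forms, is of the second order if and only if it satisfies $(*)$. -/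

import Mathlib

open scoped TensorProduct

noncomputable section

namespace SL2Ext

/-! ### The function algebra of `SL(2, ℂ)` -/

/-- The function algebra `𝒜 = ℂ[t₀₀, t₀₁, t₁₀, t₁₁] / (det T - 1)` on `SL(2, ℂ)`. -/
def FunAlg : Type :=
  MvPolynomial (Fin 2 × Fin 2) ℂ ⧸
    Ideal.span {(Matrix.mvPolynomialX (Fin 2) (Fin 2) ℂ).det - 1}

instance : CommRing FunAlg :=
  inferInstanceAs (CommRing (MvPolynomial (Fin 2 × Fin 2) ℂ ⧸
    Ideal.span {(Matrix.mvPolynomialX (Fin 2) (Fin 2) ℂ).det - 1}))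

instance : Algebra ℂ FunAlg :=
  inferInstanceAs (Algebra ℂ (MvPolynomial (Fin 2 × Fin 2) ℂ ⧸
    Ideal.span {(Matrix.mvPolynomialX (Fin 2) (Fin 2) ℂ).det - 1}))

/-- The quotient map `ℂ[t₀₀, t₀₁, t₁₀, t₁₁] → 𝒜`. -/
def quot : MvPolynomial (Fin 2 × Fin 2) ℂ →ₐ[ℂ] FunAlg :=
  Ideal.Quotient.mkₐ ℂ (Ideal.span {(Matrix.mvPolynomialX (Fin 2) (Fin 2) ℂ).det - 1})

/-- The matrix `T = (a b; c d)` of generators of `𝒜`. -/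
def T : Matrix (Fin 2) (Fin 2) FunAlg :=
  (Matrix.mvPolynomialX (Fin 2) (Fin 2) ℂ).map quot

def a : FunAlg := T 0 0
def b : FunAlg := T 0 1
def c : FunAlg := T 1 0
def d : FunAlg := T 1 1

theorem det_T : T.det = 1 := by
  have h : quot ((Matrix.mvPolynomialX (Fin 2) (Fin 2) ℂ).det - 1) = 0 :=
    Ideal.Quotient.eq_zero_iff_mem.mpr (Ideal.subset_span rfl)
  rw [map_sub, map_one, sub_eq_zero, AlgHom.map_det] at h
  exact h

/-- The matrix with entries `∑ₖ tᵢₖ ⊗ tₖⱼ`. -/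
def comulT : Matrix (Fin 2) (Fin 2) (FunAlg ⊗[ℂ] FunAlg) :=
  T.map (Algebra.TensorProduct.includeLeft : FunAlg →ₐ[ℂ] FunAlg ⊗[ℂ] FunAlg) *
    T.map (Algebra.TensorProduct.includeRight : FunAlg →ₐ[ℂ] FunAlg ⊗[ℂ] FunAlg)

theorem det_comulT : comulT.det = 1 := by
  have h (f : FunAlg →ₐ[ℂ] FunAlg ⊗[ℂ] FunAlg) : (T.map f).det = 1 := by
    have := AlgHom.map_det f T
    rw [det_T, map_one] at this
    exact this.symm
  rw [comulT, Matrix.det_mul, h, h, one_mul]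

/-- The comultiplication of `𝒜`: the algebra homomorphism with `Δ(T) = T ⊗ T`. -/
def comul : FunAlg →ₐ[ℂ] FunAlg ⊗[ℂ] FunAlg :=
  Ideal.Quotient.liftₐ _ (MvPolynomial.aeval fun p : Fin 2 × Fin 2 => comulT p.1 p.2) (by
    intro x hx
    rw [← RingHom.mem_ker]
    refine (Ideal.span_le.mpr ?_) hx
    rintro _ rfl
    rw [SetLike.mem_coe, RingHom.mem_ker, map_sub, map_one, sub_eq_zero]
    have h := AlgHom.map_det (MvPolynomial.aeval fun p : Fin 2 × Fin 2 => comulT p.1 p.2)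
      (Matrix.mvPolynomialX (Fin 2) (Fin 2) ℂ)
    refine h.trans ?_
    rw [← det_comulT]
    congr 1
    ext i j
    simp [Matrix.mvPolynomialX])

/-! ### The external algebra of `SL(2)` -/

/-- The algebra `Ω` of right-invariant forms: the exterior algebra on `θ⁰, θ¹, θ²`. -/
abbrev Forms : Type := ExteriorAlgebra ℂ (Fin 3 → ℂ)

/-- The external algebra `ℳ = 𝒜 ⊗ Ω`: generated by commuting `tₘₙ ∈ 𝒜` and anticommuting `θⁱ`,
the `tₘₙ` commuting with the `θⁱ`. -/
abbrev ExtAlg : Type := FunAlg ⊗[ℂ] Forms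

/-- The inclusion `𝒜 ⊆ ℳ`. -/
def incl : FunAlg →ₐ[ℂ] ExtAlg := Algebra.TensorProduct.includeLeft

/-- The odd generators `θⁱ` of `ℳ`. -/
def θ (i : Fin 3) : ExtAlg := 1 ⊗ₜ ExteriorAlgebra.ι ℂ (Pi.single i 1)

/-- The parity automorphism of `ℳ`: identity on `𝒜` and `θⁱ ↦ -θⁱ`. -/
def parity : ExtAlg →ₐ[ℂ] ExtAlg :=
  Algebra.TensorProduct.map (AlgHom.id ℂ FunAlg)
    (CliffordAlgebra.involute : Forms →ₐ[ℂ] Forms)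

/-- The sign `(-1)^(p q)` for `p, q ∈ ℤ/2`. -/
def koszul (p q : ZMod 2) : ℂ := if p = 1 ∧ q = 1 then -1 else 1

/-- The homogeneous part of degree `p ∈ ℤ/2` of `ℳ`, i.e. the `(-1)^p`-eigenspace of the
parity automorphism. -/
def degPart (p : ZMod 2) : Submodule ℂ ExtAlg :=
  LinearMap.ker (parity.toLinearMap - koszul p 1 • LinearMap.id)

/-- The projection of `ℳ` onto its homogeneous part of degree `p`. -/
def degProj (p : ZMod 2) : ExtAlg →ₗ[ℂ] ExtAlg :=
  (2⁻¹ : ℂ) • (LinearMap.id + koszul p 1 • parity.toLinearMap)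

/-! ### Left and right comultiplications

Both `Δ_L` and `Δ_R` extend `Δ : 𝒜 → 𝒜 ⊗ 𝒜` to algebra homomorphisms on `ℳ`, with values in
`𝒜 ⊗ ℳ` and `ℳ ⊗ 𝒜`.  As `𝒜` is even, these are subalgebras of the graded tensor product
`ℳ ⊗ ℳ` on which the graded multiplication is the ordinary one. -/

/-- The matrix of the adjoint representation: `(Ad_g e_j)^i` is the entry `(i, j)`. -/
def adMat : Matrix (Fin 3) (Fin 3) FunAlg :=
  !![1 + 2 * b * c, -(a * c), b * d;
     -(2 * a * b), a ^ 2, -(b ^ 2);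
     2 * c * d, -(c ^ 2), d ^ 2]

theorem θ_mul_swap (i j : Fin 3) : θ i * θ j = -(θ j * θ i) := by
  have h := ExteriorAlgebra.ι_add_mul_swap (R := ℂ)
    (Pi.single i 1 : Fin 3 → ℂ) (Pi.single j 1)
  rw [eq_neg_iff_add_eq_zero]
  simp only [θ, Algebra.TensorProduct.tmul_mul_tmul, ← TensorProduct.tmul_add, h,
    TensorProduct.tmul_zero]

theorem θ_mul_self (i : Fin 3) : θ i * θ i = 0 := by
  simp [θ, Algebra.TensorProduct.tmul_mul_tmul]

/-- `Δ_L θⁱ = ∑ⱼ (Ad_g e_j)^i ⊗ θʲ`. -/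
def comulLθ (i : Fin 3) : FunAlg ⊗[ℂ] ExtAlg := ∑ j, adMat i j ⊗ₜ θ j

theorem comulLθ_mul_swap (i j : Fin 3) : comulLθ i * comulLθ j = -(comulLθ j * comulLθ i) := by
  simp only [comulLθ, Finset.sum_mul_sum, Algebra.TensorProduct.tmul_mul_tmul]
  rw [Finset.sum_comm, ← Finset.sum_neg_distrib]
  refine Finset.sum_congr rfl fun k _ => ?_
  rw [← Finset.sum_neg_distrib]
  refine Finset.sum_congr rfl fun l _ => ?_
  rw [θ_mul_swap l k, TensorProduct.tmul_neg, mul_comm]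

theorem sq_zero_of_anticomm {X : Type*} [Ring X] [Algebra ℂ X] (x : Fin 3 → X)
    (h : ∀ i j, x i * x j = -(x j * x i)) (v : Fin 3 → ℂ) :
    Fintype.linearCombination ℂ x v * Fintype.linearCombination ℂ x v = 0 := by
  have e : Fintype.linearCombination ℂ x v * Fintype.linearCombination ℂ x v =
      -(Fintype.linearCombination ℂ x v * Fintype.linearCombination ℂ x v) := by
    simp only [Fintype.linearCombination_apply, Finset.sum_mul_sum, smul_mul_smul_comm]
    conv_lhs => rw [Finset.sum_comm]
    rw [← Finset.sum_neg_distrib]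
    refine Finset.sum_congr rfl fun k _ => ?_
    rw [← Finset.sum_neg_distrib]
    refine Finset.sum_congr rfl fun l _ => ?_
    rw [h l k, smul_neg, mul_comm]
  have e2 : (2 : ℂ) • (Fintype.linearCombination ℂ x v * Fintype.linearCombination ℂ x v) = 0 := by
    rw [two_smul]
    exact add_eq_zero_iff_eq_neg.mpr e
  exact (smul_eq_zero_iff_right (two_ne_zero)).mp e2

/-- The algebra homomorphism `Ω → X` that sends `θⁱ` to `x i`, for anticommuting `x i`. -/
def liftForms {X : Type*} [Ring X] [Algebra ℂ X] (x : Fin 3 → X)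
    (h : ∀ i j, x i * x j = -(x j * x i)) : Forms →ₐ[ℂ] X :=
  ExteriorAlgebra.lift ℂ ⟨Fintype.linearCombination ℂ x, sq_zero_of_anticomm x h⟩

theorem commute_liftForms {X : Type*} [Ring X] [Algebra ℂ X] (x : Fin 3 → X)
    (h : ∀ i j, x i * x j = -(x j * x i)) (y : X) (hy : ∀ i, Commute y (x i)) (w : Forms) :
    Commute y (liftForms x h w) := by
  induction w using ExteriorAlgebra.induction with
  | algebraMap r => rw [AlgHom.commutes]; exact (Algebra.commutes r y).symm
  | ι v =>
    simp only [liftForms, ExteriorAlgebra.lift_ι_apply, Fintype.linearCombination_apply]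
    exact Commute.sum_right _ _ _ fun i _ => (hy i).smul_right _
  | mul u v hu hv => rw [map_mul]; exact hu.mul_right hv
  | add u v hu hv => rw [map_add]; exact hu.add_right hv

theorem commute_incl (f : FunAlg) (x : ExtAlg) : Commute (incl f) x := by
  induction x using TensorProduct.induction_on with
  | zero => exact Commute.zero_right _
  | tmul g w => simp [incl, Commute, SemiconjBy, mul_comm]
  | add u v hu hv => exact hu.add_right hv

/-- The left comultiplication `Δ_L : ℳ → 𝒜 ⊗ ℳ`. -/
def comulL : ExtAlg →ₐ[ℂ] FunAlg ⊗[ℂ] ExtAlg :=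
  Algebra.TensorProduct.lift
    ((Algebra.TensorProduct.map (AlgHom.id ℂ FunAlg) incl).comp comul)
    (liftForms comulLθ comulLθ_mul_swap) (by
      intro f w
      refine commute_liftForms _ _ _ (fun i => ?_) w
      rw [AlgHom.comp_apply]
      induction comul f using TensorProduct.induction_on with
      | zero => rw [map_zero]; exact Commute.zero_left _
      | tmul g h =>
        refine Commute.sum_right _ _ _ fun j _ => ?_
        rw [Algebra.TensorProduct.map_tmul]
        exact (Commute.all g (adMat i j)).tmul (commute_incl h (θ j))
      | add u v hu hv => rw [map_add]; exact hu.add_left hv)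

/-- The right comultiplication `Δ_R : ℳ → ℳ ⊗ 𝒜`, with `Δ_R θⁱ = θⁱ ⊗ 1`. -/
def comulR : ExtAlg →ₐ[ℂ] ExtAlg ⊗[ℂ] FunAlg :=
  Algebra.TensorProduct.lift
    ((Algebra.TensorProduct.map incl (AlgHom.id ℂ FunAlg)).comp comul)
    (liftForms (fun i => θ i ⊗ₜ 1) (by
      intro i j
      rw [Algebra.TensorProduct.tmul_mul_tmul, θ_mul_swap, TensorProduct.neg_tmul,
        Algebra.TensorProduct.tmul_mul_tmul])) (by
      intro f w
      refine commute_liftForms _ _ _ (fun i => ?_) w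
      rw [AlgHom.comp_apply]
      induction comul f using TensorProduct.induction_on with
      | zero => rw [map_zero]; exact Commute.zero_left _
      | tmul g h =>
        rw [Algebra.TensorProduct.map_tmul]
        exact (commute_incl g (θ i)).tmul (Commute.one_right _)
      | add u v hu hv => rw [map_add]; exact hu.add_left hv)

/-- `Δ_L` as a map to `ℳ ⊗ ℳ`. -/
def ΔL : ExtAlg →ₗ[ℂ] ExtAlg ⊗[ℂ] ExtAlg :=
  TensorProduct.map incl.toLinearMap LinearMap.id ∘ₗ comulL.toLinearMap

/-- `Δ_R` as a map to `ℳ ⊗ ℳ`. -/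
def ΔR : ExtAlg →ₗ[ℂ] ExtAlg ⊗[ℂ] ExtAlg :=
  TensorProduct.map LinearMap.id incl.toLinearMap ∘ₗ comulR.toLinearMap

/-- `Δ` on `𝒜` as a map to `ℳ ⊗ ℳ`. -/
def ΔA : FunAlg →ₗ[ℂ] ExtAlg ⊗[ℂ] ExtAlg :=
  TensorProduct.map incl.toLinearMap incl.toLinearMap ∘ₗ comul.toLinearMap

/-! ### Graded Poisson brackets -/

/-- Bilinear operations on `ℳ`. -/
abbrev Bracket : Type := ExtAlg →ₗ[ℂ] ExtAlg →ₗ[ℂ] ExtAlg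

/-- A graded bracket: a bilinear operation compatible with the `ℤ/2`-grading, graded
antisymmetric, and satisfying the graded Leibniz rule (but not necessarily Jacobi). -/
structure IsGradedBracket (B : Bracket) : Prop where
  degree : ∀ (p q : ZMod 2) (x y : ExtAlg), x ∈ degPart p → y ∈ degPart q →
    B x y ∈ degPart (p + q)
  symm : ∀ (p q : ZMod 2) (x y : ExtAlg), x ∈ degPart p → y ∈ degPart q →
    B x y = -(koszul p q • B y x)
  leibniz : ∀ (p q r : ZMod 2) (x y z : ExtAlg),
    x ∈ degPart p → y ∈ degPart q → z ∈ degPart r →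
    B (x * y) z = x * B y z + koszul q r • (B x z * y)

/-- A graded Poisson bracket: a graded bracket with the super Jacobi identity. -/
structure IsGradedPoisson (B : Bracket) : Prop extends IsGradedBracket B where
  jacobi : ∀ (p q r : ZMod 2) (x y z : ExtAlg),
    x ∈ degPart p → y ∈ degPart q → z ∈ degPart r →
    koszul p r • B (B x y) z + koszul q r • B (B z x) y + koszul p q • B (B y z) x = 0

/-- The extension of a bracket to `ℳ ⊗ ℳ`: for homogeneous `y, z`,
`{x ⊗ y, z ⊗ w} = (-1)^(deg y deg z) ({x, z} ⊗ y w + x z ⊗ {y, w})`. -/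
def tensorBracket (B : Bracket) :
    ExtAlg ⊗[ℂ] ExtAlg →ₗ[ℂ] ExtAlg ⊗[ℂ] ExtAlg →ₗ[ℂ] ExtAlg ⊗[ℂ] ExtAlg :=
  ∑ p : ZMod 2, ∑ q : ZMod 2, koszul p q •
    (TensorProduct.map₂ (B.compl₂ (degProj q)) (LinearMap.mul ℂ ExtAlg ∘ₗ degProj p) +
      TensorProduct.map₂ ((LinearMap.mul ℂ ExtAlg).compl₂ (degProj q)) (B ∘ₗ degProj p))

/-- `B` prolongs the Sklyanin bracket. -/
structure ProlongsSklyanin (B : Bracket) : Prop where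
  ab : B (incl a) (incl b) = incl (-(a * b))
  bd : B (incl b) (incl d) = incl (-(b * d))
  cb : B (incl c) (incl b) = 0
  ac : B (incl a) (incl c) = incl (-(a * c))
  cd : B (incl c) (incl d) = incl (-(c * d))
  ad : B (incl a) (incl d) = incl (-(2 * b * c))

/-- `Δ {f, h} = {Δ f, Δ h}` for `f, h ∈ 𝒜`. -/
def FunCovariant (B : Bracket) : Prop :=
  ∀ f h : FunAlg,
    ΔL (B (incl f) (incl h)) = tensorBracket B (ΔA f) (ΔA h) ∧
    ΔR (B (incl f) (incl h)) = tensorBracket B (ΔA f) (ΔA h)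

/-- `Δ_{L,R} {θⁱ, f} = {Δ_{L,R} θⁱ, Δ f}` for `f ∈ 𝒜`. -/
def MixedCovariant (B : Bracket) : Prop :=
  ∀ (i : Fin 3) (f : FunAlg),
    ΔL (B (θ i) (incl f)) = tensorBracket B (ΔL (θ i)) (ΔA f) ∧
    ΔR (B (θ i) (incl f)) = tensorBracket B (ΔR (θ i)) (ΔA f)

/-- `Δ_{L,R} {θⁱ, θʲ} = {Δ_{L,R} θⁱ, Δ_{L,R} θʲ}`. -/
def FormsCovariant (B : Bracket) : Prop :=
  ∀ i j : Fin 3,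
    ΔL (B (θ i) (θ j)) = tensorBracket B (ΔL (θ i)) (ΔL (θ j)) ∧
    ΔR (B (θ i) (θ j)) = tensorBracket B (ΔR (θ i)) (ΔR (θ j))

/-- Covariance of the first order. -/
def FirstOrder (B : Bracket) : Prop := FunCovariant B ∧ MixedCovariant B

/-- Covariance of the second order. -/
def SecondOrder (B : Bracket) : Prop := FunCovariant B ∧ FormsCovariant B

/-- `{θⁱ, tₘₙ} = ∑ⱼ Cⱼ θʲ` with coefficients in `𝒜`. -/
def MixedLinear (B : Bracket) : Prop :=
  ∀ (i : Fin 3) (m n : Fin 2),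
    B (θ i) (incl (T m n)) ∈ Submodule.span FunAlg (Set.range θ)

/-- `{θⁱ, θʲ} = ∑ Cₘₙ θᵐ θⁿ` with coefficients in `𝒜`. -/
def FormsQuadratic (B : Bracket) : Prop :=
  ∀ i j : Fin 3,
    B (θ i) (θ j) ∈ Submodule.span FunAlg (Set.range fun k : Fin 3 × Fin 3 => θ k.1 * θ k.2)

/-- A graded Poisson-Lie structure on `ℳ` that prolongs the Sklyanin bracket. -/
structure IsGradedPoissonLie (B : Bracket) : Prop where
  poisson : IsGradedPoisson B
  sklyanin : ProlongsSklyanin B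
  quadratic : FormsQuadratic B
  funCov : FunCovariant B
  mixedCov : MixedCovariant B
  formsCov : FormsCovariant B

/-- The super Jacobi identity for one `θⁱ` and two functions. -/
def MixedJacobi (B : Bracket) : Prop :=
  ∀ (i : Fin 3) (f h : FunAlg),
    B (B (θ i) (incl f)) (incl h) + B (B (incl h) (θ i)) (incl f)
      + B (B (incl f) (incl h)) (θ i) = 0

/-! ### The tables of brackets; `f • ω` is the product in `ℳ` of `f ∈ 𝒜` and `ω` -/

/-- The one-parameter family of candidates for `{θ, t}`. -/
structure MixedFamily (η : ℂ) (B : Bracket) : Prop where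
  θ0a : B (θ 0) (incl a) = η • c • θ 1
  θ0b : B (θ 0) (incl b) = η • d • θ 1
  θ0c : B (θ 0) (incl c) = -(2 + η) • a • θ 2
  θ0d : B (θ 0) (incl d) = -(2 + η) • b • θ 2
  θ1a : B (θ 1) (incl a) = -(1 + η) • a • θ 1
  θ1b : B (θ 1) (incl b) = -(1 + η) • b • θ 1
  θ1c : B (θ 1) (incl c) = (4 + 2 * η) • a • θ 0 + (1 + η) • c • θ 1
  θ1d : B (θ 1) (incl d) = (4 + 2 * η) • b • θ 0 + (1 + η) • d • θ 1
  θ2a : B (θ 2) (incl a) = (-2 * η) • c • θ 0 + (1 + η) • a • θ 2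
  θ2b : B (θ 2) (incl b) = (-2 * η) • d • θ 0 + (1 + η) • b • θ 2
  θ2c : B (θ 2) (incl c) = -(1 + η) • c • θ 2
  θ2d : B (θ 2) (incl d) = -(1 + η) • d • θ 2

/-- The I-type brackets `{θ, t}`. -/
structure TypeI (B : Bracket) : Prop where
  θ0a : B (θ 0) (incl a) = (-2 * c) • θ 1
  θ0b : B (θ 0) (incl b) = (-2 * d) • θ 1
  θ0c : B (θ 0) (incl c) = 0
  θ0d : B (θ 0) (incl d) = 0
  θ1a : B (θ 1) (incl a) = a • θ 1
  θ1b : B (θ 1) (incl b) = b • θ 1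
  θ1c : B (θ 1) (incl c) = -(c • θ 1)
  θ1d : B (θ 1) (incl d) = -(d • θ 1)
  θ2a : B (θ 2) (incl a) = (4 * c) • θ 0 - a • θ 2
  θ2b : B (θ 2) (incl b) = (4 * d) • θ 0 - b • θ 2
  θ2c : B (θ 2) (incl c) = c • θ 2
  θ2d : B (θ 2) (incl d) = d • θ 2

/-- The II-type brackets `{θ, t}`. -/
structure TypeII (B : Bracket) : Prop where
  θ0a : B (θ 0) (incl a) = 0
  θ0b : B (θ 0) (incl b) = 0
  θ0c : B (θ 0) (incl c) = (-2 * a) • θ 2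
  θ0d : B (θ 0) (incl d) = (-2 * b) • θ 2
  θ1a : B (θ 1) (incl a) = -(a • θ 1)
  θ1b : B (θ 1) (incl b) = -(b • θ 1)
  θ1c : B (θ 1) (incl c) = (4 * a) • θ 0 + c • θ 1
  θ1d : B (θ 1) (incl d) = (4 * b) • θ 0 + d • θ 1
  θ2a : B (θ 2) (incl a) = a • θ 2
  θ2b : B (θ 2) (incl b) = b • θ 2
  θ2c : B (θ 2) (incl c) = -(c • θ 2)
  θ2d : B (θ 2) (incl d) = -(d • θ 2)

/-- The brackets `{θ, θ}`. -/
structure FormsTable (B : Bracket) : Prop where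
  θ00 : B (θ 0) (θ 0) = -2 * (θ 1 * θ 2)
  θ01 : B (θ 0) (θ 1) = -2 * (θ 0 * θ 1)
  θ02 : B (θ 0) (θ 2) = 2 * (θ 0 * θ 2)
  θ11 : B (θ 1) (θ 1) = 0
  θ12 : B (θ 1) (θ 2) = 0
  θ22 : B (θ 2) (θ 2) = 0

end SL2Ext

end

open scoped TensorProduct

noncomputable section

namespace SL2Ext

/-! ### Generators, homomorphisms and derivations of `𝒜` -/

/-! Up to sign the Sklyanin bracket is `vE ∧ vF + wE ∧ wF`, with `vE, vF` right-invariant and `wE,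
wF` left-invariant fields. Under `Δ` the former act on the left tensor factor and the latter on the
right one. The remaining terms live in the middle of the product, where `vE` on the right factor
equals `wF` on the left factor, and they cancel (`funCovariant`).

Since `Δ_R θⁱ = θⁱ ⊗ 1`, right covariance makes the coefficients of `{θⁱ, ·}` derivations that
commute with right translations, i.e. constant combinations of `vH, vE, vF` (`exists_rightField`),
and makes the coefficients of `{θⁱ, θʲ}` constants (`coeff₂_const`). Left covariance, read through
the counit, is then a finite linear system for these constants. At `diag(2, 1/2)` the Sklyanin
bracket vanishes, so every coefficient of nonzero torus weight is zero; the unipotent point `(1 1; 0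
1)` relates the survivors. For `{θ, f}` there remain the parameter `η` and a multiple `x` of a term
cubic in the forms (`exists_of_mixedCovariant`); for `{θ, θ}` nothing is free (`quadratic_coeff`).
Conversely, covariance of the family is an identity between vector fields (`mixed_equivariance`)
together with a direct check on forms (`formsCovariant`).

The Jacobi defect of `θⁱ, f, h` in the family is `η(η + 2)` times an explicit expression
(`mixedDefect_eq`), which singles out the two types; the same identity then forces `x = 0`
(`mixedFamily_of_jacobi`).

For existence, `familyBracket` is a sum of products of derivations of `ℳ`, and such products are
automatically graded brackets. A graded bracket is determined by its values on generators
(`ext_of_generators`). The Jacobi identity can also be tested on generators, because its defect is a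
twisted derivation in the last argument and is cyclic up to sign (`isGradedPoisson_of_generators`).
-/

theorem det_relation : a * d - b * c = 1 := by
  have h := det_T
  rwa [Matrix.det_fin_two] at h

theorem quot_surjective : Function.Surjective quot := Ideal.Quotient.mk_surjective

theorem quot_X (p : Fin 2 × Fin 2) : quot (MvPolynomial.X p) = T p.1 p.2 := by
  simp [T, Matrix.mvPolynomialX]

@[elab_as_elim]
theorem FunAlg.induction {P : FunAlg → Prop} (f : FunAlg)
    (scalar : ∀ r : ℂ, P (algebraMap ℂ FunAlg r)) (ha : P a) (hb : P b) (hc : P c) (hd : P d)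
    (add : ∀ f g, P f → P g → P (f + g)) (mul : ∀ f g, P f → P g → P (f * g)) : P f := by
  obtain ⟨p, rfl⟩ := quot_surjective f
  induction p using MvPolynomial.induction_on with
  | C r => exact (quot.commutes r) ▸ scalar r
  | add p q hp hq => rw [map_add]; exact add _ _ hp hq
  | mul_X p n hp =>
    rw [map_mul, quot_X]
    refine mul _ _ hp ?_
    obtain ⟨i, j⟩ := n
    fin_cases i <;> fin_cases j <;> assumption

theorem derivation_ext {D D' : Derivation ℂ FunAlg FunAlg} (ha : D a = D' a) (hb : D b = D' b)
    (hc : D c = D' c) (hd : D d = D' d) : D = D' := by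
  ext f
  induction f using FunAlg.induction with
  | scalar r => simp
  | ha => exact ha
  | hb => exact hb
  | hc => exact hc
  | hd => exact hd
  | add f g hf hg => rw [map_add, map_add, hf, hg]
  | mul f g hf hg => rw [Derivation.leibniz, Derivation.leibniz, hf, hg]

/-- The algebra homomorphism `𝒜 → R` given by an `R`-valued point of `SL(2)`. -/
def point {R : Type*} [CommRing R] [Algebra ℂ R] (p q r s : R) (h : p * s - q * r = 1) :
    FunAlg →ₐ[ℂ] R :=
  Ideal.Quotient.liftₐ _ (MvPolynomial.aeval fun n : Fin 2 × Fin 2 => !![p, q; r, s] n.1 n.2) (by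
    intro x hx
    rw [← RingHom.mem_ker]
    refine (Ideal.span_le.mpr ?_) hx
    rintro _ rfl
    rw [SetLike.mem_coe, RingHom.mem_ker, map_sub, map_one, sub_eq_zero, Matrix.det_fin_two]
    simpa [Matrix.mvPolynomialX] using h)

section
variable {R : Type*} [CommRing R] [Algebra ℂ R] (p q r s : R) (h : p * s - q * r = 1)

theorem point_T (i j : Fin 2) : point p q r s h (T i j) = !![p, q; r, s] i j := by
  rw [← quot_X (i, j)]
  exact MvPolynomial.aeval_X _ _

@[simp] theorem point_a : point p q r s h a = p := point_T p q r s h 0 0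
@[simp] theorem point_b : point p q r s h b = q := point_T p q r s h 0 1
@[simp] theorem point_c : point p q r s h c = r := point_T p q r s h 1 0
@[simp] theorem point_d : point p q r s h d = s := point_T p q r s h 1 1
end

/-- The counit of `𝒜`: evaluation at the unit of `SL(2)`. -/
def counit : FunAlg →ₐ[ℂ] ℂ := point 1 0 0 1 (by norm_num)

@[simp] theorem counit_a : counit a = 1 := point_a _ _ _ _ _
@[simp] theorem counit_b : counit b = 0 := point_b _ _ _ _ _
@[simp] theorem counit_c : counit c = 0 := point_c _ _ _ _ _
@[simp] theorem counit_d : counit d = 1 := point_d _ _ _ _ _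

/-- The derivation of `𝒜` with prescribed values on the matrix entries, tangent to `det = 1`. -/
def vectorField (V : Matrix (Fin 2) (Fin 2) (MvPolynomial (Fin 2 × Fin 2) ℂ))
    (h : quot (V 0 0) * d + a * quot (V 1 1) - (quot (V 0 1) * c + b * quot (V 1 0)) = 0) :
    Derivation ℂ FunAlg FunAlg :=
  Derivation.liftOfSurjective (f := quot)
    (d := MvPolynomial.mkDerivation ℂ fun p : Fin 2 × Fin 2 => V p.1 p.2) quot_surjective (by
    intro x hx
    obtain ⟨y, rfl⟩ := Ideal.mem_span_singleton'.mp (Ideal.Quotient.eq_zero_iff_mem.mp hx)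
    have hdet : quot ((Matrix.mvPolynomialX (Fin 2) (Fin 2) ℂ).det - 1) = 0 :=
      Ideal.Quotient.eq_zero_iff_mem.mpr (Ideal.subset_span rfl)
    -- The term in which `y` is differentiated carries the factor `det - 1`, which is zero in the
    -- quotient; the other is `y` times the tangency condition `h`.
    rw [Derivation.leibniz, map_add, smul_eq_mul, smul_eq_mul, map_mul, map_mul, hdet, zero_mul,
      add_zero, Matrix.det_fin_two]
    have e : ∀ i j, quot (MvPolynomial.X (i, j)) = T i j := fun i j => quot_X (i, j)
    simp only [Matrix.mvPolynomialX, Matrix.of_apply, map_sub, Derivation.leibniz,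
      MvPolynomial.mkDerivation_X, Derivation.map_one_eq_zero, smul_eq_mul, map_add, map_mul, e]
    change quot y * (a * quot (V 1 1) + d * quot (V 0 0)
      - (b * quot (V 1 0) + c * quot (V 0 1)) - quot 0) = 0
    rw [map_zero]
    linear_combination quot y * h)

theorem vectorField_T (V : Matrix (Fin 2) (Fin 2) (MvPolynomial (Fin 2 × Fin 2) ℂ))
    (h : quot (V 0 0) * d + a * quot (V 1 1) - (quot (V 0 1) * c + b * quot (V 1 0)) = 0)
    (i j : Fin 2) : vectorField V h (T i j) = quot (V i j) := by
  rw [← quot_X (i, j), vectorField, Derivation.liftOfSurjective_apply,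
    MvPolynomial.mkDerivation_X]

open MvPolynomial in
/-- The right-invariant vector field `a ↦ c, b ↦ d`. -/
def vE : Derivation ℂ FunAlg FunAlg :=
  vectorField !![X (1, 0), X (1, 1); 0, 0] (by
    simp [quot_X, a, b, c, d, mul_comm])

open MvPolynomial in
/-- The right-invariant vector field `c ↦ a, d ↦ b`. -/
def vF : Derivation ℂ FunAlg FunAlg :=
  vectorField !![0, 0; X (0, 0), X (0, 1)] (by
    simp [quot_X, a, b, c, d, mul_comm])

open MvPolynomial in
/-- The right-invariant vector field `a ↦ a, b ↦ b, c ↦ -c, d ↦ -d`. -/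
def vH : Derivation ℂ FunAlg FunAlg :=
  vectorField !![X (0, 0), X (0, 1); -X (1, 0), -X (1, 1)] (by
    simp [quot_X, a, b, c, d])

open MvPolynomial in
/-- The left-invariant vector field `a ↦ b, c ↦ d`. -/
def wE : Derivation ℂ FunAlg FunAlg :=
  vectorField !![X (0, 1), 0; X (1, 1), 0] (by
    simp [quot_X, a, b, c, d, mul_comm])

open MvPolynomial in
/-- The left-invariant vector field `b ↦ a, d ↦ c`. -/
def wF : Derivation ℂ FunAlg FunAlg :=
  vectorField !![0, X (0, 0); 0, X (1, 0)] (by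
    simp [quot_X, a, b, c, d, mul_comm])

open MvPolynomial in
/-- The left-invariant vector field `a ↦ a, b ↦ -b, c ↦ c, d ↦ -d`. -/
def wH : Derivation ℂ FunAlg FunAlg :=
  vectorField !![X (0, 0), -X (0, 1); X (1, 0), -X (1, 1)] (by
    simp [quot_X, a, b, c, d])

@[simp] theorem vE_a : vE a = c :=
  (vectorField_T _ _ 0 0).trans (quot_X _)
@[simp] theorem vE_b : vE b = d :=
  (vectorField_T _ _ 0 1).trans (quot_X _)
@[simp] theorem vE_c : vE c = 0 :=
  (vectorField_T _ _ 1 0).trans (map_zero quot)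
@[simp] theorem vE_d : vE d = 0 :=
  (vectorField_T _ _ 1 1).trans (map_zero quot)
@[simp] theorem vF_a : vF a = 0 :=
  (vectorField_T _ _ 0 0).trans (map_zero quot)
@[simp] theorem vF_b : vF b = 0 :=
  (vectorField_T _ _ 0 1).trans (map_zero quot)
@[simp] theorem vF_c : vF c = a :=
  (vectorField_T _ _ 1 0).trans (quot_X _)
@[simp] theorem vF_d : vF d = b :=
  (vectorField_T _ _ 1 1).trans (quot_X _)
@[simp] theorem vH_a : vH a = a :=
  (vectorField_T _ _ 0 0).trans (quot_X _)
@[simp] theorem vH_b : vH b = b :=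
  (vectorField_T _ _ 0 1).trans (quot_X _)
@[simp] theorem vH_c : vH c = -c :=
  (vectorField_T _ _ 1 0).trans ((map_neg quot _).trans (congrArg _ (quot_X _)))
@[simp] theorem vH_d : vH d = -d :=
  (vectorField_T _ _ 1 1).trans ((map_neg quot _).trans (congrArg _ (quot_X _)))
@[simp] theorem wE_a : wE a = b :=
  (vectorField_T _ _ 0 0).trans (quot_X _)
@[simp] theorem wE_b : wE b = 0 :=
  (vectorField_T _ _ 0 1).trans (map_zero quot)
@[simp] theorem wE_c : wE c = d :=
  (vectorField_T _ _ 1 0).trans (quot_X _)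
@[simp] theorem wE_d : wE d = 0 :=
  (vectorField_T _ _ 1 1).trans (map_zero quot)
@[simp] theorem wF_a : wF a = 0 :=
  (vectorField_T _ _ 0 0).trans (map_zero quot)
@[simp] theorem wF_b : wF b = a :=
  (vectorField_T _ _ 0 1).trans (quot_X _)
@[simp] theorem wF_c : wF c = 0 :=
  (vectorField_T _ _ 1 0).trans (map_zero quot)
@[simp] theorem wF_d : wF d = c :=
  (vectorField_T _ _ 1 1).trans (quot_X _)
@[simp] theorem wH_a : wH a = a :=
  (vectorField_T _ _ 0 0).trans (quot_X _)
@[simp] theorem wH_b : wH b = -b :=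
  (vectorField_T _ _ 0 1).trans ((map_neg quot _).trans (congrArg _ (quot_X _)))
@[simp] theorem wH_c : wH c = c :=
  (vectorField_T _ _ 1 0).trans (quot_X _)
@[simp] theorem wH_d : wH d = -d :=
  (vectorField_T _ _ 1 1).trans ((map_neg quot _).trans (congrArg _ (quot_X _)))

/-- The Sklyanin bracket on `𝒜`. -/
def sklyanin (f h : FunAlg) : FunAlg :=
  -(vE f * vF h - vF f * vE h + (wE f * wF h - wF f * wE h))

/-- A commutator of derivations is a derivation, so the four matrix entries decide. This relation
and the next two are oriented as rewriting rules that bring words in `vF, vE, vH` to a normal order.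
-/
theorem vE_vF (f : FunAlg) : vE (vF f) = vF (vE f) - vH f := by
  suffices h : ⁅vE, vF⁆ = -vH by
    have := congrArg (fun D => D f) h
    simp only [Derivation.commutator_apply, Derivation.neg_apply] at this
    linear_combination this
  apply derivation_ext <;> simp [Derivation.commutator_apply]

theorem vH_vE (f : FunAlg) : vH (vE f) = vE (vH f) - 2 * vE f := by
  suffices h : ⁅vH, vE⁆ = -(2 : ℂ) • vE by
    have := congrArg (fun D => D f) h
    simp only [Derivation.commutator_apply, neg_smul, ofNat_smul_eq_nsmul, two_smul,
      Derivation.neg_apply, Derivation.add_apply] at this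
    linear_combination this
  apply derivation_ext <;> simp [Derivation.commutator_apply, two_smul, ofNat_smul_eq_nsmul]
  all_goals ring

theorem vH_vF (f : FunAlg) : vH (vF f) = vF (vH f) + 2 * vF f := by
  suffices h : ⁅vH, vF⁆ = (2 : ℂ) • vF by
    have := congrArg (fun D => D f) h
    simp only [Derivation.commutator_apply, ofNat_smul_eq_nsmul, two_smul,
      Derivation.add_apply] at this
    linear_combination this
  apply derivation_ext <;> simp [Derivation.commutator_apply, two_smul, ofNat_smul_eq_nsmul]

/-- Left and right translations commute, hence so do their infinitesimal generators. -/
theorem commute_vector_fields (f : FunAlg) :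
    (wE (vE f) = vE (wE f) ∧ wE (vF f) = vF (wE f) ∧ wE (vH f) = vH (wE f)) ∧
    (wF (vE f) = vE (wF f) ∧ wF (vF f) = vF (wF f) ∧ wF (vH f) = vH (wF f)) := by
  have key (D D' : Derivation ℂ FunAlg FunAlg) (h : ⁅D, D'⁆ = 0) : D (D' f) = D' (D f) := by
    have := congrArg (fun D => D f) h
    simpa [Derivation.commutator_apply, sub_eq_zero] using this
  refine ⟨⟨key _ _ ?_, key _ _ ?_, key _ _ ?_⟩, key _ _ ?_, key _ _ ?_, key _ _ ?_⟩ <;>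
    apply derivation_ext <;> simp [Derivation.commutator_apply]

/-! ### The external algebra as a graded commutative algebra -/

theorem incl_apply (f : FunAlg) : incl f = f ⊗ₜ 1 := rfl

theorem incl_eq_smul (f : FunAlg) : incl f = f • (1 : ExtAlg) := by
  rw [incl_apply, Algebra.TensorProduct.one_def, TensorProduct.smul_tmul', smul_eq_mul, mul_one]

theorem incl_mul (f : FunAlg) (x : ExtAlg) : incl f * x = f • x := by
  rw [incl_eq_smul, smul_mul_assoc, one_mul]

theorem mul_incl (f : FunAlg) (x : ExtAlg) : x * incl f = f • x := by
  rw [incl_eq_smul, mul_smul_comm, mul_one]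

theorem tmul_eq_smul (f : FunAlg) (w : Forms) : (f ⊗ₜ w : ExtAlg) = f • (1 ⊗ₜ w) := by
  rw [TensorProduct.smul_tmul', smul_eq_mul, mul_one]

theorem one_tmul_ι (v : Fin 3 → ℂ) :
    (1 ⊗ₜ ExteriorAlgebra.ι ℂ v : ExtAlg) = ∑ i, v i • θ i := by
  have h : v = ∑ i, v i • (Pi.single i 1 : Fin 3 → ℂ) := by
    ext j; simp [Finset.sum_apply, Pi.single_apply]
  conv_lhs => rw [h]
  simp only [map_sum, map_smul, TensorProduct.tmul_sum, TensorProduct.tmul_smul, θ]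

@[elab_as_elim]
theorem ExtAlg.induction {P : ExtAlg → Prop} (x : ExtAlg)
    (incl : ∀ f, P (incl f)) (θ : ∀ i, P (θ i))
    (add : ∀ x y, P x → P y → P (x + y)) (mul : ∀ x y, P x → P y → P (x * y)) : P x := by
  have hsmul (r : ℂ) (y) (hy : P y) : P (r • y) := by
    have h := mul _ _ (incl (algebraMap ℂ FunAlg r)) hy
    rwa [incl_mul, algebraMap_smul] at h
  induction x using TensorProduct.induction_on with
  | zero => simpa using incl 0
  | add x y hx hy => exact add x y hx hy
  | tmul f w =>
    rw [tmul_eq_smul, ← incl_mul]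
    refine mul _ _ (incl f) ?_
    induction w using ExteriorAlgebra.induction with
    | algebraMap r =>
      rw [Algebra.algebraMap_eq_smul_one, TensorProduct.tmul_smul]
      exact hsmul r _ (incl 1)
    | ι v =>
      rw [one_tmul_ι, Fin.sum_univ_three]
      exact add _ _ (add _ _ (hsmul _ _ (θ 0)) (hsmul _ _ (θ 1))) (hsmul _ _ (θ 2))
    | mul u v hu hv =>
      have h := mul _ _ hu hv
      rwa [Algebra.TensorProduct.tmul_mul_tmul, one_mul] at h
    | add u v hu hv => rw [TensorProduct.tmul_add]; exact add _ _ hu hv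

@[simp] theorem parity_incl (f : FunAlg) : parity (incl f) = incl f := by
  simp [parity, incl_apply]

@[simp] theorem parity_θ (i : Fin 3) : parity (θ i) = -θ i := by
  simp [parity, θ, ExteriorAlgebra.ι, CliffordAlgebra.involute_ι, TensorProduct.tmul_neg]

@[simp] theorem parity_smul (f : FunAlg) (x : ExtAlg) : parity (f • x) = f • parity x := by
  rw [← incl_mul, map_mul, parity_incl, incl_mul]

@[simp] theorem parity_parity (x : ExtAlg) : parity (parity x) = x := by
  induction x using ExtAlg.induction with
  | incl f => simp
  | θ i => simp
  | add x y hx hy => simp [hx, hy]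
  | mul x y hx hy => simp [hx, hy]

@[simp] theorem koszul_zero_left (q : ZMod 2) : koszul 0 q = 1 := by simp [koszul]
@[simp] theorem koszul_zero_right (p : ZMod 2) : koszul p 0 = 1 := by simp [koszul]
@[simp] theorem koszul_one_one : koszul 1 1 = -1 := by simp [koszul]

theorem zmod_two_cases (p : ZMod 2) : p = 0 ∨ p = 1 := by revert p; decide

theorem mem_degPart_zero {x : ExtAlg} : x ∈ degPart 0 ↔ parity x = x := by
  simp [degPart, sub_eq_zero]

theorem mem_degPart_one {x : ExtAlg} : x ∈ degPart 1 ↔ parity x = -x := by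
  simp [degPart, add_eq_zero_iff_eq_neg]

theorem even_add_odd (x : ExtAlg) : ∃ y z, parity y = y ∧ parity z = -z ∧ x = y + z := by
  refine ⟨(2⁻¹ : ℂ) • (x + parity x), (2⁻¹ : ℂ) • (x - parity x), ?_, ?_, ?_⟩
  · simp [add_comm]
  · simp [← smul_neg]
  · rw [← smul_add]
    simp [← two_smul ℂ x, smul_smul]

/-- Graded commutativity with the sign carried by `parity`, so that `z` need not be homogeneous and
induction over sums and products goes through. -/
theorem θ_mul_comm (i : Fin 3) (z : ExtAlg) : θ i * z = parity z * θ i := by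
  induction z using ExtAlg.induction with
  | incl f => rw [parity_incl, incl_mul, mul_incl]
  | θ j => rw [parity_θ, θ_mul_swap, neg_mul]
  | add x y hx hy => rw [mul_add, hx, hy, map_add, add_mul]
  | mul x y hx hy => rw [← mul_assoc, hx, mul_assoc, hy, map_mul, mul_assoc]

theorem mul_comm_of_even {y : ExtAlg} (hy : parity y = y) (x : ExtAlg) : x * y = y * x := by
  induction x using ExtAlg.induction with
  | incl f => rw [incl_mul, mul_incl]
  | θ i => rw [θ_mul_comm, hy]
  | add u v hu hv => rw [mul_add, add_mul, hu, hv]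
  | mul u v hu hv => rw [mul_assoc, hv, ← mul_assoc, hu, mul_assoc]

theorem mul_comm_of_odd {y : ExtAlg} (hy : parity y = -y) (x : ExtAlg) :
    x * y = y * parity x := by
  induction x using ExtAlg.induction with
  | incl f => rw [parity_incl, incl_mul, mul_incl]
  | θ i => rw [θ_mul_comm, hy, parity_θ, mul_neg, neg_mul]
  | add u v hu hv => rw [map_add, mul_add, add_mul, hu, hv]
  | mul u v hu hv => rw [mul_assoc, hv, ← mul_assoc, hu, mul_assoc, map_mul]

/-! ### Coordinates with respect to the monomials in the forms -/

/-- Membership in the span of the eight monomials does not pass directly to products. What is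
inductive in `y` is that left multiplication by `y` preserves this span; applying it to `1` gives
the claim. -/
theorem exists_coeff (x : ExtAlg) : ∃ k : Fin 8 → FunAlg,
    x = k 0 • 1 + k 1 • θ 0 + k 2 • θ 1 + k 3 • θ 2 + k 4 • (θ 0 * θ 1) + k 5 • (θ 0 * θ 2)
      + k 6 • (θ 1 * θ 2) + k 7 • (θ 0 * θ 1 * θ 2) := by
  suffices H : ∀ y : ExtAlg, ∀ k : Fin 8 → FunAlg, ∃ l : Fin 8 → FunAlg,
      y * (k 0 • 1 + k 1 • θ 0 + k 2 • θ 1 + k 3 • θ 2 + k 4 • (θ 0 * θ 1) + k 5 • (θ 0 * θ 2)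
      + k 6 • (θ 1 * θ 2) + k 7 • (θ 0 * θ 1 * θ 2)) =
      l 0 • 1 + l 1 • θ 0 + l 2 • θ 1 + l 3 • θ 2 + l 4 • (θ 0 * θ 1) + l 5 • (θ 0 * θ 2)
      + l 6 • (θ 1 * θ 2) + l 7 • (θ 0 * θ 1 * θ 2) by
    obtain ⟨l, hl⟩ := H x ![1, 0, 0, 0, 0, 0, 0, 0]
    exact ⟨l, by rw [← hl]; simp⟩
  intro y
  induction y using ExtAlg.induction with
  | incl f => exact fun k => ⟨fun i => f * k i, by simp only [incl_mul, smul_add, smul_smul]⟩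
  | θ i =>
    intro k
    have h00 := θ_mul_self 0
    have h11 := θ_mul_self 1
    have h22 := θ_mul_self 2
    have h10 := θ_mul_swap 1 0
    have h20 := θ_mul_swap 2 0
    have h21 := θ_mul_swap 2 1
    fin_cases i
    · refine ⟨![0, k 0, 0, 0, k 2, k 3, 0, k 6], ?_⟩
      simp [mul_add, ← mul_assoc, h00]
    · refine ⟨![0, 0, k 0, 0, -k 1, 0, k 3, -k 5], ?_⟩
      simp [mul_add, ← mul_assoc, h11, h10, mul_assoc _ (θ 1) (θ 1)]
    · refine ⟨![0, 0, 0, k 0, 0, -k 1, -k 2, k 4], ?_⟩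
      simp [mul_add, ← mul_assoc, h22, h20, h21, mul_assoc _ (θ 2) (θ 1),
        mul_assoc _ (θ 2) (θ 2)]
  | add x y hx hy =>
    intro k
    obtain ⟨l, hl⟩ := hx k
    obtain ⟨m, hm⟩ := hy k
    exact ⟨l + m, by rw [add_mul, hl, hm]; simp only [Pi.add_apply]; module⟩
  | mul x y hx hy =>
    intro k
    obtain ⟨l, hl⟩ := hy k
    obtain ⟨m, hm⟩ := hx l
    exact ⟨m, by rw [mul_assoc, hl, hm]⟩

/-- The contraction with the `i`-th coordinate, an odd derivation of `ℳ` over `𝒜`. -/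
def contract (i : Fin 3) : ExtAlg →ₗ[FunAlg] ExtAlg :=
  TensorProduct.AlgebraTensorModule.lTensor FunAlg FunAlg
    (CliffordAlgebra.contractLeft (Q := (0 : QuadraticForm ℂ (Fin 3 → ℂ)))
      (LinearMap.proj i : (Fin 3 → ℂ) →ₗ[ℂ] ℂ))

theorem contract_tmul (i : Fin 3) (f : FunAlg) (w : Forms) :
    contract i (f ⊗ₜ w) = f ⊗ₜ (CliffordAlgebra.contractLeft
      (Q := (0 : QuadraticForm ℂ (Fin 3 → ℂ))) (LinearMap.proj i : (Fin 3 → ℂ) →ₗ[ℂ] ℂ) w) := rfl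

@[simp] theorem contract_one (i : Fin 3) : contract i 1 = 0 := by
  rw [Algebra.TensorProduct.one_def, contract_tmul, CliffordAlgebra.contractLeft_one,
    TensorProduct.tmul_zero]

@[simp] theorem contract_incl (i : Fin 3) (f : FunAlg) : contract i (incl f) = 0 := by
  rw [incl_eq_smul, map_smul, contract_one, smul_zero]

theorem contract_θ (i j : Fin 3) : contract i (θ j) = if i = j then 1 else 0 := by
  rw [θ, contract_tmul]
  erw [CliffordAlgebra.contractLeft_ι]
  simp only [LinearMap.coe_proj, Function.eval, Pi.single_apply]
  split_ifs <;> simp [Algebra.TensorProduct.one_def]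

theorem contract_θ_mul (i j : Fin 3) (x : ExtAlg) :
    contract i (θ j * x) = contract i (θ j) * x - θ j * contract i x := by
  induction x using TensorProduct.induction_on with
  | zero => simp
  | add x y hx hy => rw [mul_add, map_add, hx, hy, map_add]; noncomm_ring
  | tmul f w =>
    rw [contract_θ, θ, Algebra.TensorProduct.tmul_mul_tmul, one_mul, contract_tmul, contract_tmul]
    erw [CliffordAlgebra.contractLeft_ι_mul]
    simp only [LinearMap.coe_proj, Function.eval, Pi.single_apply, TensorProduct.tmul_sub]
    split_ifs <;> simp [ExteriorAlgebra.ι]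

theorem parity_contract (i : Fin 3) (x : ExtAlg) :
    parity (contract i x) = -contract i (parity x) := by
  suffices H : ∀ y x : ExtAlg, parity (contract i x) = -contract i (parity x) →
      parity (contract i (y * x)) = -contract i (parity (y * x)) by
    simpa using H x 1 (by simp)
  intro y
  induction y using ExtAlg.induction with
  | incl f => intro x hx; simp [incl_mul, hx]
  | θ j =>
    intro x hx
    rw [contract_θ_mul, map_mul, parity_θ, neg_mul, map_neg, contract_θ_mul, map_sub, map_mul,
      map_mul, hx, parity_θ, contract_θ]
    split_ifs <;> simp
  | add u v hu hv =>
    intro x hx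
    simp only [add_mul, map_add, hu x hx, hv x hx, neg_add]
  | mul u v hu hv => intro x hx; rw [mul_assoc]; exact hu _ (hv _ hx)

theorem contract_mul (i : Fin 3) (x y : ExtAlg) :
    contract i (x * y) = contract i x * y + parity x * contract i y := by
  induction x using ExtAlg.induction generalizing y with
  | incl f => simp [incl_mul]
  | θ j => rw [contract_θ_mul, parity_θ, neg_mul, sub_eq_add_neg]
  | add u v hu hv => rw [add_mul, map_add, hu, hv, map_add, map_add]; noncomm_ring
  | mul u v hu hv => rw [mul_assoc, hu, hv, hu, map_mul]; noncomm_ring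

/-- The projection of `ℳ` onto its forms of degree zero. -/
def aug : ExtAlg →ₗ[FunAlg] FunAlg :=
  (TensorProduct.AlgebraTensorModule.rid ℂ FunAlg FunAlg).toLinearMap ∘ₗ
    TensorProduct.AlgebraTensorModule.lTensor FunAlg FunAlg
      (ExteriorAlgebra.algebraMapInv : Forms →ₐ[ℂ] ℂ).toLinearMap

theorem aug_tmul (f : FunAlg) (w : Forms) :
    aug (f ⊗ₜ w) = (ExteriorAlgebra.algebraMapInv w : ℂ) • f := rfl

@[simp] theorem aug_one : aug 1 = 1 := by
  rw [Algebra.TensorProduct.one_def, aug_tmul, map_one, one_smul]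

@[simp] theorem aug_incl (f : FunAlg) : aug (incl f) = f := by
  rw [incl_eq_smul, map_smul, aug_one, smul_eq_mul, mul_one]

@[simp] theorem aug_θ_mul (i : Fin 3) (x : ExtAlg) : aug (θ i * x) = 0 := by
  induction x using TensorProduct.induction_on with
  | zero => simp
  | add x y hx hy => rw [mul_add, map_add, hx, hy, add_zero]
  | tmul f w =>
    rw [θ, Algebra.TensorProduct.tmul_mul_tmul, aug_tmul, map_mul]
    simp [ExteriorAlgebra.algebraMapInv]

@[simp] theorem aug_θ (i : Fin 3) : aug (θ i) = 0 := by simpa using aug_θ_mul i 1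

/-- The coefficient of `θⁱ`. -/
def coeff₁ (i : Fin 3) : ExtAlg →ₗ[FunAlg] FunAlg := aug ∘ₗ contract i

/-- The coefficient of `θⁱ θʲ`. -/
def coeff₂ (i j : Fin 3) : ExtAlg →ₗ[FunAlg] FunAlg := aug ∘ₗ contract j ∘ₗ contract i

/-- The coefficient of the volume form `θ⁰ θ¹ θ²`. -/
def coeff₃ : ExtAlg →ₗ[FunAlg] FunAlg := aug ∘ₗ contract 2 ∘ₗ contract 1 ∘ₗ contract 0

/-- The volume form `θ⁰ θ¹ θ²`. -/
def vol : ExtAlg := θ 0 * θ 1 * θ 2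

@[simp] theorem coeff₁_one (i : Fin 3) : coeff₁ i 1 = 0 := by simp [coeff₁]

theorem coeff₁_θ (i j : Fin 3) : coeff₁ i (θ j) = if i = j then 1 else 0 := by
  simp only [coeff₁, LinearMap.comp_apply, contract_θ]
  split_ifs <;> simp

@[simp] theorem coeff₁_θ_mul_θ (i j k : Fin 3) : coeff₁ i (θ j * θ k) = 0 := by
  simp only [coeff₁, LinearMap.comp_apply, contract_θ_mul, contract_θ, map_sub, aug_θ_mul]
  split_ifs <;> simp

@[simp] theorem coeff₁_vol (i : Fin 3) : coeff₁ i vol = 0 := by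
  simp only [coeff₁, vol, LinearMap.comp_apply, mul_assoc, contract_θ_mul, contract_θ, map_sub,
    aug_θ_mul]
  split_ifs <;> simp

theorem coeff₂_θ_mul_θ (i j k l : Fin 3) : coeff₂ i j (θ k * θ l) =
    (if i = k then if j = l then 1 else 0 else 0)
      - (if i = l then if j = k then 1 else 0 else 0) := by
  simp only [coeff₂, LinearMap.comp_apply, contract_θ_mul, contract_θ]
  split_ifs <;> simp_all [contract_θ]

@[simp] theorem coeff₃_one : coeff₃ 1 = 0 := by simp [coeff₃]

@[simp] theorem coeff₃_θ (i : Fin 3) : coeff₃ (θ i) = 0 := by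
  simp only [coeff₃, LinearMap.comp_apply, contract_θ]
  split_ifs <;> simp

@[simp] theorem coeff₃_θ_mul_θ (i j : Fin 3) : coeff₃ (θ i * θ j) = 0 := by
  simp only [coeff₃, LinearMap.comp_apply, contract_θ_mul, contract_θ]
  split_ifs <;> simp [contract_θ] <;> split_ifs <;> simp

@[simp] theorem coeff₃_vol : coeff₃ vol = 1 := by
  simp [coeff₃, vol, contract_θ_mul, contract_θ, mul_assoc]

/-- The even monomials of `x` add up to half of `x + parity x`, which is zero. The volume term is
odd too: it is the source of a possible cubic part in `{θⁱ, f}`. -/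
theorem odd_expansion {x : ExtAlg} (hx : parity x = -x) :
    x = coeff₁ 0 x • θ 0 + coeff₁ 1 x • θ 1 + coeff₁ 2 x • θ 2 + coeff₃ x • vol := by
  obtain ⟨k, rfl⟩ := exists_coeff x
  have h : k 0 • 1 + k 4 • (θ 0 * θ 1) + k 5 • (θ 0 * θ 2) + k 6 • (θ 1 * θ 2) = 0 := by
    simp only [map_add, parity_smul, map_mul, parity_θ, map_one, neg_mul, mul_neg, neg_neg,
      smul_neg] at hx
    rw [← sub_eq_zero, sub_neg_eq_add] at hx
    have h2 : (2 : ℂ) •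
        (k 0 • 1 + k 4 • (θ 0 * θ 1) + k 5 • (θ 0 * θ 2) + k 6 • (θ 1 * θ 2)) = 0 := by
      rw [two_smul, ← hx]; abel
    exact (smul_eq_zero_iff_right two_ne_zero).mp h2
  simp only [← vol.eq_1, map_add, map_smul, coeff₁_one, coeff₁_θ_mul_θ, coeff₁_vol, coeff₃_one,
    coeff₃_θ, coeff₃_θ_mul_θ, coeff₃_vol, coeff₁_θ]
  simp only [Fin.reduceEq, if_true, if_false, smul_eq_mul, mul_one, mul_zero, add_zero, zero_add]
  rw [← sub_eq_zero, ← h]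
  abel

/-! ### Graded brackets through the parity automorphism -/

/-- The defining properties of a graded bracket, stated with the parity automorphism in place of
homogeneous elements wherever possible. -/
structure IsSuperBracket (B : Bracket) : Prop where
  parity_map : ∀ x y, parity (B x y) = B (parity x) (parity y)
  even_symm : ∀ x, parity x = x → ∀ y, B x y = -B y x
  odd_symm : ∀ x y, parity x = -x → parity y = -y → B x y = B y x
  even_leibniz : ∀ x, parity x = x → ∀ y z, B x (y * z) = B x y * z + y * B x z
  odd_leibniz : ∀ x, parity x = -x → ∀ y z, B x (y * z) = B x y * z + parity y * B x z

@[elab_as_elim]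
theorem homogeneous_induction {P : ExtAlg → Prop} (x : ExtAlg) (even : ∀ x, parity x = x → P x)
    (odd : ∀ x, parity x = -x → P x) (add : ∀ x y, P x → P y → P (x + y)) : P x := by
  obtain ⟨y, z, hy, hz, rfl⟩ := even_add_odd x
  exact add _ _ (even y hy) (odd z hz)

theorem one_add_one_zmod_two : (1 : ZMod 2) + 1 = 0 := by decide

/-- The given Leibniz rule concerns the first argument; graded symmetry moves it to the second.
There the sign depends on one factor only and becomes an application of `parity`, which frees `y`
and `z` from homogeneity. -/
theorem IsGradedBracket.isSuperBracket {B : Bracket} (hB : IsGradedBracket B) :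
    IsSuperBracket B := by
  have deg00 := fun x y hx hy =>
    mem_degPart_zero.mp (hB.degree 0 0 x y (mem_degPart_zero.mpr hx) (mem_degPart_zero.mpr hy))
  have deg01 := fun x y hx hy =>
    mem_degPart_one.mp (hB.degree 0 1 x y (mem_degPart_zero.mpr hx) (mem_degPart_one.mpr hy))
  have deg10 := fun x y hx hy =>
    mem_degPart_one.mp (hB.degree 1 0 x y (mem_degPart_one.mpr hx) (mem_degPart_zero.mpr hy))
  have deg11 := fun x y hx hy =>
    mem_degPart_zero.mp (one_add_one_zmod_two ▸
      hB.degree 1 1 x y (mem_degPart_one.mpr hx) (mem_degPart_one.mpr hy))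
  have symm00 := fun x y hx hy =>
    hB.symm 0 0 x y (mem_degPart_zero.mpr hx) (mem_degPart_zero.mpr hy)
  have symm01 := fun x y hx hy =>
    hB.symm 0 1 x y (mem_degPart_zero.mpr hx) (mem_degPart_one.mpr hy)
  have symm11 := fun x y hx hy =>
    hB.symm 1 1 x y (mem_degPart_one.mpr hx) (mem_degPart_one.mpr hy)
  simp only [koszul_zero_left, one_smul, koszul_one_one, neg_smul, neg_neg]
    at symm00 symm01 symm11
  have even_symm : ∀ x, parity x = x → ∀ y, B x y = -B y x := by
    intro x hx y
    induction y using homogeneous_induction with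
    | even y hy => exact symm00 x y hx hy
    | odd y hy => exact symm01 x y hx hy
    | add y z hy hz => rw [map_add, map_add, hy, hz, LinearMap.add_apply, neg_add]
  have even_even : ∀ x y z, parity x = x → parity y = y →
      B x (y * z) = B x y * z + y * B x z := by
    intro x y z hx hy
    rw [even_symm x hx (y * z)]
    induction z using homogeneous_induction with
    | even z hz =>
      rw [hB.leibniz 0 0 0 y z x (mem_degPart_zero.mpr hy) (mem_degPart_zero.mpr hz)
        (mem_degPart_zero.mpr hx), even_symm x hx, even_symm x hx]
      simp
    | odd z hz =>
      rw [hB.leibniz 0 1 0 y z x (mem_degPart_zero.mpr hy) (mem_degPart_one.mpr hz)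
        (mem_degPart_zero.mpr hx), even_symm x hx, even_symm x hx]
      simp
    | add z w hz hw =>
      rw [mul_add, map_add, LinearMap.add_apply, neg_add, hz, hw, map_add]; noncomm_ring
  have even_odd : ∀ x y z, parity x = x → parity y = -y →
      B x (y * z) = B x y * z + y * B x z := by
    intro x y z hx hy
    rw [even_symm x hx (y * z)]
    induction z using homogeneous_induction with
    | even z hz =>
      rw [hB.leibniz 1 0 0 y z x (mem_degPart_one.mpr hy) (mem_degPart_zero.mpr hz)
        (mem_degPart_zero.mpr hx), even_symm x hx, even_symm x hx]
      simp
    | odd z hz =>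
      rw [hB.leibniz 1 1 0 y z x (mem_degPart_one.mpr hy) (mem_degPart_one.mpr hz)
        (mem_degPart_zero.mpr hx), even_symm x hx, even_symm x hx]
      simp
    | add z w hz hw =>
      rw [mul_add, map_add, LinearMap.add_apply, neg_add, hz, hw, map_add]; noncomm_ring
  have odd_even : ∀ x y z, parity x = -x → parity y = y →
      B x (y * z) = B x y * z + y * B x z := by
    intro x y z hx hy
    induction z using homogeneous_induction with
    | even z hz =>
      have hyz : parity (y * z) = y * z := by rw [map_mul, hy, hz]
      rw [← neg_neg (B x (y * z)), ← even_symm _ hyz,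
        hB.leibniz 0 0 1 y z x (mem_degPart_zero.mpr hy) (mem_degPart_zero.mpr hz)
        (mem_degPart_one.mpr hx), even_symm y hy, even_symm z hz]
      simp
    | odd z hz =>
      have hyz : parity (y * z) = -(y * z) := by rw [map_mul, hy, hz, mul_neg]
      rw [symm11 x _ hx hyz, hB.leibniz 0 1 1 y z x (mem_degPart_zero.mpr hy)
        (mem_degPart_one.mpr hz) (mem_degPart_one.mpr hx), even_symm y hy, symm11 z x hz hx]
      simp; abel
    | add z w hz hw => rw [mul_add, map_add, hz, hw, map_add]; noncomm_ring
  have odd_odd : ∀ x y z, parity x = -x → parity y = -y →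
      B x (y * z) = B x y * z - y * B x z := by
    intro x y z hx hy
    induction z using homogeneous_induction with
    | even z hz =>
      have hyz : parity (y * z) = -(y * z) := by rw [map_mul, hy, hz, neg_mul]
      rw [symm11 x _ hx hyz, hB.leibniz 1 0 1 y z x (mem_degPart_one.mpr hy)
        (mem_degPart_zero.mpr hz) (mem_degPart_one.mpr hx), even_symm z hz, symm11 y x hy hx]
      simp; abel
    | odd z hz =>
      have hyz : parity (y * z) = y * z := by rw [map_mul, hy, hz, neg_mul_neg]
      rw [← neg_neg (B x (y * z)), ← even_symm _ hyz,
        hB.leibniz 1 1 1 y z x (mem_degPart_one.mpr hy) (mem_degPart_one.mpr hz)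
        (mem_degPart_one.mpr hx), symm11 y x hy hx, symm11 z x hz hx]
      simp; abel
    | add z w hz hw => rw [mul_add, map_add, hz, hw, map_add]; noncomm_ring
  refine ⟨fun x y => ?_, even_symm, symm11, fun x hx y z => ?_, fun x hx y z => ?_⟩
  · induction x using homogeneous_induction with
    | even x hx =>
      induction y using homogeneous_induction with
      | even y hy => rw [hx, hy, deg00 x y hx hy]
      | odd y hy => rw [hx, hy, deg01 x y hx hy, map_neg]
      | add y z hy hz => simp only [map_add, hy, hz]
    | odd x hx =>
      induction y using homogeneous_induction with
      | even y hy => rw [hx, hy, deg10 x y hx hy, map_neg, LinearMap.neg_apply]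
      | odd y hy => rw [hx, hy, deg11 x y hx hy, map_neg, map_neg, LinearMap.neg_apply, neg_neg]
      | add y z hy hz => simp only [map_add, hy, hz]
    | add x z hx hz => simp only [map_add, LinearMap.add_apply, hx, hz]
  · induction y using homogeneous_induction with
    | even y hy => exact even_even x y z hx hy
    | odd y hy => exact even_odd x y z hx hy
    | add y w hy hw => rw [add_mul, map_add, hy, hw, map_add]; noncomm_ring
  · induction y using homogeneous_induction with
    | even y hy => rw [hy]; exact odd_even x y z hx hy
    | odd y hy => rw [hy, neg_mul, ← sub_eq_add_neg]; exact odd_odd x y z hx hy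
    | add y w hy hw => rw [add_mul, map_add, hy, hw, map_add, map_add]; noncomm_ring

namespace IsSuperBracket
variable {B B' : Bracket}

theorem isGradedBracket (hB : IsSuperBracket B) : IsGradedBracket B where
  degree p q x y hx hy := by
    rcases zmod_two_cases p with rfl | rfl <;> rcases zmod_two_cases q with rfl | rfl <;>
      simp only [add_zero, zero_add, one_add_one_zmod_two, mem_degPart_zero, mem_degPart_one]
        at * <;> simp [hB.parity_map, hx, hy]
  symm p q x y hx hy := by
    rcases zmod_two_cases p with rfl | rfl <;> rcases zmod_two_cases q with rfl | rfl <;>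
      simp only [mem_degPart_zero, mem_degPart_one, koszul_zero_left, koszul_zero_right,
        koszul_one_one, one_smul, neg_smul, neg_neg] at *
    · exact hB.even_symm x hx y
    · exact hB.even_symm x hx y
    · rw [hB.even_symm y hy, neg_neg]
    · exact hB.odd_symm x y hx hy
  leibniz p q r x y z hx hy hz := by
    rcases zmod_two_cases r with rfl | rfl
    · rw [mem_degPart_zero] at hz
      rw [← neg_neg (B (x * y) z), ← hB.even_symm z hz, hB.even_leibniz z hz, hB.even_symm z hz,
        hB.even_symm z hz]
      simp
    · rw [mem_degPart_one] at hz
      have comm0 : ∀ y, parity y = y → B y z = -B z y := fun y hy => hB.even_symm y hy z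
      have comm1 : ∀ y, parity y = -y → B y z = B z y := fun y hy => hB.odd_symm y z hy hz
      rcases zmod_two_cases p with rfl | rfl <;> rcases zmod_two_cases q with rfl | rfl <;>
        simp only [mem_degPart_zero, mem_degPart_one, koszul_zero_left,
          koszul_one_one, one_smul, neg_smul] at *
      · rw [comm0 _ (by rw [map_mul, hx, hy]), hB.odd_leibniz z hz, comm0 x hx, comm0 y hy, hx]
        noncomm_ring
      · rw [comm1 _ (by rw [map_mul, hx, hy, mul_neg]), hB.odd_leibniz z hz, comm0 x hx,
          comm1 y hy, hx]
        noncomm_ring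
      · rw [comm1 _ (by rw [map_mul, hx, hy, neg_mul]), hB.odd_leibniz z hz, comm1 x hx,
          comm0 y hy, hx]
        noncomm_ring
      · rw [comm0 _ (by rw [map_mul, hx, hy, neg_mul_neg]), hB.odd_leibniz z hz, comm1 x hx,
          comm1 y hy, hx]
        noncomm_ring

theorem add (hB : IsSuperBracket B) (hB' : IsSuperBracket B') : IsSuperBracket (B + B') where
  parity_map x y := by simp [hB.parity_map, hB'.parity_map]
  even_symm x hx y := by
    simp only [LinearMap.add_apply, hB.even_symm x hx y, hB'.even_symm x hx y, neg_add]
  odd_symm x y hx hy := by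
    simp only [LinearMap.add_apply, hB.odd_symm x y hx hy, hB'.odd_symm x y hx hy]
  even_leibniz x hx y z := by
    simp only [LinearMap.add_apply, hB.even_leibniz x hx y z, hB'.even_leibniz x hx y z]
    noncomm_ring
  odd_leibniz x hx y z := by
    simp only [LinearMap.add_apply, hB.odd_leibniz x hx y z, hB'.odd_leibniz x hx y z]
    noncomm_ring

/-- Functions are even, so no sign appears and `x` may be inhomogeneous. -/
theorem apply_smul (hB : IsSuperBracket B) (x : ExtAlg) (f : FunAlg) (y : ExtAlg) :
    B x (f • y) = B x (incl f) * y + f • B x y := by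
  rw [← incl_mul, ← incl_mul]
  induction x using homogeneous_induction with
  | even x hx => exact hB.even_leibniz x hx _ _
  | odd x hx => simpa using hB.odd_leibniz x hx (incl f) y
  | add x z hx hz => simp only [map_add, LinearMap.add_apply, hx, hz]; noncomm_ring

theorem symm_incl (hB : IsSuperBracket B) (x : ExtAlg) (f : FunAlg) :
    B x (incl f) = -B (incl f) x := by
  rw [hB.even_symm _ (parity_incl f), neg_neg]

theorem mul_apply_incl (hB : IsSuperBracket B) (x y : ExtAlg) (f : FunAlg) :
    B (x * y) (incl f) = B x (incl f) * y + x * B y (incl f) := by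
  simp only [hB.symm_incl, hB.even_leibniz _ (parity_incl f)]
  noncomm_ring

theorem smul_apply_incl (hB : IsSuperBracket B) (f : FunAlg) (x : ExtAlg) (h : FunAlg) :
    B (f • x) (incl h) = B (incl f) (incl h) * x + f • B x (incl h) := by
  rw [← incl_mul, hB.mul_apply_incl, incl_mul]

theorem apply_one (hB : IsSuperBracket B) (x : ExtAlg) : B x 1 = 0 := by
  have h := hB.apply_smul x 1 1
  rw [map_one, mul_one, one_smul] at h
  simpa using h

theorem apply_algebraMap (hB : IsSuperBracket B) (x : ExtAlg) (r : ℂ) :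
    B x (incl (algebraMap ℂ FunAlg r)) = 0 := by
  rw [AlgHom.commutes, Algebra.algebraMap_eq_smul_one, map_smul, hB.apply_one, smul_zero]

/-- Two linear maps that satisfy the Leibniz rule on functions agree if they agree on `T`. -/
theorem eq_on_incl {M : Type*} [AddCommGroup M] [Module ℂ M] [Module FunAlg M]
    {D D' : FunAlg →ₗ[ℂ] M}
    (h0 : ∀ r : ℂ, D (algebraMap ℂ FunAlg r) = D' (algebraMap ℂ FunAlg r))
    (hD : ∀ f g, D (f * g) = g • D f + f • D g) (hD' : ∀ f g, D' (f * g) = g • D' f + f • D' g)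
    (ha : D a = D' a) (hb : D b = D' b) (hc : D c = D' c) (hd : D d = D' d) : D = D' := by
  ext f
  induction f using FunAlg.induction with
  | scalar r => exact h0 r
  | ha => exact ha
  | hb => exact hb
  | hc => exact hc
  | hd => exact hd
  | add f g hf hg => rw [map_add, map_add, hf, hg]
  | mul f g hf hg => rw [hD, hD', hf, hg]

theorem eq_on_generators (hB : IsSuperBracket B) (hB' : IsSuperBracket B') {x : ExtAlg}
    (hx : parity x = x ∨ parity x = -x) (hf : ∀ f, B x (incl f) = B' x (incl f))
    (hθ : ∀ i, B x (θ i) = B' x (θ i)) (y : ExtAlg) : B x y = B' x y := by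
  induction y using ExtAlg.induction with
  | incl f => exact hf f
  | θ i => exact hθ i
  | add y z hy hz => rw [map_add, map_add, hy, hz]
  | mul y z hy hz =>
    rcases hx with hx | hx
    · rw [hB.even_leibniz x hx, hB'.even_leibniz x hx, hy, hz]
    · rw [hB.odd_leibniz x hx, hB'.odd_leibniz x hx, hy, hz]

/-- The Leibniz rule frees the second argument while the first is a generator; symmetry then
exchanges the roles and the rule is used once more. -/
theorem ext_of_generators (hB : IsSuperBracket B) (hB' : IsSuperBracket B')
    (hff : ∀ f h, B (incl f) (incl h) = B' (incl f) (incl h))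
    (hθf : ∀ i f, B (θ i) (incl f) = B' (θ i) (incl f))
    (hθθ : ∀ i j, B (θ i) (θ j) = B' (θ i) (θ j)) : B = B' := by
  have hf (f : FunAlg) (y : ExtAlg) : B (incl f) y = B' (incl f) y :=
    eq_on_generators hB hB' (.inl (parity_incl f)) (hff f)
      (fun i => by rw [hB.even_symm _ (parity_incl f), hB'.even_symm _ (parity_incl f), hθf]) y
  have hθ (i : Fin 3) (y : ExtAlg) : B (θ i) y = B' (θ i) y :=
    eq_on_generators hB hB' (.inr (parity_θ i)) (hθf i) (hθθ i) y
  refine LinearMap.ext fun x => LinearMap.ext fun y => ?_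
  induction x using homogeneous_induction with
  | even x hx =>
    refine eq_on_generators hB hB' (.inl hx) (fun f => ?_) (fun i => ?_) y
    · rw [hB.symm_incl, hB'.symm_incl, hf]
    · rw [hB.even_symm x hx, hB'.even_symm x hx, hθ]
  | odd x hx =>
    refine eq_on_generators hB hB' (.inr hx) (fun f => ?_) (fun i => ?_) y
    · rw [hB.symm_incl, hB'.symm_incl, hf]
    · rw [hB.odd_symm x _ hx (parity_θ i), hB'.odd_symm x _ hx (parity_θ i), hθ]
  | add x z hx hz => rw [map_add, map_add, LinearMap.add_apply, LinearMap.add_apply, hx, hz]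

/-! ### Reduction of the Jacobi identity to generators -/

/-- The defect of `{x, ·}` from being a derivation of the bracket, with the sign `s`. -/
def jacobiator (B : Bracket) (s : ℂ) (x y z : ExtAlg) : ExtAlg :=
  B x (B y z) - s • B y (B x z) - B (B x y) z

/-- Graded symmetry turns the cyclic sum into the statement that `{x, ·}` is a derivation of the
bracket, a form in which Leibniz arguments apply. -/
theorem jacobi_eq_jacobiator (hB : IsSuperBracket B) {p q r : ZMod 2} {x y z : ExtAlg}
    (hx : x ∈ degPart p) (hy : y ∈ degPart q) (hz : z ∈ degPart r) :
    koszul p r • B (B x y) z + koszul q r • B (B z x) y + koszul p q • B (B y z) x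
      = -(koszul p r • jacobiator B (koszul p q) x y z) := by
  have h1 := hB.isGradedBracket.symm r p z x hz hx
  have h2 := hB.isGradedBracket.symm _ _ _ _ (hB.isGradedBracket.degree _ _ _ _ hz hx) hy
  have h3 := hB.isGradedBracket.symm _ _ _ _ (hB.isGradedBracket.degree _ _ _ _ hy hz) hx
  rw [h2, h3, h1, jacobiator]
  rcases zmod_two_cases p with rfl | rfl <;> rcases zmod_two_cases q with rfl | rfl <;>
    rcases zmod_two_cases r with rfl | rfl <;>
    simp [one_add_one_zmod_two] <;> abel

/-- The cyclic sum is invariant under rotation, and its vanishing is equivalent to that of the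
jacobiator, the two differing by a sign. -/
theorem jacobiator_rotate (hB : IsSuperBracket B) {p q r : ZMod 2} {x y z : ExtAlg}
    (hx : x ∈ degPart p) (hy : y ∈ degPart q) (hz : z ∈ degPart r)
    (h : jacobiator B (koszul p q) x y z = 0) : jacobiator B (koszul q r) y z x = 0 := by
  have e := hB.jacobi_eq_jacobiator hx hy hz
  have e' := hB.jacobi_eq_jacobiator hy hz hx
  have hs (p q : ZMod 2) : koszul p q = koszul q p := by simp [koszul, and_comm]
  have hne : koszul q p ≠ 0 := by unfold koszul; split_ifs <;> norm_num
  rw [h, smul_zero, neg_zero, hs p r, hs q r, hs p q] at e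
  have : -(koszul q p • jacobiator B (koszul q r) y z x) = 0 := by
    rw [← e', ← e, hs q r]; abel
  exact (smul_eq_zero_iff_right hne).mp (neg_eq_zero.mp this)

/-- In its last argument the jacobiator is a derivation of degree `p + q`, the cross terms of the
two iterated Leibniz rules cancelling. The twist by `parity` is present exactly when this degree is
odd. -/
theorem jacobiator_zero_of_generators (hB : IsSuperBracket B) {p q : ZMod 2} {x y : ExtAlg}
    (hx : x ∈ degPart p) (hy : y ∈ degPart q)
    (hf : ∀ f, jacobiator B (koszul p q) x y (incl f) = 0)
    (hθ : ∀ i, jacobiator B (koszul p q) x y (θ i) = 0) (z : ExtAlg) :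
    jacobiator B (koszul p q) x y z = 0 := by
  have hxy := hB.isGradedBracket.degree p q x y hx hy
  induction z using ExtAlg.induction with
  | incl f => exact hf f
  | θ i => exact hθ i
  | add z w hz hw =>
    have := congrArg₂ (· + ·) hz hw
    simp only [jacobiator, map_add, smul_add, add_zero] at this ⊢
    rw [← this]; abel
  | mul z w hz hw =>
    rcases zmod_two_cases p with rfl | rfl <;> rcases zmod_two_cases q with rfl | rfl <;>
      simp only [mem_degPart_zero, mem_degPart_one, koszul_zero_left, koszul_zero_right,
        koszul_one_one, one_smul, neg_smul, sub_neg_eq_add, jacobiator, add_zero, zero_add,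
        one_add_one_zmod_two] at hx hy hz hw hxy ⊢
    · have := congrArg₂ (· + ·) (congrArg (· * w) hz) (congrArg (z * ·) hw)
      simp only [zero_mul, mul_zero, add_zero] at this
      simp only [hB.even_leibniz x hx, hB.even_leibniz y hy, hB.even_leibniz _ hxy, map_add]
      rw [← this]; noncomm_ring
    · have := congrArg₂ (· + ·) (congrArg (· * w) hz) (congrArg (parity z * ·) hw)
      simp only [zero_mul, mul_zero, add_zero] at this
      simp only [hB.even_leibniz x hx, hB.odd_leibniz y hy, hB.odd_leibniz _ hxy, map_add,
        hB.parity_map, hx]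
      rw [← this]; noncomm_ring
    · have := congrArg₂ (· + ·) (congrArg (· * w) hz) (congrArg (parity z * ·) hw)
      simp only [zero_mul, mul_zero, add_zero] at this
      simp only [hB.odd_leibniz x hx, hB.even_leibniz y hy, hB.odd_leibniz _ hxy, map_add,
        hB.parity_map, hy]
      rw [← this]; noncomm_ring
    · have := congrArg₂ (· + ·) (congrArg (· * w) hz) (congrArg (z * ·) hw)
      simp only [zero_mul, mul_zero, add_zero] at this
      simp only [hB.odd_leibniz x hx, hB.odd_leibniz y hy, hB.even_leibniz _ hxy, map_add,
        hB.parity_map, hx, hy, map_neg, LinearMap.neg_apply, parity_parity]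
      rw [← this]; noncomm_ring

theorem isGradedPoisson_of_generators (hB : IsSuperBracket B)
    (hfff : ∀ f g h, jacobiator B 1 (incl f) (incl g) (incl h) = 0)
    (hθff : ∀ i f g, jacobiator B 1 (θ i) (incl f) (incl g) = 0)
    (hθθf : ∀ i j f, jacobiator B (-1) (θ i) (θ j) (incl f) = 0)
    (hθθθ : ∀ i j k, jacobiator B (-1) (θ i) (θ j) (θ k) = 0) : IsGradedPoisson B := by
  have mf (f : FunAlg) : incl f ∈ degPart 0 := mem_degPart_zero.mpr (parity_incl f)
  have mθ (i : Fin 3) : θ i ∈ degPart 1 := mem_degPart_one.mpr (parity_θ i)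
  -- Each slot is freed in turn: put it last by rotation, then extend from generators. First the
  -- third slot is freed, then the second with a generator in the first, and finally all three.
  have ff (f g : FunAlg) := hB.jacobiator_zero_of_generators (mf f) (mf g)
    (by simpa using hfff f g)
    (fun i => hB.jacobiator_rotate (mθ i) (mf f) (mf g) (by simpa using hθff i f g))
  have θf (i : Fin 3) (f : FunAlg) := hB.jacobiator_zero_of_generators (mθ i) (mf f)
    (by simpa using hθff i f)
    (fun j => hB.jacobiator_rotate (mθ j) (mθ i) (mf f) (by simpa using hθθf j i f))
  have θθ (i j : Fin 3) := hB.jacobiator_zero_of_generators (mθ i) (mθ j)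
    (by simpa using hθθf i j) (by simpa using hθθθ i j)
  have fθ (f : FunAlg) (i : Fin 3) := hB.jacobiator_zero_of_generators (mf f) (mθ i)
    (fun g => hB.jacobiator_rotate (mf g) (mf f) (mθ i) (ff g f (θ i)))
    (fun j => hB.jacobiator_rotate (mθ j) (mf f) (mθ i) (θf j f (θ i)))
  have f_any (f : FunAlg) {q : ZMod 2} {y : ExtAlg} (hy : y ∈ degPart q) :=
    hB.jacobiator_zero_of_generators (mf f) hy
      (fun g => hB.jacobiator_rotate (mf g) (mf f) hy (ff g f y))
      (fun j => hB.jacobiator_rotate (mθ j) (mf f) hy (θf j f y))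
  have θ_any (i : Fin 3) {q : ZMod 2} {y : ExtAlg} (hy : y ∈ degPart q) :=
    hB.jacobiator_zero_of_generators (mθ i) hy
      (fun g => hB.jacobiator_rotate (mf g) (mθ i) hy (fθ g i y))
      (fun j => hB.jacobiator_rotate (mθ j) (mθ i) hy (θθ j i y))
  refine ⟨hB.isGradedBracket, fun p q r x y z hx hy hz => ?_⟩
  rw [hB.jacobi_eq_jacobiator hx hy hz, hB.jacobiator_zero_of_generators hx hy
    (fun g => hB.jacobiator_rotate (mf g) hx hy (f_any g hx y))
    (fun j => hB.jacobiator_rotate (mθ j) hx hy (θ_any j hx y)), smul_zero, neg_zero]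

end IsSuperBracket

/-! ### Values of a bracket on functions and forms -/

theorem sklyanin_symm (f h : FunAlg) : sklyanin f h = -sklyanin h f := by
  unfold sklyanin; ring

/-- The Hamiltonian vector field of `f`. -/
def hamiltonian (f : FunAlg) : Derivation ℂ FunAlg FunAlg :=
  -(vE f • vF - vF f • vE + (wE f • wF - wF f • wE))

theorem hamiltonian_apply (f h : FunAlg) : hamiltonian f h = sklyanin f h := rfl

theorem ProlongsSklyanin.apply_incl {B : Bracket} (hS : ProlongsSklyanin B)
    (hB : IsSuperBracket B) (f h : FunAlg) : B (incl f) (incl h) = incl (sklyanin f h) := by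
  have sw (f h : FunAlg) : B (incl f) (incl h) = -B (incl h) (incl f) := hB.symm_incl _ _
  -- Antisymmetry gives `2{f, f} = 0`; with it the six tabulated brackets determine all sixteen
  -- brackets of matrix entries.
  have self (f : FunAlg) : B (incl f) (incl f) = 0 := by
    have h2 : (2 : ℂ) • B (incl f) (incl f) = 0 := by
      rw [two_smul]; exact add_eq_zero_iff_eq_neg.mpr (sw f f)
    exact (smul_eq_zero_iff_right two_ne_zero).mp h2
  have ext (f : FunAlg) (ha : B (incl f) (incl a) = incl (sklyanin f a))
      (hb : B (incl f) (incl b) = incl (sklyanin f b))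
      (hc : B (incl f) (incl c) = incl (sklyanin f c))
      (hd : B (incl f) (incl d) = incl (sklyanin f d)) (h : FunAlg) :
      B (incl f) (incl h) = incl (sklyanin f h) := by
    refine LinearMap.congr_fun (IsSuperBracket.eq_on_incl (D := B (incl f) ∘ₗ incl.toLinearMap)
      (D' := incl.toLinearMap ∘ₗ (hamiltonian f).toLinearMap) ?_ ?_ ?_ ha hb hc hd) h
    · intro r
      exact (hB.apply_algebraMap (incl f) r).trans (by simp)
    · intro g h
      simp only [LinearMap.comp_apply, AlgHom.toLinearMap_apply, map_mul]
      rw [incl_mul, hB.apply_smul, mul_incl]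
    · intro g h
      simp [incl_mul, add_comm]
  have gen : ∀ f ∈ ({a, b, c, d} : Set FunAlg), ∀ h, B (incl f) (incl h) = incl (sklyanin f h) := by
    rintro _ (rfl | rfl | rfl | rfl) h <;> apply ext
    · rw [self]; simp [sklyanin]
    · rw [hS.ab]; simp [sklyanin, mul_comm]
    · rw [hS.ac]; simp [sklyanin, mul_comm]
    · rw [hS.ad]; congr 1; simp [sklyanin]; ring
    · rw [sw, hS.ab]; simp [sklyanin, mul_comm]
    · rw [self]; simp [sklyanin]
    · rw [sw, hS.cb, neg_zero]; simp [sklyanin, mul_comm]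
    · rw [hS.bd]; simp [sklyanin, mul_comm]
    · rw [sw, hS.ac]; simp [sklyanin, mul_comm]
    · rw [hS.cb]; simp [sklyanin, mul_comm]
    · rw [self]; simp [sklyanin]
    · rw [hS.cd]; simp [sklyanin, mul_comm]
    · rw [sw, hS.ad]; rw [← map_neg]; congr 1; simp [sklyanin]; ring
    · rw [sw, hS.bd]; simp [sklyanin, mul_comm]
    · rw [sw, hS.cd]; simp [sklyanin, mul_comm]
    · rw [self]; simp [sklyanin]
  -- Now `f` is arbitrary: antisymmetry moves the matrix entry to the first slot, where `gen`
  -- applies.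
  apply ext <;> rw [sw, gen _ (by simp), ← map_neg, ← sklyanin_symm]

/-- The derivation of `𝒜` that is the coefficient of `θʲ` in `{θⁱ, ·}`. -/
def mixedCoeff (η : ℂ) : Matrix (Fin 3) (Fin 3) (Derivation ℂ FunAlg FunAlg) :=
  !![0, η • vE, -(2 + η) • vF;
     (4 + 2 * η) • vF, -(1 + η) • vH, 0;
     (-2 * η) • vE, 0, (1 + η) • vH]

/-- The derivation `{θⁱ, ·} : 𝒜 → ℳ` of the one-parameter family. -/
def mixed (η : ℂ) (i : Fin 3) (f : FunAlg) : ExtAlg := ∑ j, mixedCoeff η i j f • θ j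

theorem mixed_zero (η : ℂ) (f : FunAlg) :
    mixed η 0 f = (η • vE f) • θ 1 + (-(2 + η) • vF f) • θ 2 := by
  simp [mixed, mixedCoeff, Fin.sum_univ_three]

theorem mixed_one (η : ℂ) (f : FunAlg) :
    mixed η 1 f = ((4 + 2 * η) • vF f) • θ 0 + (-(1 + η) • vH f) • θ 1 := by
  simp [mixed, mixedCoeff, Fin.sum_univ_three]

theorem mixed_two (η : ℂ) (f : FunAlg) :
    mixed η 2 f = ((-2 * η) • vE f) • θ 0 + ((1 + η) • vH f) • θ 2 := by
  simp [mixed, mixedCoeff, Fin.sum_univ_three]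

/-- Both sides are derivations on `𝒜`, so the twelve table entries are equivalent to a formula in
terms of invariant vector fields valid for every `f`. -/
theorem mixedFamily_iff {B : Bracket} (hB : IsSuperBracket B) (η : ℂ) :
    MixedFamily η B ↔ ∀ i f, B (θ i) (incl f) = mixed η i f := by
  constructor
  · intro h i f
    have ext (i : Fin 3) (ha : B (θ i) (incl a) = mixed η i a)
        (hb : B (θ i) (incl b) = mixed η i b) (hc : B (θ i) (incl c) = mixed η i c)
        (hd : B (θ i) (incl d) = mixed η i d) : B (θ i) (incl f) = mixed η i f := by
      refine LinearMap.congr_fun (IsSuperBracket.eq_on_incl (D := B (θ i) ∘ₗ incl.toLinearMap)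
        (D' := ∑ j, (LinearMap.toSpanSingleton FunAlg ExtAlg (θ j)).restrictScalars ℂ ∘ₗ
          (mixedCoeff η i j).toLinearMap) ?_ ?_ ?_ ?_ ?_ ?_ ?_) f |>.trans ?_
      · intro r
        exact (hB.apply_algebraMap _ r).trans (by simp)
      · intro g h
        simp only [LinearMap.comp_apply, AlgHom.toLinearMap_apply, map_mul]
        rw [incl_mul, hB.apply_smul, mul_incl]
      · intro g h
        simp only [LinearMap.sum_apply, LinearMap.comp_apply, LinearMap.restrictScalars_apply,
          LinearMap.toSpanSingleton_apply, Derivation.coeFn_coe, Derivation.leibniz, add_smul,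
          Finset.sum_add_distrib, Finset.smul_sum, smul_assoc]
        exact add_comm _ _
      all_goals simp [mixed, LinearMap.sum_apply, *]
    fin_cases i <;> apply ext <;>
      simp only [Fin.zero_eta, Fin.mk_one, Fin.reduceFinMk, mixed_zero, mixed_one, mixed_two,
        h.θ0a, h.θ0b, h.θ0c, h.θ0d, h.θ1a, h.θ1b, h.θ1c, h.θ1d, h.θ2a, h.θ2b, h.θ2c, h.θ2d,
        vE_a, vE_b, vE_c, vE_d, vF_a, vF_b, vF_c, vF_d, vH_a, vH_b, vH_c, vH_d] <;> simp <;> module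
  · intro h
    constructor <;> rw [h] <;> simp only [mixed_zero, mixed_one, mixed_two, vE_a, vE_b, vE_c, vE_d,
        vF_a, vF_b, vF_c, vF_d, vH_a, vH_b, vH_c, vH_d] <;> simp <;> module

/-! ### Construction of brackets from derivations -/

/-- Even derivations of `ℳ`. -/
structure IsEvenDer (D : ExtAlg →ₗ[ℂ] ExtAlg) : Prop where
  parity_map : ∀ x, parity (D x) = D (parity x)
  leibniz : ∀ x y, D (x * y) = D x * y + x * D y

/-- Odd derivations of `ℳ`. -/
structure IsOddDer (D : ExtAlg →ₗ[ℂ] ExtAlg) : Prop where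
  parity_map : ∀ x, parity (D x) = -D (parity x)
  leibniz : ∀ x y, D (x * y) = D x * y + parity x * D y

/-- The extension to `ℳ` of a derivation of `𝒜` that vanishes on the forms `θⁱ`. -/
def liftDer (D : Derivation ℂ FunAlg FunAlg) : ExtAlg →ₗ[ℂ] ExtAlg := D.toLinearMap.rTensor Forms

theorem liftDer_tmul (D : Derivation ℂ FunAlg FunAlg) (f : FunAlg) (w : Forms) :
    liftDer D (f ⊗ₜ w) = D f ⊗ₜ w := rfl

@[simp] theorem liftDer_incl (D : Derivation ℂ FunAlg FunAlg) (f : FunAlg) :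
    liftDer D (incl f) = incl (D f) := rfl

@[simp] theorem liftDer_θ (D : Derivation ℂ FunAlg FunAlg) (i : Fin 3) : liftDer D (θ i) = 0 := by
  rw [θ, liftDer_tmul, Derivation.map_one_eq_zero, TensorProduct.zero_tmul]

theorem isEvenDer_liftDer (D : Derivation ℂ FunAlg FunAlg) : IsEvenDer (liftDer D) where
  parity_map x := by
    induction x using TensorProduct.induction_on with
    | zero => simp
    | tmul f w => simp [parity, liftDer_tmul]
    | add x y hx hy => simp only [map_add, hx, hy]
  leibniz x y := by
    induction x using TensorProduct.induction_on with
    | zero => simp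
    | add x z hx hz => rw [add_mul, map_add, hx, hz, map_add]; noncomm_ring
    | tmul f w =>
      induction y using TensorProduct.induction_on with
      | zero => simp
      | add y z hy hz => rw [mul_add, map_add, hy, hz, map_add]; noncomm_ring
      | tmul g v =>
        simp only [Algebra.TensorProduct.tmul_mul_tmul, liftDer_tmul, Derivation.leibniz,
          smul_eq_mul, TensorProduct.add_tmul]
        rw [add_comm, mul_comm g]

theorem isOddDer_contract (i : Fin 3) : IsOddDer ((contract i).restrictScalars ℂ) where
  parity_map := parity_contract i
  leibniz := contract_mul i

/-- Moving the odd factor `n` past `x` produces exactly the `parity x` of an odd derivation. -/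
theorem IsEvenDer.mulLeft {D : ExtAlg →ₗ[ℂ] ExtAlg} (hD : IsEvenDer D) {n : ExtAlg}
    (hn : parity n = -n) : IsOddDer (LinearMap.mulLeft ℂ n ∘ₗ D) where
  parity_map x := by simp [hn, hD.parity_map]
  leibniz x y := by
    have h := mul_comm_of_odd hn (parity x)
    rw [parity_parity] at h
    simp only [LinearMap.comp_apply, LinearMap.mulLeft_apply, hD.leibniz, mul_add, ← mul_assoc, h]

theorem IsOddDer.mulLeft {D : ExtAlg →ₗ[ℂ] ExtAlg} (hD : IsOddDer D) {n : ExtAlg}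
    (hn : parity n = n) : IsOddDer (LinearMap.mulLeft ℂ n ∘ₗ D) where
  parity_map x := by simp [hn, hD.parity_map]
  leibniz x y := by
    simp only [LinearMap.comp_apply, LinearMap.mulLeft_apply, hD.leibniz, mul_add, ← mul_assoc,
      mul_comm_of_even hn (parity x)]

theorem IsOddDer.add {D D' : ExtAlg →ₗ[ℂ] ExtAlg} (hD : IsOddDer D) (hD' : IsOddDer D') :
    IsOddDer (D + D') where
  parity_map x := by simp [hD.parity_map, hD'.parity_map, add_comm]
  leibniz x y := by simp only [LinearMap.add_apply, hD.leibniz, hD'.leibniz]; noncomm_ring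

/-- The bracket `D x · D' y - D' x · D y` of two even derivations. -/
def evenPair (D D' : ExtAlg →ₗ[ℂ] ExtAlg) : Bracket :=
  (LinearMap.mul ℂ ExtAlg).compl₁₂ D D' - (LinearMap.mul ℂ ExtAlg).compl₁₂ D' D

/-- The bracket of two odd derivations. -/
def oddPair (D D' : ExtAlg →ₗ[ℂ] ExtAlg) : Bracket :=
  (LinearMap.mul ℂ ExtAlg).compl₁₂ (parity.toLinearMap ∘ₗ D) D'
    + (LinearMap.mul ℂ ExtAlg).compl₁₂ (parity.toLinearMap ∘ₗ D') D

theorem evenPair_apply (D D' : ExtAlg →ₗ[ℂ] ExtAlg) (x y : ExtAlg) :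
    evenPair D D' x y = D x * D' y - D' x * D y := rfl

theorem oddPair_apply (D D' : ExtAlg →ₗ[ℂ] ExtAlg) (x y : ExtAlg) :
    oddPair D D' x y = parity (D x) * D' y + parity (D' x) * D y := rfl

/-- In the second argument the bracket is a derivation multiplied by an element of `ℳ`, hence
Leibniz; antisymmetrising in `D, D'` gives the symmetry, by graded commutativity. -/
theorem isSuperBracket_evenPair {D D' : ExtAlg →ₗ[ℂ] ExtAlg} (hD : IsEvenDer D)
    (hD' : IsEvenDer D') : IsSuperBracket (evenPair D D') where
  parity_map x y := by simp [evenPair_apply, hD.parity_map, hD'.parity_map]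
  even_symm x hx y := by
    rw [evenPair_apply, evenPair_apply,
      mul_comm_of_even (y := D x) (by rw [hD.parity_map, hx]),
      mul_comm_of_even (y := D' x) (by rw [hD'.parity_map, hx])]
    abel
  odd_symm x y hx hy := by
    have e := mul_comm_of_odd (y := D x) (by rw [hD.parity_map, hx, map_neg]) (D' y)
    have e' := mul_comm_of_odd (y := D' x) (by rw [hD'.parity_map, hx, map_neg]) (D y)
    rw [hD'.parity_map, hy, map_neg] at e
    rw [hD.parity_map, hy, map_neg] at e'
    rw [evenPair_apply, evenPair_apply, e, e']
    noncomm_ring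
  even_leibniz x hx y z := by
    have e := mul_comm_of_even (y := D x) (by rw [hD.parity_map, hx]) y
    have e' := mul_comm_of_even (y := D' x) (by rw [hD'.parity_map, hx]) y
    simp only [evenPair_apply, hD.leibniz, hD'.leibniz, mul_add, mul_sub, sub_mul, ← mul_assoc,
      e, e']
    abel
  odd_leibniz x hx y z := by
    have e := mul_comm_of_odd (y := D x) (by rw [hD.parity_map, hx, map_neg]) (parity y)
    have e' := mul_comm_of_odd (y := D' x) (by rw [hD'.parity_map, hx, map_neg]) (parity y)
    simp only [evenPair_apply, hD.leibniz, hD'.leibniz, mul_add, mul_sub, sub_mul, ← mul_assoc,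
      e, e', parity_parity]
    abel

/-- The `parity` in `oddPair` is, up to a global sign, the Koszul sign of an odd derivation passing
the first argument. With it the sum of the two terms has the required graded symmetry. -/
theorem isSuperBracket_oddPair {D D' : ExtAlg →ₗ[ℂ] ExtAlg} (hD : IsOddDer D)
    (hD' : IsOddDer D') : IsSuperBracket (oddPair D D') where
  parity_map x y := by
    have h (x) : D (parity x) = -parity (D x) := by rw [hD.parity_map, neg_neg]
    have h' (x) : D' (parity x) = -parity (D' x) := by rw [hD'.parity_map, neg_neg]
    simp [oddPair_apply, h, h']
  even_symm x hx y := by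
    have o : parity (D x) = -D x := by rw [hD.parity_map, hx]
    have o' : parity (D' x) = -D' x := by rw [hD'.parity_map, hx]
    have e := mul_comm_of_odd o (parity (D' y))
    have e' := mul_comm_of_odd o' (parity (D y))
    rw [parity_parity] at e e'
    rw [oddPair_apply, oddPair_apply, e, e', o, o']
    noncomm_ring
  odd_symm x y hx hy := by
    have o : parity (D x) = D x := by rw [hD.parity_map, hx, map_neg, neg_neg]
    have o' : parity (D' x) = D' x := by rw [hD'.parity_map, hx, map_neg, neg_neg]
    have p : parity (D y) = D y := by rw [hD.parity_map, hy, map_neg, neg_neg]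
    have p' : parity (D' y) = D' y := by rw [hD'.parity_map, hy, map_neg, neg_neg]
    rw [oddPair_apply, oddPair_apply, o, o', p, p', mul_comm_of_even o, mul_comm_of_even o',
      add_comm]
  even_leibniz x hx y z := by
    have o : parity (D x) = -D x := by rw [hD.parity_map, hx]
    have o' : parity (D' x) = -D' x := by rw [hD'.parity_map, hx]
    simp only [oddPair_apply, hD.leibniz, hD'.leibniz, mul_add, add_mul, ← mul_assoc, o, o',
      neg_mul, mul_neg, mul_comm_of_odd o y, mul_comm_of_odd o' y]
    abel
  odd_leibniz x hx y z := by
    have o : parity (D x) = D x := by rw [hD.parity_map, hx, map_neg, neg_neg]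
    have o' : parity (D' x) = D' x := by rw [hD'.parity_map, hx, map_neg, neg_neg]
    simp only [oddPair_apply, hD.leibniz, hD'.leibniz, mul_add, add_mul, ← mul_assoc, o, o',
      mul_comm_of_even o, mul_comm_of_even o']
    abel

/-! ### The one-parameter family of brackets -/

/-- The forms part of `{θ⁰, ·}`. -/
def formsDer : ExtAlg →ₗ[ℂ] ExtAlg :=
  LinearMap.mulLeft ℂ (-(θ 1 * θ 2)) ∘ₗ (contract 0).restrictScalars ℂ
    + LinearMap.mulLeft ℂ (-2 * (θ 0 * θ 1)) ∘ₗ (contract 1).restrictScalars ℂ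
    + LinearMap.mulLeft ℂ (2 * (θ 0 * θ 2)) ∘ₗ (contract 2).restrictScalars ℂ

theorem isOddDer_formsDer : IsOddDer formsDer :=
  (((isOddDer_contract 0).mulLeft (by simp)).add ((isOddDer_contract 1).mulLeft (by simp [map_ofNat]))).add
    ((isOddDer_contract 2).mulLeft (by simp [map_ofNat]))

/-- The extension to `ℳ` of the derivation `mixed η i`. -/
def mixedDer (η : ℂ) (i : Fin 3) : ExtAlg →ₗ[ℂ] ExtAlg :=
  LinearMap.mulLeft ℂ (θ 0) ∘ₗ liftDer (mixedCoeff η i 0)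
    + LinearMap.mulLeft ℂ (θ 1) ∘ₗ liftDer (mixedCoeff η i 1)
    + LinearMap.mulLeft ℂ (θ 2) ∘ₗ liftDer (mixedCoeff η i 2)

theorem isOddDer_mixedDer (η : ℂ) (i : Fin 3) : IsOddDer (mixedDer η i) :=
  (((isEvenDer_liftDer _).mulLeft (parity_θ 0)).add
    ((isEvenDer_liftDer _).mulLeft (parity_θ 1))).add ((isEvenDer_liftDer _).mulLeft (parity_θ 2))

theorem mixedDer_incl (η : ℂ) (i : Fin 3) (f : FunAlg) : mixedDer η i (incl f) = mixed η i f := by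
  simp [mixedDer, mixed, Fin.sum_univ_three, mul_incl]

theorem mixedDer_θ (η : ℂ) (i j : Fin 3) : mixedDer η i (θ j) = 0 := by simp [mixedDer]

/-- The graded bracket with parameter `η` that satisfies `FormsTable`. -/
def familyBracket (η : ℂ) : Bracket :=
  evenPair (liftDer vF) (liftDer vE) + evenPair (liftDer wF) (liftDer wE)
    + oddPair ((contract 0).restrictScalars ℂ) (mixedDer η 0)
    + oddPair ((contract 1).restrictScalars ℂ) (mixedDer η 1)
    + oddPair ((contract 2).restrictScalars ℂ) (mixedDer η 2)
    + oddPair ((contract 0).restrictScalars ℂ) formsDer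

theorem isSuperBracket_familyBracket (η : ℂ) : IsSuperBracket (familyBracket η) :=
  (((((isSuperBracket_evenPair (isEvenDer_liftDer _) (isEvenDer_liftDer _)).add
    (isSuperBracket_evenPair (isEvenDer_liftDer _) (isEvenDer_liftDer _))).add
    (isSuperBracket_oddPair (isOddDer_contract _) (isOddDer_mixedDer _ _))).add
    (isSuperBracket_oddPair (isOddDer_contract _) (isOddDer_mixedDer _ _))).add
    (isSuperBracket_oddPair (isOddDer_contract _) (isOddDer_mixedDer _ _))).add
    (isSuperBracket_oddPair (isOddDer_contract _) isOddDer_formsDer)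

theorem formsDer_incl (f : FunAlg) : formsDer (incl f) = 0 := by simp [formsDer]

theorem familyBracket_incl_incl (η : ℂ) (f h : FunAlg) :
    familyBracket η (incl f) (incl h) = incl (sklyanin f h) := by
  simp only [familyBracket, LinearMap.add_apply, evenPair_apply, oddPair_apply, liftDer_incl,
    LinearMap.restrictScalars_apply, contract_incl, sklyanin, map_zero, zero_mul, mul_zero,
    add_zero, ← map_mul, ← map_sub, ← map_add]
  congr 1
  ring

theorem familyBracket_θ_incl (η : ℂ) (i : Fin 3) (f : FunAlg) :
    familyBracket η (θ i) (incl f) = mixed η i f := by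
  simp only [familyBracket, LinearMap.add_apply, evenPair_apply, oddPair_apply, liftDer_θ,
    LinearMap.restrictScalars_apply, contract_incl, contract_θ, mixedDer_incl, mixedDer_θ,
    formsDer_incl]
  fin_cases i <;> simp

theorem prolongsSklyanin_familyBracket (η : ℂ) : ProlongsSklyanin (familyBracket η) := by
  constructor <;> rw [familyBracket_incl_incl]
  case ad => congr 1; simp [sklyanin]; ring
  all_goals simp [sklyanin, mul_comm]

theorem mixedFamily_familyBracket (η : ℂ) : MixedFamily η (familyBracket η) :=
  (mixedFamily_iff (isSuperBracket_familyBracket η) η).mpr (familyBracket_θ_incl η)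

/-- In `{θ⁰, θ⁰}` both halves of `oddPair` contribute, which is why `formsDer` carries `-θ¹θ²`
rather than `-2θ¹θ²`. In `{θ⁰, θ¹}` and `{θ⁰, θ²}` only one half does. -/
theorem formsTable_familyBracket (η : ℂ) : FormsTable (familyBracket η) := by
  constructor <;>
  simp [familyBracket, evenPair_apply, oddPair_apply, contract_θ, mixedDer_θ, formsDer]
  noncomm_ring

theorem FormsTable.symm {B : Bracket} (h : FormsTable B) (hB : IsSuperBracket B) :
    B (θ 1) (θ 0) = -2 * (θ 0 * θ 1) ∧ B (θ 2) (θ 0) = 2 * (θ 0 * θ 2) ∧ B (θ 2) (θ 1) = 0 := by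
  have sw (i j : Fin 3) := hB.odd_symm _ _ (parity_θ i) (parity_θ j)
  exact ⟨(sw 1 0).trans h.θ01, (sw 2 0).trans h.θ02, (sw 2 1).trans h.θ12⟩

theorem eq_familyBracket {B : Bracket} {η : ℂ} (hB : IsSuperBracket B) (hS : ProlongsSklyanin B)
    (hM : MixedFamily η B) (hF : FormsTable B) : B = familyBracket η := by
  have hB' := isSuperBracket_familyBracket η
  have hF' := formsTable_familyBracket η
  refine hB.ext_of_generators hB' ?_ ?_ ?_
  · intro f h
    rw [hS.apply_incl hB, familyBracket_incl_incl]
  · intro i f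
    rw [(mixedFamily_iff hB η).mp hM, familyBracket_θ_incl]
  · obtain ⟨h1, h2, h3⟩ := hF.symm hB
    obtain ⟨h1', h2', h3'⟩ := hF'.symm hB'
    intro i j
    fin_cases i <;> fin_cases j <;>
      simp [hF.θ00, hF.θ01, hF.θ02, hF.θ11, hF.θ12, hF.θ22, h1, h2, h3,
        hF'.θ00, hF'.θ01, hF'.θ02, hF'.θ11, hF'.θ12, hF'.θ22, h1', h2', h3']

/-! ### The Jacobi identity for functions and for one form with two functions -/

section
open IsSuperBracket
variable {B : Bracket}

theorem sklyanin_jacobi (f g h : FunAlg) :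
    sklyanin f (sklyanin g h) = sklyanin g (sklyanin f h) + sklyanin (sklyanin f g) h := by
  have rot (f g h : FunAlg)
      (e : sklyanin f (sklyanin g h) = sklyanin g (sklyanin f h) + sklyanin (sklyanin f g) h) :
      sklyanin g (sklyanin h f) = sklyanin h (sklyanin g f) + sklyanin (sklyanin g h) f := by
    have e1 (x : FunAlg) : sklyanin x (-sklyanin f h) = -sklyanin x (sklyanin f h) :=
      map_neg (hamiltonian x) _
    have e2 (x : FunAlg) : sklyanin x (-sklyanin f g) = -sklyanin x (sklyanin f g) :=
      map_neg (hamiltonian x) _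
    rw [sklyanin_symm h f, sklyanin_symm g f, sklyanin_symm (sklyanin g h) f, e1, e2,
      sklyanin_symm h, e]
    ring
  have ext (f g : FunAlg) (hg : ∀ h ∈ ({a, b, c, d} : Set FunAlg),
      sklyanin f (sklyanin g h) = sklyanin g (sklyanin f h) + sklyanin (sklyanin f g) h)
      (h : FunAlg) :
      sklyanin f (sklyanin g h) = sklyanin g (sklyanin f h) + sklyanin (sklyanin f g) h := by
    have key : ⁅hamiltonian f, hamiltonian g⁆ = hamiltonian (sklyanin f g) := by
      apply derivation_ext <;>
        simp only [Derivation.commutator_apply, hamiltonian_apply, sub_eq_iff_eq_add'] <;>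
        exact hg _ (by simp)
    have := congrArg (fun D => D h) key
    simpa only [Derivation.commutator_apply, hamiltonian_apply, sub_eq_iff_eq_add'] using this
  have gen₃ : ∀ f ∈ ({a, b, c, d} : Set FunAlg), ∀ g ∈ ({a, b, c, d} : Set FunAlg),
      ∀ h ∈ ({a, b, c, d} : Set FunAlg),
      sklyanin f (sklyanin g h) = sklyanin g (sklyanin f h) + sklyanin (sklyanin f g) h := by
    -- Sixty-four polynomial identities in `a, b, c, d`; none of them needs the determinant
    -- relation.
    rintro _ (rfl | rfl | rfl | rfl) _ (rfl | rfl | rfl | rfl) _ (rfl | rfl | rfl | rfl) <;>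
      simp [sklyanin] <;> ring
  have gen₂ : ∀ f ∈ ({a, b, c, d} : Set FunAlg), ∀ g h,
      sklyanin f (sklyanin g h) = sklyanin g (sklyanin f h) + sklyanin (sklyanin f g) h :=
    -- `ext` frees the last argument and `rot` permutes cyclically, so each slot gets its turn.
    fun f hf g => ext f g fun h hh => rot h f g (ext h f (gen₃ h hh f hf) g)
  exact ext f g (fun h hh => rot h f g (gen₂ h hh f g)) h

theorem derivation_ofNat (D : Derivation ℂ FunAlg FunAlg) (n : ℕ) [n.AtLeastTwo] :
    D ofNat(n) = 0 := by
  rw [← Nat.cast_ofNat (R := FunAlg)]; exact D.map_natCast n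

/-- The coefficient of `θˡ` in the Jacobi identity for `θⁱ`, `f`, `h`. -/
def mixedDefect (η : ℂ) (i l : Fin 3) (f h : FunAlg) : FunAlg :=
  mixedCoeff η i l (sklyanin f h) + sklyanin (mixedCoeff η i l h) f
    - sklyanin (mixedCoeff η i l f) h
    + ∑ j, (mixedCoeff η i j h * mixedCoeff η j l f - mixedCoeff η i j f * mixedCoeff η j l h)

/-- The bracket of a function with `{θⁱ, h}` differentiates both the coefficients, through the
Sklyanin bracket, and the forms, through the family again; the products of coefficients in
`mixedDefect` come from the latter. -/
theorem mixed_jacobiator (hB : IsSuperBracket B) (hS : ProlongsSklyanin B) {η : ℂ}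
    (hM : MixedFamily η B) (i : Fin 3) (f h : FunAlg) :
    jacobiator B 1 (θ i) (incl f) (incl h) = ∑ l, mixedDefect η i l f h • θ l := by
  rw [mixedFamily_iff hB] at hM
  have key (f h : FunAlg) : B (mixed η i f) (incl h) =
      ∑ j, (sklyanin (mixedCoeff η i j f) h • θ j + mixedCoeff η i j f • mixed η j h) := by
    rw [mixed, map_sum, LinearMap.sum_apply]
    refine Finset.sum_congr rfl fun j _ => ?_
    rw [hB.smul_apply_incl, hS.apply_incl hB, incl_mul, hM]
  rw [jacobiator, hS.apply_incl hB, hM, hM, hM, one_smul, key, ← neg_neg (B (incl f) _),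
    ← hB.symm_incl _ f, key]
  simp only [mixed, mixedDefect, Fin.sum_univ_three]
  module

/-- The left-invariant half of the Sklyanin bracket drops out, since `wE, wF` commute with the
coefficient fields. The rest is a computation with the commutators of `vE, vF, vH`, in which `η(η +
2)` factors out of every entry. -/
theorem mixedDefect_eq (η : ℂ) (i l : Fin 3) (f h : FunAlg) :
    mixedDefect η i l f h = (η * (η + 2)) •
      !![0, vE f * vH h - vH f * vE h, vF f * vH h - vH f * vF h;
        -2 * (vF f * vH h - vH f * vF h), 2 * (vE f * vF h - vF f * vE h), 0;
        -2 * (vE f * vH h - vH f * vE h), 0, -2 * (vE f * vF h - vF f * vE h)] i l := by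
  have hw := commute_vector_fields
  fin_cases i <;> fin_cases l <;>
    simp [mixedDefect, Fin.sum_univ_three, mixedCoeff, sklyanin, (hw _).1, (hw _).2, vE_vF, vH_vE,
      vH_vF, Algebra.smul_def, map_ofNat, derivation_ofNat] <;> ring

theorem mixedJacobi_iff (hB : IsSuperBracket B) (hS : ProlongsSklyanin B) {η : ℂ}
    (hM : MixedFamily η B) : MixedJacobi B ↔ η = 0 ∨ η = -2 := by
  have key (i : Fin 3) (f h : FunAlg) : B (B (θ i) (incl f)) (incl h)
      + B (B (incl h) (θ i)) (incl f) + B (B (incl f) (incl h)) (θ i)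
      = -∑ l, mixedDefect η i l f h • θ l := by
    rw [← mixed_jacobiator hB hS hM, jacobiator, one_smul, hB.symm_incl (B (incl h) (θ i)) f,
      hB.even_symm (incl h) (parity_incl h) (θ i), hS.apply_incl hB f h,
      hB.even_symm _ (parity_incl (sklyanin f h)) (θ i), map_neg]
    abel
  constructor
  -- For `θ¹, a, c` the coefficient of `θ¹` is `2η(η + 2) a c` up to sign, and `a c = 1` at the
  -- point `(1 0; 1 1)`.
  · intro h
    have h1 := h 1 a c
    rw [key, neg_eq_zero] at h1
    have h2 := congrArg (fun x => point (1 : ℂ) 0 1 1 (by norm_num) (coeff₁ 1 x)) h1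
    simp [mixedDefect_eq, coeff₁_θ, Fin.sum_univ_three, map_ofNat] at h2
    rcases h2 with h2 | h2
    · exact .inl h2
    · exact .inr (eq_neg_of_add_eq_zero_left h2)
  · intro h i f g
    have h0 : η * (η + 2) = 0 := by rcases h with rfl | rfl <;> norm_num
    simp [key, mixedDefect_eq, h0]

/-! ### The Jacobi identity -/

theorem θ_relations : (θ 1 * θ 0 = -(θ 0 * θ 1) ∧ θ 2 * θ 0 = -(θ 0 * θ 2) ∧
    θ 2 * θ 1 = -(θ 1 * θ 2)) ∧ ∀ i, θ i * θ i = 0 :=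
  ⟨⟨θ_mul_swap 1 0, θ_mul_swap 2 0, θ_mul_swap 2 1⟩, θ_mul_self⟩

/-- Complex scalars are moved into `𝒜` here and in the two variants below, so that all coefficients
lie in a single commutative ring when coefficients of forms are compared. -/
theorem mixed_zero_eq (η : ℂ) (f : FunAlg) : mixed η 0 f =
    (algebraMap ℂ FunAlg η * vE f) • θ 1 + (-(2 + algebraMap ℂ FunAlg η) * vF f) • θ 2 := by
  rw [mixed_zero]; simp [Algebra.smul_def, map_ofNat]

theorem mixed_one_eq (η : ℂ) (f : FunAlg) : mixed η 1 f =
    ((4 + 2 * algebraMap ℂ FunAlg η) * vF f) • θ 0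
      + (-(1 + algebraMap ℂ FunAlg η) * vH f) • θ 1 := by
  rw [mixed_one]; simp [Algebra.smul_def, map_ofNat]

theorem mixed_two_eq (η : ℂ) (f : FunAlg) : mixed η 2 f =
    (-2 * algebraMap ℂ FunAlg η * vE f) • θ 0 + ((1 + algebraMap ℂ FunAlg η) * vH f) • θ 2 := by
  rw [mixed_two]; simp [Algebra.smul_def, map_ofNat]

theorem FormsTable.smul_form (hF : FormsTable B) (hB : IsSuperBracket B) :
    (B (θ 0) (θ 0) = (-2 : FunAlg) • (θ 1 * θ 2) ∧ B (θ 0) (θ 1) = (-2 : FunAlg) • (θ 0 * θ 1) ∧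
      B (θ 0) (θ 2) = (2 : FunAlg) • (θ 0 * θ 2)) ∧
    (B (θ 1) (θ 0) = (-2 : FunAlg) • (θ 0 * θ 1) ∧ B (θ 1) (θ 1) = 0 ∧ B (θ 1) (θ 2) = 0) ∧
    (B (θ 2) (θ 0) = (2 : FunAlg) • (θ 0 * θ 2) ∧ B (θ 2) (θ 1) = 0 ∧ B (θ 2) (θ 2) = 0) := by
  have h2 (x : ExtAlg) : 2 * x = (2 : FunAlg) • x := by rw [two_mul, two_smul]
  have h2' (x : ExtAlg) : -2 * x = (-2 : FunAlg) • x := by rw [neg_mul, h2, neg_smul]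
  obtain ⟨h10, h20, h21⟩ := hF.symm hB
  simp only [← h2, ← h2']
  exact ⟨⟨hF.θ00, hF.θ01, hF.θ02⟩, ⟨h10, hF.θ11, hF.θ12⟩, h20, h21, hF.θ22⟩

/-- Here the table of `{θ, θ}` meets that of `{θ, f}`. After expansion into the monomials `θᵏθˡ`,
the coefficients are compared separately for the two admissible values of `η`. -/
theorem jacobiator_θ_θ_incl {η : ℂ} (hη : η = 0 ∨ η = -2) (i j : Fin 3) (f : FunAlg) :
    jacobiator (familyBracket η) (-1) (θ i) (θ j) (incl f) = 0 := by
  have hB := isSuperBracket_familyBracket η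
  have hM := familyBracket_θ_incl η
  obtain ⟨⟨h00, h01, h02⟩, ⟨h10, h11, h12⟩, h20, h21, h22⟩ :=
    (formsTable_familyBracket η).smul_form hB
  obtain ⟨⟨r10, r20, r21⟩, r⟩ := θ_relations
  have he : algebraMap ℂ FunAlg η = 0 ∨ algebraMap ℂ FunAlg η = -2 := by
    rcases hη with rfl | rfl
    · exact .inl (map_zero _)
    · exact .inr (by rw [map_neg, map_ofNat])
  rw [jacobiator, hM, hM]
  fin_cases i <;> fin_cases j <;>
    simp only [Fin.zero_eta, Fin.mk_one, Fin.reduceFinMk, mixed_zero_eq, mixed_one_eq,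
      mixed_two_eq, map_add, hB.apply_smul, hB.smul_apply_incl, hB.mul_apply_incl, hM, h00, h01,
      h02, h10, h11, h12, h20, h21, h22, map_zero, LinearMap.zero_apply, add_mul, mul_add,
      smul_mul_assoc, mul_smul_comm, r10, r20, r21, r, smul_add, smul_neg, smul_zero] <;>
    simp [vE_vF, vH_vE, vH_vF, derivation_ofNat, familyBracket_incl_incl, sklyanin] <;>
    match_scalars <;> rcases he with he | he <;> rw [he] <;> ring

/-- The brackets of forms have constant coefficients, so the computation stays inside the exterior
algebra and never involves `{θ, f}`. -/
theorem jacobiator_θ_θ_θ (hB : IsSuperBracket B) (hF : FormsTable B) (i j k : Fin 3) :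
    jacobiator B (-1) (θ i) (θ j) (θ k) = 0 := by
  obtain ⟨⟨h00, h01, h02⟩, ⟨h10, h11, h12⟩, h20, h21, h22⟩ := hF.smul_form hB
  obtain ⟨⟨r10, r20, r21⟩, r⟩ := θ_relations
  have hp (i j : Fin 3) : parity (θ i * θ j) = θ i * θ j := by simp
  have hl (i j k : Fin 3) : B (θ i) (θ j * θ k) = B (θ i) (θ j) * θ k - θ j * B (θ i) (θ k) := by
    rw [hB.odd_leibniz _ (parity_θ i), parity_θ, neg_mul, sub_eq_add_neg]
  have hr (i j k : Fin 3) : B (θ i * θ j) (θ k) = -B (θ k) (θ i * θ j) :=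
    hB.even_symm _ (hp i j) _
  -- Constants bracket to zero with everything, so the factors `2` and `-2` pass through `B`.
  have hn (i : Fin 3) (n : FunAlg) (hn : ∀ y, B y (incl n) = 0) (x : ExtAlg) :
      B (θ i) (n • x) = n • B (θ i) x := by rw [hB.apply_smul, hn, zero_mul, zero_add]
  have z2 (y : ExtAlg) : B y (incl 2) = 0 := by
    rw [← map_ofNat (algebraMap ℂ FunAlg) 2, hB.apply_algebraMap]
  have z2' (y : ExtAlg) : B y (incl (-2)) = 0 := by rw [map_neg, map_neg, z2, neg_zero]
  have hm (n : FunAlg) (hn : ∀ y, B y (incl n) = 0) (x y : ExtAlg) (hx : parity x = x) :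
      B (n • x) y = n • B x y := by
    rw [hB.even_symm (n • x) (by rw [parity_smul, hx]), hB.apply_smul, hn, zero_mul, zero_add,
      hB.even_symm x hx, smul_neg]
  rw [jacobiator]
  fin_cases i <;> fin_cases j <;> fin_cases k <;>
    simp only [Fin.zero_eta, Fin.mk_one, Fin.reduceFinMk, h00, h01, h02, h10, h11, h12, h20, h21,
      h22, hn _ _ z2, hn _ _ z2', hm _ z2 _ _ (hp _ _), hm _ z2' _ _ (hp _ _), hl, hr, map_zero,
      LinearMap.zero_apply, smul_mul_assoc, mul_smul_comm, mul_assoc, zero_mul, mul_zero] <;>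
    simp [← mul_assoc, r10, r21, r]

theorem isGradedPoisson_familyBracket {η : ℂ} (hη : η = 0 ∨ η = -2) :
    IsGradedPoisson (familyBracket η) := by
  have hB := isSuperBracket_familyBracket η
  have hS := prolongsSklyanin_familyBracket η
  have h0 : η * (η + 2) = 0 := by rcases hη with rfl | rfl <;> norm_num
  refine hB.isGradedPoisson_of_generators (fun f g h => ?_) (fun i f g => ?_)
    (jacobiator_θ_θ_incl hη) (jacobiator_θ_θ_θ hB (formsTable_familyBracket η))
  · simp only [jacobiator, familyBracket_incl_incl, one_smul, sklyanin_jacobi f g h, map_add]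
    abel
  · rw [mixed_jacobiator hB hS (mixedFamily_familyBracket η)]
    simp [mixedDefect_eq, h0]

end

section
variable {B : Bracket}

/-! ### The bracket on the tensor square -/

theorem degProj_zero_incl (f : FunAlg) : degProj 0 (incl f) = incl f := by
  simp [degProj, ← add_smul]
  norm_num

theorem degProj_one_incl (f : FunAlg) : degProj 1 (incl f) = 0 := by
  simp [degProj]

theorem degProj_add (x : ExtAlg) : degProj 0 x + degProj 1 x = x := by
  simp only [degProj, koszul_zero_left, koszul_one_one, LinearMap.smul_apply, LinearMap.add_apply,
    LinearMap.id_apply, AlgHom.toLinearMap_apply, one_smul, neg_smul, ← smul_add]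
  rw [show x + parity x + (x + -parity x) = (2 : ℂ) • x by rw [two_smul]; abel, smul_smul]
  norm_num

theorem sum_zmod_two {M : Type*} [AddCommMonoid M] (g : ZMod 2 → M) : ∑ p, g p = g 0 + g 1 :=
  Fin.sum_univ_two g

/-- The sign depends on the two inner tensor factors and is trivial as soon as one of them is a
function; the homogeneous parts of the other then recombine. -/
theorem tensorBracket_incl_left (B : Bracket) (x y : ExtAlg) (h : FunAlg) (z : ExtAlg) :
    tensorBracket B (x ⊗ₜ y) (incl h ⊗ₜ z) =
      B x (incl h) ⊗ₜ (y * z) + (x * incl h) ⊗ₜ B y z := by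
  conv_rhs => rw [← degProj_add y]
  simp only [tensorBracket, sum_zmod_two, LinearMap.add_apply, LinearMap.smul_apply,
    TensorProduct.map₂_apply_tmul, TensorProduct.map_tmul, LinearMap.compl₂_apply, LinearMap.comp_apply,
    LinearMap.mul_apply', degProj_zero_incl, degProj_one_incl, koszul_zero_left,
    koszul_zero_right, one_smul, map_zero, TensorProduct.zero_tmul, smul_zero, add_zero,
    map_add, add_mul, TensorProduct.tmul_add]
  abel

theorem tensorBracket_incl_right (B : Bracket) (x : ExtAlg) (f : FunAlg) (y z : ExtAlg) :
    tensorBracket B (x ⊗ₜ incl f) (y ⊗ₜ z) =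
      B x y ⊗ₜ (incl f * z) + (x * y) ⊗ₜ B (incl f) z := by
  conv_rhs => rw [← degProj_add y]
  simp only [tensorBracket, sum_zmod_two, LinearMap.add_apply, LinearMap.smul_apply,
    TensorProduct.map₂_apply_tmul, TensorProduct.map_tmul, LinearMap.compl₂_apply, LinearMap.comp_apply,
    LinearMap.mul_apply', degProj_zero_incl, degProj_one_incl, koszul_zero_left,
    koszul_zero_right, one_smul, map_zero, TensorProduct.tmul_zero, smul_zero,
    add_zero, map_add, mul_add, TensorProduct.add_tmul, LinearMap.zero_apply]
  abel

/-- The Sklyanin bracket as a bilinear map. -/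
def sklyaninBilin : FunAlg →ₗ[ℂ] FunAlg →ₗ[ℂ] FunAlg :=
  LinearMap.mk₂ ℂ sklyanin
    (fun f g h => by simp only [sklyanin, map_add]; ring)
    (fun r f h => by simp only [sklyanin, Derivation.map_smul]; simp only [Algebra.smul_def]; ring)
    (fun f g h => by simp only [sklyanin, map_add]; ring)
    (fun r f h => by simp only [sklyanin, Derivation.map_smul]; simp only [Algebra.smul_def]; ring)

/-- The bracket of `ℳ ⊗ ℳ` restricted to `𝒜 ⊗ ℳ`. -/
def bracketL (B : Bracket) :
    FunAlg ⊗[ℂ] ExtAlg →ₗ[ℂ] FunAlg ⊗[ℂ] ExtAlg →ₗ[ℂ] FunAlg ⊗[ℂ] ExtAlg :=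
  TensorProduct.map₂ sklyaninBilin (LinearMap.mul ℂ ExtAlg)
    + TensorProduct.map₂ (LinearMap.mul ℂ FunAlg) B

theorem bracketL_tmul (B : Bracket) (f h : FunAlg) (x y : ExtAlg) :
    bracketL B (f ⊗ₜ x) (h ⊗ₜ y) = sklyanin f h ⊗ₜ (x * y) + (f * h) ⊗ₜ B x y := rfl

/-- The inclusion `𝒜 ⊗ ℳ ⊆ ℳ ⊗ ℳ`. -/
def inclL : FunAlg ⊗[ℂ] ExtAlg →ₗ[ℂ] ExtAlg ⊗[ℂ] ExtAlg :=
  TensorProduct.map incl.toLinearMap LinearMap.id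

theorem inclL_tmul (f : FunAlg) (x : ExtAlg) : inclL (f ⊗ₜ x) = incl f ⊗ₜ x := rfl

/-- Projection to forms of degree zero retracts `ℳ` onto `𝒜`, so identities in `ℳ ⊗ ℳ` can be pulled
back to `𝒜 ⊗ ℳ`. -/
theorem inclL_injective : Function.Injective inclL := by
  refine Function.LeftInverse.injective
    (g := TensorProduct.map (aug.restrictScalars ℂ) LinearMap.id) fun u => ?_
  induction u using TensorProduct.induction_on with
  | zero => simp
  | tmul f x => simp [inclL_tmul]
  | add u v hu hv => rw [map_add, map_add, hu, hv]

theorem tensorBracket_inclL (hB : IsSuperBracket B) (hS : ProlongsSklyanin B)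
    (u v : FunAlg ⊗[ℂ] ExtAlg) :
    tensorBracket B (inclL u) (inclL v) = inclL (bracketL B u v) := by
  induction u using TensorProduct.induction_on with
  | zero => simp
  | add u w hu hw => simp only [map_add, LinearMap.add_apply, hu, hw]
  | tmul f x =>
    induction v using TensorProduct.induction_on with
    | zero => simp
    | add v w hv hw => simp only [map_add, hv, hw]
    | tmul h y =>
      rw [inclL_tmul, inclL_tmul, tensorBracket_incl_left, hS.apply_incl hB, bracketL_tmul,
        map_add, inclL_tmul, inclL_tmul, map_mul]

theorem ΔL_apply (x : ExtAlg) : ΔL x = inclL (comulL x) := rfl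

/-- The inclusion `𝒜 ⊗ 𝒜 ⊆ 𝒜 ⊗ ℳ`. -/
def inclAL : FunAlg ⊗[ℂ] FunAlg →ₐ[ℂ] FunAlg ⊗[ℂ] ExtAlg :=
  Algebra.TensorProduct.map (AlgHom.id ℂ FunAlg) incl

/-- The inclusion `𝒜 ⊗ 𝒜 ⊆ ℳ ⊗ 𝒜`. -/
def inclAR : FunAlg ⊗[ℂ] FunAlg →ₐ[ℂ] ExtAlg ⊗[ℂ] FunAlg :=
  Algebra.TensorProduct.map incl (AlgHom.id ℂ FunAlg)

theorem inclAL_tmul (f h : FunAlg) : inclAL (f ⊗ₜ h) = f ⊗ₜ incl h := rfl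

theorem inclAR_tmul (f h : FunAlg) : inclAR (f ⊗ₜ h) = incl f ⊗ₜ h := rfl

theorem ΔA_apply (f : FunAlg) : ΔA f = inclL (inclAL (comul f)) := by
  change TensorProduct.map incl.toLinearMap incl.toLinearMap (comul f) = _
  induction comul f using TensorProduct.induction_on with
  | zero => simp
  | tmul g h => rfl
  | add u v hu hv => rw [map_add, map_add, map_add, hu, hv]

theorem comulL_incl (f : FunAlg) : comulL (incl f) = inclAL (comul f) := by
  rw [comulL, incl_apply, Algebra.TensorProduct.lift_tmul, map_one, mul_one]; rfl

theorem liftForms_ι {X : Type*} [Ring X] [Algebra ℂ X] (x : Fin 3 → X)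
    (h : ∀ i j, x i * x j = -(x j * x i)) (i : Fin 3) :
    liftForms x h (ExteriorAlgebra.ι ℂ (Pi.single i 1)) = x i := by
  simp [liftForms]

theorem comulL_θ (i : Fin 3) : comulL (θ i) = comulLθ i := by
  rw [comulL, θ, Algebra.TensorProduct.lift_tmul, map_one, one_mul, liftForms_ι]

theorem comulL_smul (f : FunAlg) (x : ExtAlg) : comulL (f • x) = inclAL (comul f) * comulL x := by
  rw [← incl_mul, map_mul, comulL_incl]

theorem comulR_incl (f : FunAlg) : comulR (incl f) = inclAR (comul f) := by
  rw [comulR, incl_apply, Algebra.TensorProduct.lift_tmul, map_one, mul_one]; rfl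

theorem comulR_θ (i : Fin 3) : comulR (θ i) = θ i ⊗ₜ 1 := by
  rw [comulR, θ, Algebra.TensorProduct.lift_tmul, map_one, one_mul, liftForms_ι]; rfl

theorem comulR_smul (f : FunAlg) (x : ExtAlg) : comulR (f • x) = inclAR (comul f) * comulR x := by
  rw [← incl_mul, map_mul, comulR_incl]

/-! ### Comultiplication and vector fields -/

theorem comul_T (i j : Fin 2) : comul (T i j) = comulT i j := by
  rw [← quot_X (i, j)]
  exact MvPolynomial.aeval_X _ _

theorem comul_a : comul a = a ⊗ₜ a + b ⊗ₜ c := by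
  refine (comul_T 0 0).trans ?_
  simp [comulT, Matrix.mul_apply, a, b, c]

theorem comul_b : comul b = a ⊗ₜ b + b ⊗ₜ d := by
  refine (comul_T 0 1).trans ?_
  simp [comulT, Matrix.mul_apply, a, b, d]

theorem comul_c : comul c = c ⊗ₜ a + d ⊗ₜ c := by
  refine (comul_T 1 0).trans ?_
  simp [comulT, Matrix.mul_apply, a, d, c]

theorem comul_d : comul d = c ⊗ₜ b + d ⊗ₜ d := by
  refine (comul_T 1 1).trans ?_
  simp [comulT, Matrix.mul_apply, b, d, c]

/-- A derivation acting on the left factor of `𝒜 ⊗ 𝒜`. -/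
def derLeft (D : Derivation ℂ FunAlg FunAlg) : FunAlg ⊗[ℂ] FunAlg →ₗ[ℂ] FunAlg ⊗[ℂ] FunAlg :=
  D.toLinearMap.rTensor FunAlg

/-- A derivation acting on the right factor of `𝒜 ⊗ 𝒜`. -/
def derRight (D : Derivation ℂ FunAlg FunAlg) : FunAlg ⊗[ℂ] FunAlg →ₗ[ℂ] FunAlg ⊗[ℂ] FunAlg :=
  D.toLinearMap.lTensor FunAlg

theorem derLeft_tmul (D : Derivation ℂ FunAlg FunAlg) (f h : FunAlg) :
    derLeft D (f ⊗ₜ h) = D f ⊗ₜ h := rfl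

theorem derRight_tmul (D : Derivation ℂ FunAlg FunAlg) (f h : FunAlg) :
    derRight D (f ⊗ₜ h) = f ⊗ₜ D h := rfl

theorem derLeft_mul (D : Derivation ℂ FunAlg FunAlg) (u v : FunAlg ⊗[ℂ] FunAlg) :
    derLeft D (u * v) = derLeft D u * v + u * derLeft D v := by
  induction u using TensorProduct.induction_on with
  | zero => simp
  | add u w hu hw => rw [add_mul, map_add, hu, hw, map_add]; ring
  | tmul f h =>
    induction v using TensorProduct.induction_on with
    | zero => simp
    | add v w hv hw => rw [mul_add, map_add, hv, hw, map_add]; ring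
    | tmul f' h' =>
      simp only [Algebra.TensorProduct.tmul_mul_tmul, derLeft_tmul, Derivation.leibniz,
        smul_eq_mul, TensorProduct.add_tmul, mul_comm f' (D f), add_comm]

theorem derRight_mul (D : Derivation ℂ FunAlg FunAlg) (u v : FunAlg ⊗[ℂ] FunAlg) :
    derRight D (u * v) = derRight D u * v + u * derRight D v := by
  induction u using TensorProduct.induction_on with
  | zero => simp
  | add u w hu hw => rw [add_mul, map_add, hu, hw, map_add]; ring
  | tmul f h =>
    induction v using TensorProduct.induction_on with
    | zero => simp
    | add v w hv hw => rw [mul_add, map_add, hv, hw, map_add]; ring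
    | tmul f' h' =>
      simp only [Algebra.TensorProduct.tmul_mul_tmul, derRight_tmul, Derivation.leibniz,
        smul_eq_mul, TensorProduct.tmul_add, mul_comm h' (D h), add_comm]

/-- Derivations along `comul` are determined by the matrix entries; this is the common source of all
the intertwining relations between vector fields and `comul`. -/
theorem eq_of_leibniz_comul {P P' : FunAlg →ₗ[ℂ] FunAlg ⊗[ℂ] FunAlg}
    (hP : ∀ f h, P (f * h) = P f * comul h + comul f * P h)
    (hP' : ∀ f h, P' (f * h) = P' f * comul h + comul f * P' h)
    (ha : P a = P' a) (hb : P b = P' b) (hc : P c = P' c) (hd : P d = P' d) (f : FunAlg) :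
    P f = P' f := by
  have one {P : FunAlg →ₗ[ℂ] FunAlg ⊗[ℂ] FunAlg}
      (hP : ∀ f h, P (f * h) = P f * comul h + comul f * P h) : P 1 = 0 := by
    have h := hP 1 1
    rw [map_one comul, mul_one, mul_one, one_mul] at h
    simpa using h
  induction f using FunAlg.induction with
  | scalar r => rw [Algebra.algebraMap_eq_smul_one, map_smul, map_smul, one hP, one hP']
  | ha => exact ha
  | hb => exact hb
  | hc => exact hc
  | hd => exact hd
  | add f h hf hh => rw [map_add, map_add, hf, hh]
  | mul f h hf hh => rw [hP, hP', hf, hh]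

theorem comul_derivation_eq {D D' : Derivation ℂ FunAlg FunAlg}
    (ha : comul (D a) = derLeft D' (comul a)) (hb : comul (D b) = derLeft D' (comul b))
    (hc : comul (D c) = derLeft D' (comul c)) (hd : comul (D d) = derLeft D' (comul d))
    (f : FunAlg) : comul (D f) = derLeft D' (comul f) := by
  refine eq_of_leibniz_comul (P := comul.toLinearMap ∘ₗ D.toLinearMap)
    (P' := derLeft D' ∘ₗ comul.toLinearMap) (fun f h => ?_) (fun f h => ?_) ha hb hc hd f
  · simp; ring
  · simp [derLeft_mul]

theorem comul_derivation_eq' {D D' : Derivation ℂ FunAlg FunAlg}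
    (ha : comul (D a) = derRight D' (comul a)) (hb : comul (D b) = derRight D' (comul b))
    (hc : comul (D c) = derRight D' (comul c)) (hd : comul (D d) = derRight D' (comul d))
    (f : FunAlg) : comul (D f) = derRight D' (comul f) := by
  refine eq_of_leibniz_comul (P := comul.toLinearMap ∘ₗ D.toLinearMap)
    (P' := derRight D' ∘ₗ comul.toLinearMap) (fun f h => ?_) (fun f h => ?_) ha hb hc hd f
  · simp; ring
  · simp [derRight_mul]

theorem derRight_eq_derLeft {D D' : Derivation ℂ FunAlg FunAlg}
    (ha : derRight D (comul a) = derLeft D' (comul a))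
    (hb : derRight D (comul b) = derLeft D' (comul b))
    (hc : derRight D (comul c) = derLeft D' (comul c))
    (hd : derRight D (comul d) = derLeft D' (comul d))
    (f : FunAlg) : derRight D (comul f) = derLeft D' (comul f) := by
  refine eq_of_leibniz_comul (P := derRight D ∘ₗ comul.toLinearMap)
    (P' := derLeft D' ∘ₗ comul.toLinearMap) (fun f h => ?_) (fun f h => ?_) ha hb hc hd f
  · simp [derRight_mul]
  · simp [derLeft_mul]

theorem comul_vE (f : FunAlg) : comul (vE f) = derLeft vE (comul f) := by
  apply comul_derivation_eq <;> simp [comul_a, comul_b, comul_c, comul_d, derLeft_tmul]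

theorem comul_vF (f : FunAlg) : comul (vF f) = derLeft vF (comul f) := by
  apply comul_derivation_eq <;> simp [comul_a, comul_b, comul_c, comul_d, derLeft_tmul]

theorem comul_vH (f : FunAlg) : comul (vH f) = derLeft vH (comul f) := by
  apply comul_derivation_eq <;>
    simp [comul_a, comul_b, comul_c, comul_d, derLeft_tmul, TensorProduct.neg_tmul, add_comm]

theorem comul_wE (f : FunAlg) : comul (wE f) = derRight wE (comul f) := by
  apply comul_derivation_eq' <;> simp [comul_a, comul_b, comul_c, comul_d, derRight_tmul]

theorem comul_wF (f : FunAlg) : comul (wF f) = derRight wF (comul f) := by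
  apply comul_derivation_eq' <;> simp [comul_a, comul_b, comul_c, comul_d, derRight_tmul]

/-- In `f(gh)` an infinitesimal left translation of `h` is the same as a right translation of `g`.
The letters change because `vE` is `T ↦ E T` and `wF` is `T ↦ T E` for the same matrix unit `E`. -/
theorem derRight_vE (f : FunAlg) : derRight vE (comul f) = derLeft wF (comul f) := by
  apply derRight_eq_derLeft <;>
    simp [comul_a, comul_b, comul_c, comul_d, derLeft_tmul, derRight_tmul]

theorem derRight_vF (f : FunAlg) : derRight vF (comul f) = derLeft wE (comul f) := by
  apply derRight_eq_derLeft <;>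
    simp [comul_a, comul_b, comul_c, comul_d, derLeft_tmul, derRight_tmul]

theorem derRight_vH (f : FunAlg) : derRight vH (comul f) = derLeft wH (comul f) := by
  apply derRight_eq_derLeft <;>
    simp [comul_a, comul_b, comul_c, comul_d, derLeft_tmul, derRight_tmul, TensorProduct.neg_tmul,
      TensorProduct.tmul_neg]

/-! ### Covariance of the Sklyanin bracket -/

theorem bracketL_inclAL (hB : IsSuperBracket B) (hS : ProlongsSklyanin B)
    (u v : FunAlg ⊗[ℂ] FunAlg) : bracketL B (inclAL u) (inclAL v) =
      inclAL (-(derLeft vE u * derLeft vF v - derLeft vF u * derLeft vE v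
          + (derLeft wE u * derLeft wF v - derLeft wF u * derLeft wE v))
        - (derRight vE u * derRight vF v - derRight vF u * derRight vE v
          + (derRight wE u * derRight wF v - derRight wF u * derRight wE v))) := by
  induction u using TensorProduct.induction_on with
  | zero => simp
  | add u w hu hw =>
    rw [map_add, map_add, LinearMap.add_apply, hu, hw, ← map_add]
    congr 1
    simp only [map_add]
    ring
  | tmul f x =>
    induction v using TensorProduct.induction_on with
    | zero => simp
    | add v w hv hw =>
      rw [map_add, map_add, hv, hw, ← map_add]
      congr 1
      simp only [map_add]
      ring
    | tmul h y =>
      rw [inclAL_tmul, inclAL_tmul, bracketL_tmul, hS.apply_incl hB, ← map_mul, ← inclAL_tmul,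
        ← inclAL_tmul, ← map_add]
      congr 1
      simp only [derLeft_tmul, derRight_tmul, Algebra.TensorProduct.tmul_mul_tmul, sklyanin,
        TensorProduct.neg_tmul, TensorProduct.tmul_neg, TensorProduct.add_tmul,
        TensorProduct.tmul_add, TensorProduct.sub_tmul, TensorProduct.tmul_sub]
      ring

theorem ΔR_incl (f : FunAlg) : ΔR (incl f) = ΔA f := by
  change TensorProduct.map LinearMap.id incl.toLinearMap (comulR (incl f)) =
    TensorProduct.map incl.toLinearMap incl.toLinearMap (comul f)
  rw [comulR_incl]
  induction comul f using TensorProduct.induction_on with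
  | zero => simp
  | tmul g h => rfl
  | add u v hu hv => rw [map_add, map_add, map_add, hu, hv]

theorem funCovariant (hB : IsSuperBracket B) (hS : ProlongsSklyanin B) : FunCovariant B := by
  intro f h
  have key : ΔA (sklyanin f h) = tensorBracket B (ΔA f) (ΔA h) := by
    rw [ΔA_apply, ΔA_apply, ΔA_apply, tensorBracket_inclL hB hS, bracketL_inclAL hB hS]
    congr 2
    -- The terms `wE ∧ wF` on the left factor and `vE ∧ vF` on the right factor become opposite to
    -- each other and cancel; the other two make up `Δ{f, h}`.
    simp only [sklyanin, map_neg, map_add, map_sub, map_mul, comul_vE, comul_vF, comul_wE,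
      comul_wF, derRight_vE, derRight_vF]
    ring
  rw [hS.apply_incl hB, ΔR_incl, ΔL_apply, comulL_incl, ← ΔA_apply]
  exact ⟨key, key⟩

end

section
variable {B : Bracket}

/-! ### Covariance of the one-parameter family -/

/-- With every entry homogeneous of degree two, the identities involving `adMat` become polynomial
ones that `ring` proves without the determinant relation. -/
theorem adMat_eq : adMat = !![a * d + b * c, -(a * c), b * d;
     -(2 * a * b), a ^ 2, -(b ^ 2);
     2 * c * d, -(c ^ 2), d ^ 2] := by
  have h : 1 + 2 * b * c = a * d + b * c := by linear_combination -det_relation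
  rw [adMat, h]

/-- The left-invariant counterpart of `mixedCoeff`. -/
def mixedCoeffLeft (η : ℂ) : Matrix (Fin 3) (Fin 3) (Derivation ℂ FunAlg FunAlg) :=
  !![0, η • wF, -(2 + η) • wE;
     (4 + 2 * η) • wE, -(1 + η) • wH, 0;
     (-2 * η) • wF, 0, (1 + η) • wH]

theorem derLeft_apply_smul (r : ℂ) (D : Derivation ℂ FunAlg FunAlg) (u : FunAlg ⊗[ℂ] FunAlg) :
    derLeft (r • D) u = r • derLeft D u := by
  change LinearMap.rTensor FunAlg (r • D.toLinearMap) u = _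
  rw [LinearMap.rTensor_smul]; rfl

theorem derRight_apply_smul (r : ℂ) (D : Derivation ℂ FunAlg FunAlg) (u : FunAlg ⊗[ℂ] FunAlg) :
    derRight (r • D) u = r • derRight D u := by
  change LinearMap.lTensor FunAlg (r • D.toLinearMap) u = _
  rw [LinearMap.lTensor_smul]; rfl

theorem derLeft_zero (u : FunAlg ⊗[ℂ] FunAlg) : derLeft 0 u = 0 := by
  change LinearMap.rTensor FunAlg (0 : FunAlg →ₗ[ℂ] FunAlg) u = _
  rw [LinearMap.rTensor_zero]; rfl

theorem derRight_zero (u : FunAlg ⊗[ℂ] FunAlg) : derRight 0 u = 0 := by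
  change LinearMap.lTensor FunAlg (0 : FunAlg →ₗ[ℂ] FunAlg) u = _
  rw [LinearMap.lTensor_zero]; rfl

theorem derLeft_add (D D' : Derivation ℂ FunAlg FunAlg) (u : FunAlg ⊗[ℂ] FunAlg) :
    derLeft (D + D') u = derLeft D u + derLeft D' u := by
  change LinearMap.rTensor FunAlg (D.toLinearMap + D'.toLinearMap) u = _
  rw [LinearMap.rTensor_add]; rfl

theorem derLeft_smul (f : FunAlg) (D : Derivation ℂ FunAlg FunAlg) (u : FunAlg ⊗[ℂ] FunAlg) :
    derLeft (f • D) u = f ⊗ₜ 1 * derLeft D u := by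
  induction u using TensorProduct.induction_on with
  | zero => simp
  | tmul g h => simp [derLeft_tmul]
  | add u v hu hv => rw [map_add, hu, hv, map_add, mul_add]

theorem comul_mixedCoeff (η : ℂ) (i j : Fin 3) (f : FunAlg) :
    comul (mixedCoeff η i j f) = derLeft (mixedCoeff η i j) (comul f) := by
  fin_cases i <;> fin_cases j <;>
    simp [mixedCoeff, derLeft_apply_smul, derLeft_zero, comul_vE, comul_vF, comul_vH,
      -neg_add_rev, -neg_smul]

theorem derRight_mixedCoeff (η : ℂ) (i j : Fin 3) (f : FunAlg) :
    derRight (mixedCoeff η i j) (comul f) = derLeft (mixedCoeffLeft η i j) (comul f) := by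
  fin_cases i <;> fin_cases j <;>
    simp [mixedCoeff, mixedCoeffLeft, derLeft_apply_smul, derRight_apply_smul, derLeft_zero,
      derRight_zero, derRight_vE, derRight_vF, derRight_vH, -neg_add_rev, -neg_smul]

-- Left covariance of the family in infinitesimal form: both sides are derivations of `𝒜`, so it
-- reduces to the four matrix entries. The Hamiltonian term measures how far `mixedCoeff` is from
-- being equivariant under the adjoint action.
set_option maxHeartbeats 2000000 in
theorem mixed_equivariance (η : ℂ) (i l : Fin 3) :
    ∑ j, adMat j l • mixedCoeff η i j =
      hamiltonian (adMat i l) + ∑ j, adMat i j • mixedCoeffLeft η j l := by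
  rw [adMat_eq]
  fin_cases i <;> fin_cases l <;> apply derivation_ext <;>
    simp only [Fin.sum_univ_three, mixedCoeff, mixedCoeffLeft, hamiltonian, Fin.zero_eta, Fin.mk_one,
      Fin.reduceFinMk, Matrix.of_apply, Matrix.cons_val, Matrix.cons_val_zero, Matrix.cons_val_one,
      Matrix.cons_val', Matrix.cons_val_fin_one, smul_zero,
      zero_add, add_zero, Derivation.add_apply, Derivation.sub_apply, Derivation.neg_apply,
      Derivation.smul_apply, Derivation.leibniz, pow_two, derivation_ofNat, mul_zero,
      vE_a, vE_b, vE_c, vE_d, vF_a, vF_b, vF_c, vF_d, vH_a, vH_b, vH_c, vH_d, wE_a, wE_b, wE_c,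
      wE_d, wF_a, wF_b, wF_c, wF_d, wH_a, wH_b, wH_c, wH_d, smul_eq_mul, Algebra.smul_def, map_neg,
      map_add, map_mul, map_one, map_ofNat] <;> ring

theorem bracketL_comulLθ (i : Fin 3) (u : FunAlg ⊗[ℂ] FunAlg) {L : Fin 3 → FunAlg →ₗ[ℂ] ExtAlg}
    (hL : ∀ i f, B (θ i) (incl f) = L i f) : bracketL B (comulLθ i) (inclAL u) =
      ∑ j, (inclAL (derLeft (hamiltonian (adMat i j)) u) * (1 ⊗ₜ θ j)
        + (adMat i j ⊗ₜ 1) * (L j).lTensor FunAlg u) := by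
  rw [comulLθ, map_sum, LinearMap.sum_apply]
  refine Finset.sum_congr rfl fun j _ => ?_
  induction u using TensorProduct.induction_on with
  | zero => simp
  | add u v hu hv => simp only [map_add, hu, hv, add_mul, mul_add]; abel
  | tmul f h =>
    rw [inclAL_tmul, bracketL_tmul, derLeft_tmul, hamiltonian_apply, inclAL_tmul,
      Algebra.TensorProduct.tmul_mul_tmul, mul_one, incl_mul, mul_incl, LinearMap.lTensor_tmul,
      Algebra.TensorProduct.tmul_mul_tmul, one_mul, hL]

/-- The derivation `mixed η i` as a linear map. -/
def mixedHom (η : ℂ) (i : Fin 3) : FunAlg →ₗ[ℂ] ExtAlg :=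
  ∑ j, (LinearMap.toSpanSingleton FunAlg ExtAlg (θ j)).restrictScalars ℂ ∘ₗ
    (mixedCoeff η i j).toLinearMap

theorem mixedHom_apply (η : ℂ) (i : Fin 3) (f : FunAlg) : mixedHom η i f = mixed η i f := by
  simp [mixedHom, mixed, LinearMap.sum_apply]

theorem mixedHom_lTensor (η : ℂ) (i : Fin 3) (u : FunAlg ⊗[ℂ] FunAlg) :
    (mixedHom η i).lTensor FunAlg u = ∑ j, inclAL (derRight (mixedCoeff η i j) u) * (1 ⊗ₜ θ j) := by
  induction u using TensorProduct.induction_on with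
  | zero => simp
  | add u v hu hv => simp only [map_add, hu, hv, add_mul, Finset.sum_add_distrib]
  | tmul f h =>
    simp only [LinearMap.lTensor_tmul, mixedHom_apply, mixed, TensorProduct.tmul_sum, derRight_tmul,
      inclAL_tmul, Algebra.TensorProduct.tmul_mul_tmul, mul_one, incl_mul]

theorem comulL_mixed (η : ℂ) (i : Fin 3) (f : FunAlg) : comulL (mixed η i f) =
    ∑ l, inclAL (derLeft (∑ j, adMat j l • mixedCoeff η i j) (comul f)) * (1 ⊗ₜ θ l) := by
  have h (j l : Fin 3) : (adMat j l ⊗ₜ θ l : FunAlg ⊗[ℂ] ExtAlg) =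
      inclAL (adMat j l ⊗ₜ 1) * (1 ⊗ₜ θ l) := by
    rw [inclAL_tmul, map_one, Algebra.TensorProduct.tmul_mul_tmul, mul_one, one_mul]
  simp only [mixed, map_sum, comulL_smul, comulL_θ, comulLθ, Finset.mul_sum, h, ← mul_assoc,
    ← map_mul, comul_mixedCoeff]
  rw [Finset.sum_comm]
  refine Finset.sum_congr rfl fun l _ => ?_
  simp only [Fin.sum_univ_three, derLeft_add, derLeft_smul, map_add, add_mul, mul_comm]

theorem comulR_mixed (η : ℂ) (i : Fin 3) (f : FunAlg) : comulR (mixed η i f) =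
    (mixedHom η i).rTensor FunAlg (comul f) := by
  have key (u : FunAlg ⊗[ℂ] FunAlg) : (mixedHom η i).rTensor FunAlg u =
      ∑ j, inclAR (derLeft (mixedCoeff η i j) u) * (θ j ⊗ₜ 1) := by
    induction u using TensorProduct.induction_on with
    | zero => simp
    | add u v hu hv => simp only [map_add, hu, hv, add_mul, Finset.sum_add_distrib]
    | tmul f h =>
      simp only [LinearMap.rTensor_tmul, mixedHom_apply, mixed, TensorProduct.sum_tmul,
        derLeft_tmul, inclAR_tmul, Algebra.TensorProduct.tmul_mul_tmul, mul_one, incl_mul]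
  rw [key, mixed, map_sum]
  simp only [comulR_smul, comulR_θ, comul_mixedCoeff]

theorem ΔL_θ (i : Fin 3) : ΔL (θ i) = inclL (comulLθ i) := by rw [ΔL_apply, comulL_θ]

theorem ΔR_apply (x : ExtAlg) :
    ΔR x = TensorProduct.map LinearMap.id incl.toLinearMap (comulR x) := rfl

theorem ΔR_θ (i : Fin 3) : ΔR (θ i) = θ i ⊗ₜ incl 1 := by
  rw [ΔR_apply, comulR_θ, TensorProduct.map_tmul]; rfl

theorem tensorBracket_ΔR_θ (hB : IsSuperBracket B) (i : Fin 3) (f : FunAlg) :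
    tensorBracket B (ΔR (θ i)) (ΔA f) = TensorProduct.map LinearMap.id incl.toLinearMap
      ((B (θ i) ∘ₗ incl.toLinearMap).rTensor FunAlg (comul f)) := by
  change tensorBracket B (ΔR (θ i))
    (TensorProduct.map incl.toLinearMap incl.toLinearMap (comul f)) = _
  rw [ΔR_θ]
  induction comul f using TensorProduct.induction_on with
  | zero => simp
  | add u v hu hv => simp only [map_add, hu, hv]
  | tmul g h =>
    have h1 : B (incl 1) (incl h) = 0 := by
      rw [hB.even_symm _ (parity_incl 1), map_one, hB.apply_one, neg_zero]
    simp only [TensorProduct.map_tmul, AlgHom.toLinearMap_apply, tensorBracket_incl_right, h1,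
      TensorProduct.tmul_zero, add_zero, LinearMap.rTensor_tmul, LinearMap.comp_apply,
      LinearMap.id_apply]
    rw [map_one, one_mul]

theorem mixedCovariant (hB : IsSuperBracket B) (hS : ProlongsSklyanin B) {η : ℂ}
    (hM : MixedFamily η B) : MixedCovariant B := by
  rw [mixedFamily_iff hB] at hM
  have hL : ∀ i f, B (θ i) (incl f) = mixedHom η i f := fun i f => by rw [hM, mixedHom_apply]
  intro i f
  constructor
  · rw [hM, ΔL_apply, ΔL_θ, ΔA_apply, tensorBracket_inclL hB hS, bracketL_comulLθ i _ hL,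
      comulL_mixed]
    congr 1
    simp only [mixed_equivariance, derLeft_add, mixedHom_lTensor, map_add, add_mul,
      Finset.sum_add_distrib, Finset.mul_sum]
    congr 1
    rw [Finset.sum_comm]
    refine Finset.sum_congr rfl fun l _ => ?_
    have h (j : Fin 3) : (adMat i j ⊗ₜ 1 : FunAlg ⊗[ℂ] ExtAlg) = inclAL (adMat i j ⊗ₜ 1) := by
      rw [inclAL_tmul, map_one]
    simp only [Fin.sum_univ_three, derLeft_add, derLeft_smul, map_add, add_mul, map_mul, h,
      derRight_mixedCoeff, mul_assoc]
  -- On the right side only right-invariance of the coefficient fields is needed.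
  · rw [tensorBracket_ΔR_θ hB, ΔR_apply, hM, comulR_mixed]
    rw [show B (θ i) ∘ₗ incl.toLinearMap = mixedHom η i from LinearMap.ext (hL i)]

/-! ### Covariance of the brackets of forms -/

theorem bracketL_comulLθ_comulLθ (B : Bracket) (i j : Fin 3) :
    bracketL B (comulLθ i) (comulLθ j) = ∑ k, ∑ l,
      (sklyanin (adMat i k) (adMat j l) ⊗ₜ (θ k * θ l) + (adMat i k * adMat j l) ⊗ₜ B (θ k) (θ l)) := by
  simp only [comulLθ, map_sum, LinearMap.sum_apply, bracketL_tmul]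
  exact Finset.sum_comm

theorem comulLθ_mul_comulLθ (i j : Fin 3) : comulLθ i * comulLθ j =
    ∑ k, ∑ l, (adMat i k * adMat j l) ⊗ₜ (θ k * θ l) := by
  simp only [comulLθ, Finset.sum_mul_sum, Algebra.TensorProduct.tmul_mul_tmul]

theorem tensorBracket_ΔR_θ_θ (hB : IsSuperBracket B) (i j : Fin 3) :
    tensorBracket B (ΔR (θ i)) (ΔR (θ j)) = B (θ i) (θ j) ⊗ₜ incl 1 := by
  rw [ΔR_θ, ΔR_θ, tensorBracket_incl_right, map_one, hB.apply_one, TensorProduct.tmul_zero,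
    add_zero, mul_one]

set_option maxHeartbeats 4000000 in
theorem formsCovariant (hB : IsSuperBracket B) (hS : ProlongsSklyanin B) (hF : FormsTable B) :
    FormsCovariant B := by
  obtain ⟨⟨r10, r20, r21⟩, r⟩ := θ_relations
  obtain ⟨h10, h20, h21⟩ := hF.symm hB
  have h2 (x : ExtAlg) : 2 * x = (2 : ℂ) • x := by rw [two_mul, two_smul]
  have h2' (x : ExtAlg) : -2 * x = -((2 : ℂ) • x) := by rw [neg_mul, h2]
  have t00 := hF.θ00
  have t01 := hF.θ01
  have t02 := hF.θ02
  simp only [h2, h2'] at t00 t01 t02 h10 h20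
  -- The tensors `1 ⊗ θᵏθˡ` are replaced by opaque symbols over `𝒜`, so that `match_scalars`
  -- compares their coefficients.
  obtain ⟨W, hW⟩ : ∃ W : Fin 3 → Fin 3 → FunAlg ⊗[ℂ] ExtAlg,
      ∀ (f : FunAlg) (k l : Fin 3), f ⊗ₜ (θ k * θ l) = f • W k l :=
    ⟨fun k l => 1 ⊗ₜ (θ k * θ l), fun f k l => by
      rw [TensorProduct.smul_tmul', smul_eq_mul, mul_one]⟩
  intro i j
  constructor
  · rw [ΔL_θ, ΔL_θ, tensorBracket_inclL hB hS, ΔL_apply, bracketL_comulLθ_comulLθ]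
    congr 1
    fin_cases i <;> fin_cases j <;>
      simp only [Fin.zero_eta, Fin.mk_one, Fin.reduceFinMk, Fin.sum_univ_three, t00, t01, t02,
        h10, h20, h21, hF.θ11, hF.θ12, hF.θ22, map_neg, map_smul, map_mul, map_zero, comulL_θ,
        comulLθ_mul_comulLθ, r10, r20, r21, r, TensorProduct.tmul_zero, add_zero, zero_add,
        TensorProduct.tmul_neg, TensorProduct.tmul_smul] <;>
      rw [adMat_eq] <;>
      simp [hW, sklyanin, derivation_ofNat, pow_two] <;>
      match_scalars <;> simp [map_ofNat] <;> ring
  · rw [tensorBracket_ΔR_θ_θ hB]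
    have key (k l : Fin 3) : ΔR (θ k * θ l) = (θ k * θ l) ⊗ₜ incl 1 := by
      rw [ΔR_apply, map_mul, comulR_θ, comulR_θ, Algebra.TensorProduct.tmul_mul_tmul, mul_one]
      rfl
    fin_cases i <;> fin_cases j <;>
      simp [t00, t01, t02, h10, h20, h21, hF.θ11, hF.θ12, hF.θ22, key, TensorProduct.neg_tmul,
        TensorProduct.smul_tmul']

end

section
variable {B : Bracket}

/-! ### Consequences of covariance -/

/-- Applying the counit to the left factor of `𝒜 ⊗ 𝒜`. -/
def counitLeft : FunAlg ⊗[ℂ] FunAlg →ₐ[ℂ] FunAlg :=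
  Algebra.TensorProduct.lift ((Algebra.ofId ℂ FunAlg).comp counit) (AlgHom.id ℂ FunAlg)
    fun _ _ => Commute.all _ _

theorem counitLeft_tmul (f h : FunAlg) :
    counitLeft (f ⊗ₜ h) = algebraMap ℂ FunAlg (counit f) * h := rfl

theorem counitLeft_comul (f : FunAlg) : counitLeft (comul f) = f := by
  induction f using FunAlg.induction with
  | scalar r => rw [AlgHom.commutes, AlgHom.commutes]
  | ha => simp [comul_a, counitLeft_tmul]
  | hb => simp [comul_b, counitLeft_tmul]
  | hc => simp [comul_c, counitLeft_tmul]
  | hd => simp [comul_d, counitLeft_tmul]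
  | add f g hf hg => rw [map_add, map_add, hf, hg]
  | mul f g hf hg => rw [map_mul, map_mul, hf, hg]

/-- Applying the counit to the right factor of `𝒜 ⊗ 𝒜`. -/
def counitRight : FunAlg ⊗[ℂ] FunAlg →ₐ[ℂ] FunAlg :=
  Algebra.TensorProduct.lift (AlgHom.id ℂ FunAlg) ((Algebra.ofId ℂ FunAlg).comp counit)
    fun _ _ => Commute.all _ _

theorem counitRight_tmul (f h : FunAlg) :
    counitRight (f ⊗ₜ h) = f * algebraMap ℂ FunAlg (counit h) := rfl

theorem counitRight_comul (f : FunAlg) : counitRight (comul f) = f := by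
  induction f using FunAlg.induction with
  | scalar r => rw [AlgHom.commutes, AlgHom.commutes]
  | ha => simp [comul_a, counitRight_tmul]
  | hb => simp [comul_b, counitRight_tmul]
  | hc => simp [comul_c, counitRight_tmul]
  | hd => simp [comul_d, counitRight_tmul]
  | add f g hf hg => rw [map_add, map_add, hf, hg]
  | mul f g hf hg => rw [map_mul, map_mul, hf, hg]

theorem counitRight_derLeft (D : Derivation ℂ FunAlg FunAlg) (u : FunAlg ⊗[ℂ] FunAlg) :
    counitRight (derLeft D u) = D (counitRight u) := by
  induction u using TensorProduct.induction_on with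
  | zero => simp
  | add u v hu hv => simp only [map_add, hu, hv]
  | tmul f h =>
    rw [derLeft_tmul, counitRight_tmul, counitRight_tmul, Derivation.leibniz,
      Derivation.map_algebraMap, smul_zero, zero_add, smul_eq_mul, mul_comm]

theorem counitRight_derRight_vH (f : FunAlg) : counitRight (derRight vH (comul f)) = wH f := by
  rw [derRight_vH, counitRight_derLeft, counitRight_comul]

theorem counitRight_derRight_vE (f : FunAlg) : counitRight (derRight vE (comul f)) = wF f := by
  rw [derRight_vE, counitRight_derLeft, counitRight_comul]

theorem counitRight_derRight_vF (f : FunAlg) : counitRight (derRight vF (comul f)) = wE f := by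
  rw [derRight_vF, counitRight_derLeft, counitRight_comul]

/-- The right-invariant vector field with components `p` along `vH`, `vE`, `vF`. -/
def rightField (p : Fin 3 → ℂ) : Derivation ℂ FunAlg FunAlg := p 0 • vH + p 1 • vE + p 2 • vF

/-- The left-invariant vector field with components `p` along `wH`, `wF`, `wE`. -/
def leftField (p : Fin 3 → ℂ) : Derivation ℂ FunAlg FunAlg := p 0 • wH + p 1 • wF + p 2 • wE

theorem rightField_apply (p : Fin 3 → ℂ) (f : FunAlg) :
    rightField p f = p 0 • vH f + p 1 • vE f + p 2 • vF f := rfl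

theorem leftField_apply (p : Fin 3 → ℂ) (f : FunAlg) :
    leftField p f = p 0 • wH f + p 1 • wF f + p 2 • wE f := rfl

theorem counitRight_derRight_rightField (p : Fin 3 → ℂ) (f : FunAlg) :
    counitRight (derRight (rightField p) (comul f)) = leftField p f := by
  have h (u : FunAlg ⊗[ℂ] FunAlg) : derRight (rightField p) u =
      p 0 • derRight vH u + p 1 • derRight vE u + p 2 • derRight vF u := by
    induction u using TensorProduct.induction_on with
    | zero => simp
    | add u v hu hv => simp only [map_add, hu, hv, smul_add]; abel
    | tmul f h =>
      simp only [derRight_tmul, rightField_apply, TensorProduct.tmul_add, TensorProduct.tmul_smul]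
  rw [h, leftField_apply, map_add, map_add, map_smul, map_smul, map_smul, counitRight_derRight_vH,
    counitRight_derRight_vE, counitRight_derRight_vF]

/-- A derivation of `𝒜` that commutes with right translations. -/
theorem exists_rightField {D : FunAlg →ₗ[ℂ] FunAlg}
    (hD : ∀ f g, D (f * g) = g • D f + f • D g)
    (h : ∀ f, comul (D f) = D.rTensor FunAlg (comul f)) : ∃ p, ∀ f, D f = rightField p f := by
  have h1 : D 1 = 0 := by simpa using hD 1 1
  -- Applying the counit on the left shows that `D` is determined by its tangent vector at the unit.
  have key (f : FunAlg) : D f = counitLeft (D.rTensor FunAlg (comul f)) := by rw [← h, counitLeft_comul]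
  have ka : D a = counit (D a) • a + counit (D b) • c := by
    rw [key a]; simp [comul_a, counitLeft_tmul, Algebra.smul_def]
  have kb : D b = counit (D a) • b + counit (D b) • d := by
    rw [key b]; simp [comul_b, counitLeft_tmul, Algebra.smul_def]
  have kc : D c = counit (D c) • a + counit (D d) • c := by
    rw [key c]; simp [comul_c, counitLeft_tmul, Algebra.smul_def]
  have kd : D d = counit (D c) • b + counit (D d) • d := by
    rw [key d]; simp [comul_d, counitLeft_tmul, Algebra.smul_def]
  -- Differentiating `det = 1` at the unit: the tangent matrix is traceless, which leaves three
  -- constants.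
  have ktr : counit (D d) = -counit (D a) := by
    have e := congrArg (fun f => counit (D f)) det_relation
    simp only [map_sub, hD, h1, map_zero, smul_eq_mul, map_add, map_mul, counit_a, counit_b,
      counit_c, counit_d] at e
    linear_combination e
  refine ⟨![counit (D a), counit (D b), counit (D c)], LinearMap.congr_fun
    (IsSuperBracket.eq_on_incl (D' := (rightField _).toLinearMap) (fun r => ?_) hD (fun f g => ?_)
      ?_ ?_ ?_ ?_)⟩
  · simp [Algebra.algebraMap_eq_smul_one, h1]
  · simp [add_comm]
  · rw [ka]; simp [rightField_apply]
  · rw [kb]; simp [rightField_apply]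
  · rw [kc, ktr]; simp [rightField_apply, add_comm]
  · rw [kd, ktr]; simp [rightField_apply, add_comm]

theorem rTensor_inclAR (φ : ExtAlg →ₗ[FunAlg] FunAlg) (u : FunAlg ⊗[ℂ] FunAlg) (w : ExtAlg) :
    (φ.restrictScalars ℂ).rTensor FunAlg (inclAR u * (w ⊗ₜ 1)) = u * (φ w ⊗ₜ 1) := by
  induction u using TensorProduct.induction_on with
  | zero => simp
  | add u v hu hv => simp only [map_add, add_mul, hu, hv]
  | tmul f h => simp [inclAR_tmul, incl_mul]

theorem rTensor_inclAR_θ (φ : ExtAlg →ₗ[FunAlg] FunAlg) (f : FunAlg) (i : Fin 3) :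
    (φ.restrictScalars ℂ).rTensor FunAlg (comulR (f • θ i)) = comul f * (φ (θ i) ⊗ₜ 1) := by
  rw [comulR_smul, comulR_θ, rTensor_inclAR]

theorem rTensor_inclAR_vol (φ : ExtAlg →ₗ[FunAlg] FunAlg) (f : FunAlg) :
    (φ.restrictScalars ℂ).rTensor FunAlg (comulR (f • vol)) = comul f * (φ vol ⊗ₜ 1) := by
  rw [comulR_smul, ← rTensor_inclAR]
  simp [vol, comulR_θ]

/-- As `Δ_R` fixes the forms, it acts on coefficients alone; right covariance of a bracket thus
becomes right invariance of each coefficient. -/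
theorem rTensor_coeff₁_comulR {x : ExtAlg} (hx : parity x = -x) (i : Fin 3) :
    ((coeff₁ i).restrictScalars ℂ).rTensor FunAlg (comulR x) = comul (coeff₁ i x) := by
  conv_lhs => rw [odd_expansion hx]
  simp only [map_add, rTensor_inclAR_θ, rTensor_inclAR_vol]
  have h1 : (1 ⊗ₜ 1 : FunAlg ⊗[ℂ] FunAlg) = 1 := rfl
  fin_cases i <;> simp [coeff₁_θ, h1]

theorem rTensor_coeff₃_comulR {x : ExtAlg} (hx : parity x = -x) :
    (coeff₃.restrictScalars ℂ).rTensor FunAlg (comulR x) = comul (coeff₃ x) := by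
  conv_lhs => rw [odd_expansion hx]
  simp only [map_add, rTensor_inclAR_θ, rTensor_inclAR_vol]
  have h1 : (1 ⊗ₜ 1 : FunAlg ⊗[ℂ] FunAlg) = 1 := rfl
  simp [h1]

theorem map_id_incl_injective :
    Function.Injective (TensorProduct.map (LinearMap.id : ExtAlg →ₗ[ℂ] ExtAlg)
      incl.toLinearMap) := by
  refine Function.LeftInverse.injective
    (g := TensorProduct.map LinearMap.id (aug.restrictScalars ℂ)) fun u => ?_
  induction u using TensorProduct.induction_on with
  | zero => simp
  | tmul f x => simp
  | add u v hu hv => rw [map_add, map_add, hu, hv]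

theorem comulR_bracket (hB : IsSuperBracket B) (hC : MixedCovariant B) (i : Fin 3) (f : FunAlg) :
    comulR (B (θ i) (incl f)) = (B (θ i) ∘ₗ incl.toLinearMap).rTensor FunAlg (comul f) := by
  have h := (hC i f).2
  rw [tensorBracket_ΔR_θ hB, ΔR_apply] at h
  exact map_id_incl_injective h

theorem parity_bracket_θ_incl (hB : IsSuperBracket B) (i : Fin 3) (f : FunAlg) :
    parity (B (θ i) (incl f)) = -B (θ i) (incl f) := by
  rw [hB.parity_map, parity_θ, parity_incl, map_neg, LinearMap.neg_apply]

theorem exists_rightField_of_mixedCovariant (hB : IsSuperBracket B) (hC : MixedCovariant B)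
    (i : Fin 3) {φ : ExtAlg →ₗ[FunAlg] FunAlg} (hφ : ∀ x, parity x = -x →
      (φ.restrictScalars ℂ).rTensor FunAlg (comulR x) = comul (φ x)) :
    ∃ p, ∀ f, φ (B (θ i) (incl f)) = rightField p f := by
  refine exists_rightField (D := φ.restrictScalars ℂ ∘ₗ B (θ i) ∘ₗ incl.toLinearMap) ?_ ?_
  · intro f g
    simp only [LinearMap.comp_apply, AlgHom.toLinearMap_apply, map_mul]
    rw [incl_mul, hB.apply_smul, mul_incl, map_add]
    simp
  · intro f
    rw [LinearMap.rTensor_comp, LinearMap.comp_apply (LinearMap.rTensor _ _), ← comulR_bracket hB hC,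
      hφ _ (parity_bracket_θ_incl hB i f)]
    rfl

theorem comulL_bracket (hB : IsSuperBracket B) (hS : ProlongsSklyanin B) (hC : MixedCovariant B)
    (i : Fin 3) (f : FunAlg) : comulL (B (θ i) (incl f)) =
      ∑ j, (inclAL (derLeft (hamiltonian (adMat i j)) (comul f)) * (1 ⊗ₜ θ j)
        + (adMat i j ⊗ₜ 1) * (B (θ j) ∘ₗ incl.toLinearMap).lTensor FunAlg (comul f)) := by
  have h := (hC i f).1
  rw [ΔL_apply, ΔL_θ, ΔA_apply, tensorBracket_inclL hB hS] at h
  rw [inclL_injective h, bracketL_comulLθ i _ (L := fun i => B (θ i) ∘ₗ incl.toLinearMap)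
    fun _ _ => rfl]

/-- The map `f ⊗ x ↦ ε(φ x) f`. -/
def counitCoeff (φ : ExtAlg →ₗ[FunAlg] FunAlg) : FunAlg ⊗[ℂ] ExtAlg →ₗ[ℂ] FunAlg :=
  counitRight.toLinearMap ∘ₗ (φ.restrictScalars ℂ).lTensor FunAlg

theorem counitCoeff_tmul (φ : ExtAlg →ₗ[FunAlg] FunAlg) (f : FunAlg) (x : ExtAlg) :
    counitCoeff φ (f ⊗ₜ x) = f * algebraMap ℂ FunAlg (counit (φ x)) := rfl

theorem counitCoeff_inclAL (φ : ExtAlg →ₗ[FunAlg] FunAlg) (u : FunAlg ⊗[ℂ] FunAlg)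
    (v : FunAlg ⊗[ℂ] ExtAlg) :
    counitCoeff φ (inclAL u * v) = counitRight u * counitCoeff φ v := by
  induction u using TensorProduct.induction_on with
  | zero => simp
  | add u w hu hw => simp only [map_add, add_mul, hu, hw]
  | tmul f h =>
    induction v using TensorProduct.induction_on with
    | zero => simp
    | add v w hv hw => simp only [map_add, mul_add, hv, hw]
    | tmul g x =>
      rw [inclAL_tmul, Algebra.TensorProduct.tmul_mul_tmul, counitCoeff_tmul, counitCoeff_tmul,
        counitRight_tmul, incl_mul, map_smul, smul_eq_mul, map_mul, map_mul]
      ring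

theorem counitCoeff_comulL_smul (φ : ExtAlg →ₗ[FunAlg] FunAlg) (f : FunAlg) (x : ExtAlg) :
    counitCoeff φ (comulL (f • x)) = f * counitCoeff φ (comulL x) := by
  rw [comulL_smul, counitCoeff_inclAL, counitRight_comul]

/-- A right-invariant field on the right factor moves through the middle of the product; evaluating
that factor at the unit leaves the left-invariant field with the same components. -/
theorem counitCoeff_lTensor (φ : ExtAlg →ₗ[FunAlg] FunAlg) {p : Fin 3 → ℂ}
    {L : FunAlg →ₗ[ℂ] ExtAlg} (hL : ∀ f, φ (L f) = rightField p f) (f : FunAlg) :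
    counitCoeff φ (L.lTensor FunAlg (comul f)) = leftField p f := by
  rw [counitCoeff, LinearMap.comp_apply, ← LinearMap.comp_apply (LinearMap.lTensor _ _),
    ← LinearMap.lTensor_comp, AlgHom.toLinearMap_apply, ← counitRight_derRight_rightField, derRight]
  congr 3
  exact LinearMap.ext hL

theorem counitCoeff_comulL_bracket (hB : IsSuperBracket B) (hS : ProlongsSklyanin B)
    (hC : MixedCovariant B) {φ : ExtAlg →ₗ[FunAlg] FunAlg} {p : Fin 3 → Fin 3 → ℂ}
    (hp : ∀ j f, φ (B (θ j) (incl f)) = rightField (p j) f) (i : Fin 3) (f : FunAlg) :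
    counitCoeff φ (comulL (B (θ i) (incl f))) =
      ∑ j, (sklyanin (adMat i j) f * algebraMap ℂ FunAlg (counit (φ (θ j)))
        + adMat i j * leftField (p j) f) := by
  rw [comulL_bracket hB hS hC, map_sum]
  refine Finset.sum_congr rfl fun j _ => ?_
  have h : (adMat i j ⊗ₜ 1 : FunAlg ⊗[ℂ] ExtAlg) = inclAL (adMat i j ⊗ₜ 1) := by
    rw [inclAL_tmul, map_one]
  rw [map_add, counitCoeff_inclAL, counitRight_derLeft, counitRight_comul, counitCoeff_tmul,
    one_mul, h, counitCoeff_inclAL, counitRight_tmul,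
    counitCoeff_lTensor φ (p := p j) (fun f => hp j f)]
  simp [hamiltonian_apply]

/-- The adjoint representation has determinant one; as a polynomial the determinant is `(ad - bc)³`.
-/
theorem comulL_vol : comulL vol = 1 ⊗ₜ vol := by
  obtain ⟨⟨r10, r20, r21⟩, r⟩ := θ_relations
  have hdet : adMat.det = 1 := by
    have h : adMat.det = (a * d - b * c) ^ 3 := by
      rw [adMat_eq, Matrix.det_fin_three]; simp; ring
    rw [h, det_relation, one_pow]
  have z1 (i j : Fin 3) : θ i * θ i * θ j = 0 := by rw [r, zero_mul]
  have z2 (i j : Fin 3) : θ j * θ i * θ i = 0 := by rw [mul_assoc, r, mul_zero]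
  have z3 (i j : Fin 3) : θ i * θ j * θ i = 0 := by
    rw [θ_mul_swap i j, neg_mul, mul_assoc, r, mul_zero, neg_zero]
  have e1 : θ 0 * θ 2 * θ 1 = -vol := by rw [mul_assoc, r21, mul_neg, ← mul_assoc, vol]
  have e2 : θ 1 * θ 0 * θ 2 = -vol := by rw [r10, neg_mul, vol]
  have e3 : θ 1 * θ 2 * θ 0 = vol := by rw [mul_assoc, r20, mul_neg, ← mul_assoc, e2, neg_neg]
  have e4 : θ 2 * θ 0 * θ 1 = vol := by rw [r20, neg_mul, e1, neg_neg]
  have e5 : θ 2 * θ 1 * θ 0 = -vol := by rw [r21, neg_mul, e3]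
  rw [← hdet, Matrix.det_fin_three]
  conv_lhs => rw [vol, map_mul, map_mul, comulL_θ, comulL_θ, comulL_θ]
  simp only [comulLθ, Fin.sum_univ_three, add_mul, mul_add, Algebra.TensorProduct.tmul_mul_tmul,
    z1, z2, z3, e1, e2, e3, e4, e5, ← vol.eq_1, TensorProduct.tmul_zero, add_zero, zero_add,
    TensorProduct.tmul_neg, TensorProduct.sub_tmul, TensorProduct.add_tmul]
  abel

theorem counitCoeff_comulL_θ (φ : ExtAlg →ₗ[FunAlg] FunAlg) (i : Fin 3) :
    counitCoeff φ (comulL (θ i)) = ∑ j, adMat i j * algebraMap ℂ FunAlg (counit (φ (θ j))) := by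
  rw [comulL_θ, comulLθ, map_sum]
  rfl

theorem counitCoeff_comulL_vol (φ : ExtAlg →ₗ[FunAlg] FunAlg) :
    counitCoeff φ (comulL vol) = algebraMap ℂ FunAlg (counit (φ vol)) := by
  rw [comulL_vol, counitCoeff_tmul, one_mul]

/-- The equations imposed by covariance on the coefficients of `{θⁱ, ·}`. -/
theorem equivariance_of_mixedCovariant (hB : IsSuperBracket B) (hS : ProlongsSklyanin B)
    (hC : MixedCovariant B) {p : Fin 3 → Fin 3 → Fin 3 → ℂ} {q : Fin 3 → Fin 3 → ℂ}
    (hp : ∀ i j f, coeff₁ j (B (θ i) (incl f)) = rightField (p i j) f)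
    (hq : ∀ i f, coeff₃ (B (θ i) (incl f)) = rightField (q i) f) :
    (∀ i l f, ∑ j, adMat j l * rightField (p i j) f =
      sklyanin (adMat i l) f + ∑ j, adMat i j * leftField (p j l) f) ∧
    ∀ i f, rightField (q i) f = ∑ j, adMat i j * leftField (q j) f := by
  constructor
  · intro i l f
    have h := counitCoeff_comulL_bracket hB hS hC (fun j f => hp j l f) i f
    -- The `θʲ` mix through `adMat` while the volume form is invariant, so the equations for linear
    -- and cubic coefficients decouple.
    rw [odd_expansion (parity_bracket_θ_incl hB i f)] at h
    simp only [map_add, counitCoeff_comulL_smul, counitCoeff_comulL_θ, counitCoeff_comulL_vol,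
      coeff₁_θ, coeff₁_vol, hp] at h
    fin_cases l <;> simp [Fin.sum_univ_three] at h ⊢ <;> linear_combination h
  · intro i f
    have h := counitCoeff_comulL_bracket hB hS hC hq i f
    rw [odd_expansion (parity_bracket_θ_incl hB i f)] at h
    simpa [counitCoeff_comulL_smul, counitCoeff_comulL_θ, counitCoeff_comulL_vol, hq] using h

end

section
open IsSuperBracket
variable {B : Bracket}

/-! ### Solving the equivariance equations -/

-- Invariance under the torus: a coefficient can be nonzero only if the weights of the two forms and
-- of the vector field balance. The factor in `hne` is the difference of these weights at `diag(2,
-- 1/2)`.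
set_option maxHeartbeats 1000000 in
theorem linear_coeff_weights {p : Fin 3 → Fin 3 → Fin 3 → ℂ}
    (h : ∀ i l f, ∑ j, adMat j l * rightField (p i j) f =
      sklyanin (adMat i l) f + ∑ j, adMat i j * leftField (p j l) f) :
    (p 0 0 1 = 0 ∧ p 0 0 2 = 0 ∧ p 0 1 0 = 0 ∧ p 0 1 2 = 0 ∧ p 0 2 0 = 0 ∧ p 0 2 1 = 0) ∧
    (p 1 0 0 = 0 ∧ p 1 0 1 = 0 ∧ p 1 1 1 = 0 ∧ p 1 1 2 = 0 ∧ p 1 2 0 = 0 ∧ p 1 2 1 = 0 ∧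
      p 1 2 2 = 0) ∧
    (p 2 0 0 = 0 ∧ p 2 0 2 = 0 ∧ p 2 1 0 = 0 ∧ p 2 1 1 = 0 ∧ p 2 1 2 = 0 ∧ p 2 2 1 = 0 ∧
      p 2 2 2 = 0) := by
  have weight (i l k : Fin 3) (hne : ![1, 4, 4⁻¹] l * ![2, 2⁻¹, 2] k
      - ![1, 4, 4⁻¹] i * ![2, 2, 2⁻¹] k ≠ (0 : ℂ)) : p i l k = 0 := by
    refine (mul_eq_zero.mp ?_).resolve_left hne
    -- At a diagonal point the Sklyanin bracket vanishes and `adMat` is diagonal; the test functions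
    -- `a, b, c` see only the components along `vH, vE, vF`, and along `wH, wF, wE` on the
    -- left-invariant side.
    have e := congrArg (point (2 : ℂ) 0 0 2⁻¹ (by norm_num)) (h i l (![a, b, c] k))
    rw [adMat_eq] at e
    clear hne
    revert e
    fin_cases i <;> fin_cases l <;> fin_cases k <;>
      simp [Fin.sum_univ_three, rightField_apply, leftField_apply, sklyanin, derivation_ofNat,
        map_ofNat, -mul_eq_zero, -mul_eq_mul_left_iff, -mul_eq_mul_right_iff] <;>
      intro e <;>
      first
      | linear_combination e
      | linear_combination 4 * e
      | linear_combination 4⁻¹ * e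
  refine ⟨⟨?_, ?_, ?_, ?_, ?_, ?_⟩, ⟨?_, ?_, ?_, ?_, ?_, ?_, ?_⟩, ?_, ?_, ?_, ?_, ?_, ?_, ?_⟩ <;>
    apply weight <;> simp <;> norm_num

/-- Seven coefficients have weight zero. The torus cannot relate them, but a unipotent element does,
expressing all of them through `p 0 1 1`, which is `η`. -/
theorem rightField_eq_mixedCoeff {p : Fin 3 → Fin 3 → Fin 3 → ℂ}
    (h : ∀ i l f, ∑ j, adMat j l * rightField (p i j) f =
      sklyanin (adMat i l) f + ∑ j, adMat i j * leftField (p j l) f) :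
    ∃ η, ∀ i j, rightField (p i j) = mixedCoeff η i j := by
  have z := linear_coeff_weights h
  have u (i l : Fin 3) (f) := congrArg (point (1 : ℂ) 1 0 1 (by norm_num)) (h i l f)
  rw [adMat_eq] at u
  have e1 : p 0 0 0 = 1 + (p 0 2 2 + p 2 2 0) := by
    simpa [Fin.sum_univ_three, rightField_apply, leftField_apply, sklyanin, map_ofNat, z]
      using u 0 2 a
  have e2 : p 1 0 2 = -(p 0 2 2 * 2) := by
    simpa [Fin.sum_univ_three, rightField_apply, leftField_apply, sklyanin, map_ofNat, z]
      using u 1 2 c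
  have e3 : -p 1 1 0 = p 2 2 0 := by
    simpa [Fin.sum_univ_three, rightField_apply, leftField_apply, sklyanin, map_ofNat, z]
      using u 1 2 b
  have e4 : p 1 0 2 + p 1 1 0 = 2 + p 2 2 0 := by
    simpa [Fin.sum_univ_three, rightField_apply, leftField_apply, sklyanin, map_ofNat, z]
      using u 1 2 d
  have e5 : p 1 1 0 = -2 + (-(p 0 1 1 * 2) + -p 1 1 0) := by
    simpa [Fin.sum_univ_three, rightField_apply, leftField_apply, sklyanin, map_ofNat, z]
      using u 1 1 b
  have e6 : p 2 0 1 + p 2 2 0 = 2 + -p 2 2 0 := by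
    simpa [Fin.sum_univ_three, rightField_apply, leftField_apply, sklyanin, map_ofNat, z]
      using u 2 2 b
  have f1 : p 2 2 0 = 1 + p 0 1 1 := by linear_combination -e3 - e5 / 2
  have f2 : p 1 1 0 = -(1 + p 0 1 1) := by linear_combination -e3 - f1
  have f3 : p 1 0 2 = 4 + 2 * p 0 1 1 := by linear_combination e4 - f2 + f1
  have f4 : p 0 2 2 = -(2 + p 0 1 1) := by linear_combination (e2 - f3) / 2
  have f5 : p 0 0 0 = 0 := by linear_combination e1 + f4 + f1
  have f6 : p 2 0 1 = -2 * p 0 1 1 := by linear_combination e6 - 2 * f1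
  refine ⟨p 0 1 1, fun i j => ?_⟩
  fin_cases i <;> fin_cases j <;> ext f <;>
    simp [rightField_apply, mixedCoeff, z, f1, f2, f3, f4, f5, f6]

/-- The Sklyanin term is linear in the forms, so this system is homogeneous. It says that `q`
intertwines adjoint representations, hence is unique up to a factor `x`. -/
theorem cubic_coeff {q : Fin 3 → Fin 3 → ℂ}
    (h : ∀ i f, rightField (q i) f = ∑ j, adMat i j * leftField (q j) f) :
    ∃ x : ℂ, rightField (q 0) = x • vH ∧ rightField (q 1) = (2 * x) • vF ∧
      rightField (q 2) = (2 * x) • vE := by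
  have weight (i k : Fin 3) (hne : ![2, 2⁻¹, 2] k - ![1, 4, 4⁻¹] i * ![2, 2, 2⁻¹] k ≠ (0 : ℂ)) :
      q i k = 0 := by
    refine (mul_eq_zero.mp ?_).resolve_left hne
    have e := congrArg (point (2 : ℂ) 0 0 2⁻¹ (by norm_num)) (h i (![a, b, c] k))
    rw [adMat_eq] at e
    clear hne
    revert e
    fin_cases i <;> fin_cases k <;>
      simp [Fin.sum_univ_three, rightField_apply, leftField_apply,
        -mul_eq_zero, -mul_eq_mul_left_iff, -mul_eq_mul_right_iff] <;>
      intro e <;> linear_combination e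
  have z : (q 0 1 = 0 ∧ q 0 2 = 0) ∧ (q 1 0 = 0 ∧ q 1 1 = 0) ∧ (q 2 0 = 0 ∧ q 2 2 = 0) := by
    refine ⟨⟨?_, ?_⟩, ⟨?_, ?_⟩, ?_, ?_⟩ <;> apply weight <;> simp <;> norm_num
  have u (i : Fin 3) (f) := congrArg (point (1 : ℂ) 1 0 1 (by norm_num)) (h i f)
  rw [adMat_eq] at u
  have e1 : q 0 0 = -q 0 0 + q 2 1 := by
    simpa [Fin.sum_univ_three, rightField_apply, leftField_apply, map_ofNat, z] using u 0 b
  have e2 : q 1 2 = q 0 0 * 2 := by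
    simpa [Fin.sum_univ_three, rightField_apply, leftField_apply, map_ofNat, z] using u 1 d
  have e3 : q 2 1 = 2 * q 0 0 := by linear_combination -e1
  refine ⟨q 0 0, ?_, ?_, ?_⟩ <;> ext f <;> simp [rightField_apply, z, e2, e3, mul_comm]

theorem exists_of_mixedCovariant (hB : IsSuperBracket B) (hS : ProlongsSklyanin B)
    (hC : MixedCovariant B) : ∃ η x : ℂ, ∀ i f,
      B (θ i) (incl f) = mixed η i f + (x • (![vH, (2 : ℂ) • vF, (2 : ℂ) • vE] i) f) • vol := by
  choose p hp using fun i j => exists_rightField_of_mixedCovariant hB hC i (φ := coeff₁ j)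
    fun x hx => rTensor_coeff₁_comulR hx j
  choose q hq using fun i => exists_rightField_of_mixedCovariant hB hC i (φ := coeff₃)
    fun x hx => rTensor_coeff₃_comulR hx
  obtain ⟨h1, h2⟩ := equivariance_of_mixedCovariant hB hS hC hp hq
  obtain ⟨η, hη⟩ := rightField_eq_mixedCoeff h1
  obtain ⟨x, hx0, hx1, hx2⟩ := cubic_coeff h2
  refine ⟨η, x, fun i f => ?_⟩
  rw [odd_expansion (parity_bracket_θ_incl hB i f), hp, hp, hp, hq, hη, hη, hη, mixed,
    Fin.sum_univ_three]
  fin_cases i <;> simp [hx0, hx1, hx2, mul_smul, smul_comm x]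

theorem exists_mixedFamily (hB : IsSuperBracket B) (hS : ProlongsSklyanin B)
    (hC : MixedCovariant B) (hL : MixedLinear B) : ∃ η, MixedFamily η B := by
  obtain ⟨η, x, h⟩ := exists_of_mixedCovariant hB hS hC
  have h3 : ∀ y ∈ Submodule.span FunAlg (Set.range θ), coeff₃ y = 0 := by
    intro y hy
    induction hy using Submodule.span_induction with
    | mem y hy => obtain ⟨i, rfl⟩ := hy; exact coeff₃_θ i
    | zero => exact map_zero _
    | add y z _ _ hy hz => rw [map_add, hy, hz, add_zero]
    | smul f y _ hy => rw [map_smul, hy, smul_zero]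
  -- The volume coefficient of `{θ⁰, a}` is `x a`, with value `x` at the unit.
  have h0 := congrArg counit (h3 _ (hL 0 0 0))
  rw [← a, h] at h0
  have hx : x = 0 := by simpa [mixed] using h0
  exact ⟨η, (mixedFamily_iff hB η).mpr fun i f => by rw [h, hx, zero_smul, zero_smul, add_zero]⟩

/-- Only the trace of the linear coefficients could contribute, and it is `-(1 + η) vH + (1 + η)
vH`; the cubic terms are killed by the remaining forms. -/
theorem bracket_vol_incl (hB : IsSuperBracket B) {η x : ℂ} (h : ∀ i f, B (θ i) (incl f) =
      mixed η i f + (x • (![vH, (2 : ℂ) • vF, (2 : ℂ) • vE] i) f) • vol) (f : FunAlg) :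
    B vol (incl f) = 0 := by
  obtain ⟨⟨r10, r20, r21⟩, r⟩ := θ_relations
  have z1 (i j : Fin 3) : θ i * θ i * θ j = 0 := by rw [r, zero_mul]
  have z2 (i j : Fin 3) : θ j * θ i * θ i = 0 := by rw [mul_assoc, r, mul_zero]
  have z3 (i j : Fin 3) : θ i * θ j * θ i = 0 := by
    rw [θ_mul_swap i j, neg_mul, mul_assoc, r, mul_zero, neg_zero]
  have v (i : Fin 3) : vol * θ i = 0 := by
    fin_cases i
    · change θ 0 * θ 1 * θ 2 * θ 0 = 0
      rw [mul_assoc, r20, mul_neg, ← mul_assoc, z3, zero_mul, neg_zero]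
    · change θ 0 * θ 1 * θ 2 * θ 1 = 0
      rw [mul_assoc, r21, mul_neg, ← mul_assoc, z2, zero_mul, neg_zero]
    · change θ 0 * θ 1 * θ 2 * θ 2 = 0
      rw [mul_assoc, r, mul_zero]
  have v' (i : Fin 3) : θ i * vol = 0 := by
    rw [mul_comm_of_odd (y := vol) (by simp [vol]), parity_θ, mul_neg, v, neg_zero]
  conv_lhs => rw [vol, hB.mul_apply_incl, hB.mul_apply_incl, h, h, h, mixed_zero_eq, mixed_one_eq,
    mixed_two_eq]
  simp only [add_mul, mul_add, smul_mul_assoc, mul_smul_comm, z3, r, v, v',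
    smul_zero, add_zero, zero_add, mul_assoc, mul_zero]
  module

/-- A single instance of the Jacobi identity decides both parameters: its `θ¹` coefficient restricts
`η`, and its volume coefficient then eliminates `x`. -/
theorem mixedFamily_of_jacobi (hB : IsSuperBracket B) (hS : ProlongsSklyanin B)
    (hC : MixedCovariant B) (hJ : jacobiator B 1 (θ 1) (incl a) (incl c) = 0) :
    MixedFamily (-2) B ∨ MixedFamily 0 B := by
  obtain ⟨η, x, h⟩ := exists_of_mixedCovariant hB hS hC
  have hv := bracket_vol_incl hB h
  have e : sklyanin a c = -(a * c) := by simp [sklyanin, mul_comm]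
  rw [jacobiator, one_smul, hS.apply_incl hB, ← neg_neg (B (incl a) _), ← hB.symm_incl, e, h, h,
    h] at hJ
  simp only [mixed_one_eq, map_add, LinearMap.add_apply, hB.smul_apply_incl, hv,
    hS.apply_incl hB, h, mixed_zero_eq, incl_mul] at hJ
  have h1 := congrArg (fun x => point (1 : ℂ) 0 1 1 (by norm_num) (coeff₁ 1 x)) hJ
  have h3 := congrArg (fun x => counit (coeff₃ x)) hJ
  simp [coeff₁_θ, map_ofNat, sklyanin, derivation_ofNat] at h1 h3
  have hη : η = -2 ∨ η = 0 := h1.imp (fun h1 => by linear_combination h1 / 2) id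
  -- At the unit the volume coefficient is `-4x` for `η = -2` and `4x` for `η = 0`.
  have hx : x = 0 := by
    rcases hη with rfl | rfl
    · linear_combination -h3 / 4
    · linear_combination h3 / 4
  have hM : MixedFamily η B :=
    (mixedFamily_iff hB η).mpr fun i f => by rw [h, hx, zero_smul, zero_smul, add_zero]
  rcases hη with rfl | rfl
  · exact .inl hM
  · exact .inr hM

theorem typeI_iff : TypeI B ↔ MixedFamily (-2) B := by
  constructor <;> rintro ⟨h1, h2, h3, h4, h5, h6, h7, h8, h9, h10, h11, h12⟩ <;> constructor <;>
    simp only [h1, h2, h3, h4, h5, h6, h7, h8, h9, h10, h11, h12] <;>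
    match_scalars <;> simp [map_ofNat] <;> ring

theorem typeII_iff : TypeII B ↔ MixedFamily 0 B := by
  constructor <;> rintro ⟨h1, h2, h3, h4, h5, h6, h7, h8, h9, h10, h11, h12⟩ <;> constructor <;>
    simp only [h1, h2, h3, h4, h5, h6, h7, h8, h9, h10, h11, h12] <;>
    match_scalars <;> simp [map_ofNat]

end

section
variable {B : Bracket}

/-! ### Covariance determines the brackets of forms -/

theorem quadratic_expansion {x : ExtAlg}
    (hx : x ∈ Submodule.span FunAlg (Set.range fun k : Fin 3 × Fin 3 => θ k.1 * θ k.2)) :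
    x = coeff₂ 0 1 x • (θ 0 * θ 1) + coeff₂ 0 2 x • (θ 0 * θ 2) + coeff₂ 1 2 x • (θ 1 * θ 2) := by
  obtain ⟨⟨r10, r20, r21⟩, r⟩ := θ_relations
  induction hx using Submodule.span_induction with
  | mem y hy =>
    obtain ⟨⟨i, j⟩, rfl⟩ := hy
    fin_cases i <;> fin_cases j <;> simp [coeff₂_θ_mul_θ, r10, r20, r21, r]
  | zero => simp
  | add y z _ _ hy hz =>
    conv_lhs => rw [hy, hz]
    simp only [map_add]
    module
  | smul f y _ hy =>
    conv_lhs => rw [hy]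
    simp only [map_smul, smul_eq_mul]
    module

theorem rTensor_inclAR_θ_mul_θ (φ : ExtAlg →ₗ[FunAlg] FunAlg) (f : FunAlg) (i j : Fin 3) :
    (φ.restrictScalars ℂ).rTensor FunAlg (comulR (f • (θ i * θ j)))
      = comul f * (φ (θ i * θ j) ⊗ₜ 1) := by
  rw [comulR_smul, ← rTensor_inclAR, map_mul comulR, comulR_θ, comulR_θ,
    Algebra.TensorProduct.tmul_mul_tmul, mul_one]

/-- Right covariance gives `Δ f = f ⊗ 1` for each coefficient `f`; the counit on the left factor
then shows that `f` is a scalar. -/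
theorem coeff₂_const (hB : IsSuperBracket B) (hQ : FormsQuadratic B) (hC : FormsCovariant B)
    (i j : Fin 3) {k l : Fin 3} (hkl : k < l) : coeff₂ k l (B (θ i) (θ j)) =
      algebraMap ℂ FunAlg (counit (coeff₂ k l (B (θ i) (θ j)))) := by
  have h := (hC i j).2
  rw [tensorBracket_ΔR_θ_θ hB, ΔR_apply] at h
  have h' := map_id_incl_injective (a₂ := B (θ i) (θ j) ⊗ₜ 1) h
  rw [quadratic_expansion (hQ i j)] at h'
  have h1 : (1 ⊗ₜ 1 : FunAlg ⊗[ℂ] FunAlg) = 1 := rfl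
  have e := congrArg (fun u => counitLeft (((coeff₂ k l).restrictScalars ℂ).rTensor FunAlg u)) h'
  simp only [map_add, rTensor_inclAR_θ_mul_θ] at e
  fin_cases k <;> fin_cases l <;> first | exact absurd hkl (by decide) | skip
  all_goals simpa [coeff₂_θ_mul_θ, counitLeft_comul, counitLeft_tmul, h1] using e

/-- The equations imposed by covariance on the coefficients of `{θⁱ, θʲ}` with respect to
`θ⁰θ¹`, `θ⁰θ²`, `θ¹θ²`. -/
def FormsEquivariant (p : Fin 3 → Fin 3 → Fin 3 → ℂ) : Prop :=
  ∀ (i j m n : Fin 3) (x : FunAlg →ₐ[ℂ] ℂ),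
    p i j 0 * (x (adMat 0 m) * x (adMat 1 n) - x (adMat 0 n) * x (adMat 1 m))
      + p i j 1 * (x (adMat 0 m) * x (adMat 2 n) - x (adMat 0 n) * x (adMat 2 m))
      + p i j 2 * (x (adMat 1 m) * x (adMat 2 n) - x (adMat 1 n) * x (adMat 2 m)) =
    x (sklyanin (adMat i m) (adMat j n)) - x (sklyanin (adMat i n) (adMat j m))
      + ∑ k, ∑ l, x (adMat i k) * x (adMat j l) *
        !![0, p k l 0, p k l 1; -p k l 0, 0, p k l 2; -p k l 1, -p k l 2, 0] m n

theorem equivariance_of_formsCovariant (hB : IsSuperBracket B) (hS : ProlongsSklyanin B)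
    (hC : FormsCovariant B) {p : Fin 3 → Fin 3 → Fin 3 → ℂ}
    (hp : ∀ i j, B (θ i) (θ j) = p i j 0 • (θ 0 * θ 1) + p i j 1 • (θ 0 * θ 2)
      + p i j 2 • (θ 1 * θ 2)) : FormsEquivariant p := by
  intro i j m n x
  have hc (k l : Fin 3) : counit (coeff₂ m n (B (θ k) (θ l))) =
      !![0, p k l 0, p k l 1; -p k l 0, 0, p k l 2; -p k l 1, -p k l 2, 0] m n := by
    rw [hp]
    fin_cases m <;> fin_cases n <;> simp [coeff₂_θ_mul_θ]
  have h := (hC i j).1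
  rw [ΔL_θ, ΔL_θ, ΔL_apply, tensorBracket_inclL hB hS, bracketL_comulLθ_comulLθ] at h
  have e := congrArg (fun u => x (counitCoeff (coeff₂ m n) u)) (inclL_injective h)
  -- Products of two forms transform by the `2 × 2` minors of `adMat`.
  have aux (k l : Fin 3) : x (counitCoeff (coeff₂ m n) (comulL (θ k * θ l))) =
      x (adMat k m) * x (adMat l n) - x (adMat k n) * x (adMat l m) := by
    rw [map_mul, comulL_θ, comulL_θ, comulLθ_mul_comulLθ]
    simp only [map_sum, counitCoeff_tmul, map_mul, coeff₂_θ_mul_θ, AlgHom.commutes]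
    fin_cases m <;> fin_cases n <;> simp [Fin.sum_univ_three] <;> ring
  rw [hp] at e
  simp only [map_add, map_smul, aux, smul_eq_mul] at e
  rw [e]
  simp only [map_sum, map_add, counitCoeff_tmul, map_mul, coeff₂_θ_mul_θ, AlgHom.commutes,
    Finset.sum_add_distrib, hc]
  congr 1
  fin_cases m <;> fin_cases n <;> simp [Fin.sum_univ_three] <;> ring

set_option maxHeartbeats 2000000 in
theorem quadratic_coeff_weights {p : Fin 3 → Fin 3 → Fin 3 → ℂ} (h : FormsEquivariant p)
    (i j k : Fin 3) (hne : ![4, 4⁻¹, 1] k - ![1, 4, 4⁻¹] i * ![1, 4, 4⁻¹] j ≠ (0 : ℂ)) :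
    p i j k = 0 := by
  refine (mul_eq_zero.mp ?_).resolve_left hne
  -- The vectors encode the pairs `(0,1), (0,2), (1,2)` numbered by `k`, whose products have weights
  -- `4, 1/4, 1` at `diag(2, 1/2)`.
  have e := h i j (![0, 0, 1] k) (![1, 2, 2] k) (point (2 : ℂ) 0 0 2⁻¹ (by norm_num))
  rw [adMat_eq] at e
  clear hne
  revert e
  fin_cases i <;> fin_cases j <;> fin_cases k <;>
    simp [Fin.sum_univ_three, sklyanin, derivation_ofNat, map_ofNat,
      -mul_eq_zero, -mul_eq_mul_left_iff, -mul_eq_mul_right_iff] <;>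
    intro e <;> linear_combination e

theorem quadratic_coeff {p : Fin 3 → Fin 3 → Fin 3 → ℂ} (symm : ∀ i j k, p i j k = p j i k)
    (h : FormsEquivariant p) :
    (p 0 0 = ![0, 0, -2] ∧ p 0 1 = ![-2, 0, 0] ∧ p 0 2 = ![0, 2, 0]) ∧
    (p 1 1 = 0 ∧ p 1 2 = 0 ∧ p 2 2 = 0) := by
  have s := (⟨symm 1 0, symm 2 0, symm 2 1⟩ : _ ∧ _ ∧ _)
  have z : (p 0 0 0 = 0 ∧ p 0 0 1 = 0) ∧ (p 0 1 1 = 0 ∧ p 0 1 2 = 0) ∧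
      (p 0 2 0 = 0 ∧ p 0 2 2 = 0) ∧ (∀ k, p 1 1 k = 0) ∧ (p 1 2 0 = 0 ∧ p 1 2 1 = 0) ∧
      ∀ k, p 2 2 k = 0 := by
    refine ⟨⟨?_, ?_⟩, ⟨?_, ?_⟩, ⟨?_, ?_⟩, fun k => ?_, ⟨?_, ?_⟩, fun k => ?_⟩ <;>
      apply quadratic_coeff_weights h <;> try fin_cases k
    all_goals (simp; norm_num)
  -- Up to symmetry only four coefficients balance the weights. The Sklyanin term is nonzero at this
  -- unipotent point and fixes all four, so no parameter is left.
  have u (i j m n : Fin 3) := h i j m n (point (1 : ℂ) 1 0 1 (by norm_num))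
  rw [adMat_eq] at u
  have e1 := u 1 1 0 1
  have e2 := u 1 1 0 2
  have e3 := u 0 0 0 2
  have e4 := u 1 2 0 2
  simp [Fin.sum_univ_three, sklyanin, derivation_ofNat, map_ofNat, z, s] at e1 e2 e3 e4
  have f1 : p 0 1 0 = -2 := by linear_combination e1 / 4
  have f2 : p 0 2 1 = 2 := by linear_combination -e2 / 4
  have f3 : p 0 0 2 = -2 := by linear_combination -e3 / 2 - f2
  have f4 : p 1 2 2 = 0 := by linear_combination -e4 / 2 + f2
  refine ⟨⟨?_, ?_, ?_⟩, ?_, ?_, ?_⟩ <;> ext k <;> fin_cases k <;> simp [z, f1, f2, f3, f4]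

theorem formsTable_of_formsCovariant (hB : IsSuperBracket B) (hS : ProlongsSklyanin B)
    (hQ : FormsQuadratic B) (hC : FormsCovariant B) : FormsTable B := by
  obtain ⟨p, hp⟩ : ∃ p : Fin 3 → Fin 3 → Fin 3 → ℂ, ∀ i j, B (θ i) (θ j) =
      p i j 0 • (θ 0 * θ 1) + p i j 1 • (θ 0 * θ 2) + p i j 2 • (θ 1 * θ 2) := by
    refine ⟨fun i j => ![counit (coeff₂ 0 1 (B (θ i) (θ j))), counit (coeff₂ 0 2 (B (θ i) (θ j))),
      counit (coeff₂ 1 2 (B (θ i) (θ j)))], fun i j => ?_⟩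
    conv_lhs => rw [quadratic_expansion (hQ i j), coeff₂_const hB hQ hC i j (by decide),
      coeff₂_const hB hQ hC i j (k := 0) (l := 2) (by decide),
      coeff₂_const hB hQ hC i j (k := 1) (l := 2) (by decide)]
    simp
  have symm (i j k : Fin 3) : p i j k = p j i k := by
    have h := hB.odd_symm _ _ (parity_θ i) (parity_θ j)
    have e (m n : Fin 3) := congrArg (fun x => counit (coeff₂ m n x)) h
    rw [hp, hp] at e
    fin_cases k
    · simpa [coeff₂_θ_mul_θ] using e 0 1
    · simpa [coeff₂_θ_mul_θ] using e 0 2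
    · simpa [coeff₂_θ_mul_θ] using e 1 2
  obtain ⟨⟨h00, h01, h02⟩, h11, h12, h22⟩ :=
    quadratic_coeff symm (equivariance_of_formsCovariant hB hS hC hp)
  have h2 (x : ExtAlg) : 2 * x = (2 : ℂ) • x := by rw [two_mul, two_smul]
  constructor <;> simp [hp, h00, h01, h02, h11, h12, h22, h2]

/-! ### Existence and distinctness of the two structures -/

theorem formsQuadratic_of_formsTable (hB : IsSuperBracket B) (hF : FormsTable B) :
    FormsQuadratic B := by
  obtain ⟨⟨h00, h01, h02⟩, ⟨h10, h11, h12⟩, h20, h21, h22⟩ := hF.smul_form hB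
  have key (f : FunAlg) (i j : Fin 3) : f • (θ i * θ j) ∈
      Submodule.span FunAlg (Set.range fun k : Fin 3 × Fin 3 => θ k.1 * θ k.2) :=
    Submodule.smul_mem _ _ (Submodule.subset_span ⟨(i, j), rfl⟩)
  intro i j
  fin_cases i <;> fin_cases j <;>
    simp only [Fin.zero_eta, Fin.mk_one, Fin.reduceFinMk, h00, h01, h02, h10, h11, h12, h20, h21,
      h22] <;> first | exact key _ _ _ | exact Submodule.zero_mem _

theorem isGradedPoissonLie_familyBracket {η : ℂ} (hη : η = 0 ∨ η = -2) :
    IsGradedPoissonLie (familyBracket η) := by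
  have hB := isSuperBracket_familyBracket η
  have hS := prolongsSklyanin_familyBracket η
  have hF := formsTable_familyBracket η
  exact ⟨isGradedPoisson_familyBracket hη, hS, formsQuadratic_of_formsTable hB hF,
    funCovariant hB hS, mixedCovariant hB hS (mixedFamily_familyBracket η),
    formsCovariant hB hS hF⟩

theorem mixedFamily_of_isGradedPoisson (hP : IsGradedPoisson B) (hS : ProlongsSklyanin B)
    (hC : MixedCovariant B) : MixedFamily (-2) B ∨ MixedFamily 0 B := by
  have hB := hP.toIsGradedBracket.isSuperBracket
  refine mixedFamily_of_jacobi hB hS hC ?_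
  have h1 : θ 1 ∈ degPart 1 := mem_degPart_one.mpr (parity_θ 1)
  have ha : incl a ∈ degPart 0 := mem_degPart_zero.mpr (parity_incl a)
  have hc : incl c ∈ degPart 0 := mem_degPart_zero.mpr (parity_incl c)
  have h := hP.jacobi 1 0 0 _ _ _ h1 ha hc
  rw [hB.jacobi_eq_jacobiator h1 ha hc] at h
  simpa using h

theorem familyBracket_ne : familyBracket (-2) ≠ familyBracket 0 := by
  intro h
  -- In `{θ¹, a}` the coefficient of `θ¹` at the unit is `-(1 + η)`, which is `1` for one bracket
  -- and `-1` for the other.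
  have e := congrArg (fun B : Bracket => counit (coeff₁ 1 (B (θ 1) (incl a)))) h
  simp only [(mixedFamily_familyBracket _).θ1a] at e
  simp [coeff₁_θ] at e

end

end SL2Ext

end

open SL2Ext in
theorem theorem1 :
    -- exactly two graded Poisson-Lie structures prolong the Sklyanin bracket
    (∃ B₁ B₂ : Bracket, B₁ ≠ B₂ ∧
      (TypeI B₁ ∧ FormsTable B₁) ∧ (TypeII B₂ ∧ FormsTable B₂) ∧
      ∀ B : Bracket, IsGradedPoissonLie B ↔ B = B₁ ∨ B = B₂) ∧
    -- the brackets `{θ, t}` of a first-order structure are of type I or of type II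
    (∀ B : Bracket, IsGradedPoisson B → ProlongsSklyanin B → FirstOrder B →
      TypeI B ∨ TypeII B) ∧
    -- they are cut out by the Jacobi identity from a one-parameter family
    (∀ B : Bracket, IsGradedBracket B → ProlongsSklyanin B → MixedLinear B →
      (FirstOrder B ↔ ∃ η : ℂ, MixedFamily η B)) ∧
    (∀ η : ℂ, ∃ B : Bracket, IsGradedBracket B ∧ ProlongsSklyanin B ∧ MixedFamily η B) ∧
    (∀ (η : ℂ) (B : Bracket), IsGradedBracket B → ProlongsSklyanin B → MixedFamily η B →
      (MixedJacobi B ↔ η = 0 ∨ η = -2)) ∧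
    (∀ B : Bracket, (TypeI B ↔ MixedFamily (-2) B) ∧ (TypeII B ↔ MixedFamily 0 B)) ∧
    -- the brackets `{θ, θ}` are forced by bicovariance
    (∀ B : Bracket, IsGradedBracket B → ProlongsSklyanin B → FormsQuadratic B →
      (SecondOrder B ↔ FormsTable B)) := by
  have hmixed (B : Bracket) (hP : IsGradedPoisson B) (hS : ProlongsSklyanin B)
      (hC : MixedCovariant B) := mixedFamily_of_isGradedPoisson hP hS hC
  refine ⟨⟨familyBracket (-2), familyBracket 0, familyBracket_ne,
    ⟨typeI_iff.mpr (mixedFamily_familyBracket _), formsTable_familyBracket _⟩,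
    ⟨typeII_iff.mpr (mixedFamily_familyBracket _), formsTable_familyBracket _⟩,
    fun B => ⟨fun h => ?_, ?_⟩⟩, fun B hP hS hC => ?_, fun B hG hS hL => ⟨fun hC => ?_, ?_⟩,
    fun η => ⟨familyBracket η, (isSuperBracket_familyBracket η).isGradedBracket,
      prolongsSklyanin_familyBracket η, mixedFamily_familyBracket η⟩,
    fun η B hG hS hM => mixedJacobi_iff hG.isSuperBracket hS hM,
    fun B => ⟨typeI_iff, typeII_iff⟩, fun B hG hS hQ => ⟨fun hC => ?_, fun hF => ?_⟩⟩
  · have hB := h.poisson.toIsGradedBracket.isSuperBracket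
    -- Covariance alone fixes the brackets of forms; the Jacobi identity is needed only to choose
    -- `η` and to exclude the cubic term.
    have hF := formsTable_of_formsCovariant hB h.sklyanin h.quadratic h.formsCov
    exact (hmixed B h.poisson h.sklyanin h.mixedCov).imp
      (fun hM => eq_familyBracket hB h.sklyanin hM hF)
      fun hM => eq_familyBracket hB h.sklyanin hM hF
  · rintro (rfl | rfl)
    · exact isGradedPoissonLie_familyBracket (.inr rfl)
    · exact isGradedPoissonLie_familyBracket (.inl rfl)
  · exact (hmixed B hP hS hC.2).imp typeI_iff.mpr typeII_iff.mpr
  · exact exists_mixedFamily hG.isSuperBracket hS hC.2 hL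
  · rintro ⟨η, hM⟩
    exact ⟨funCovariant hG.isSuperBracket hS, mixedCovariant hG.isSuperBracket hS hM⟩
  · exact formsTable_of_formsCovariant hG.isSuperBracket hS hQ hC.2
  · exact ⟨funCovariant hG.isSuperBracket hS, formsCovariant hG.isSuperBracket hS hF⟩
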